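/- **Setting.** Let $N=2^n$, $n\ge 1$, $p\ge 1$, and let $A$ be a real symmetric $N^p\times N^p$ matrix with at most $s_A$ nonzero entries in each row ($s_A\ge1$), given by two quantum oracles: $|j,k\rangle|z\rangle\mapsto|j,k\rangle|z\oplus A_{jk}\rangle$ (fixed-point encoding of the entries) and $|j,l\rangle\mapsto|j,g_A(j,l)\rangle$ (column of the $l$-th nonzero entry of row $j$). Let $$f(x)=\tfrac12\,(x^{\otimes p})^TA\,x^{\otimes p},\qquad x\in\mathbb R^N .$$ For $\|x\|=1$ let $D(x)$ be the gradient operator, $\nabla f(x)=D(x)x$, i.e. $D(x)=\sum_{j=1}^p\mathrm{tr}_{i\neq j}\{(|x\rangle\langle x|^{\otimes(p-1)}\otimes 1_j)A\}$. Given a unit vector $x^{(0)}$, $T\ge 0$ and step sizes $\eta^{(t)}>0$, let $$x^{(t+1)}=\frac{x^{(t)}-\eta^{(t)}\nabla f(x^{(t)})}{\|x^{(t)}-\eta^{(t)}\nabla f(x^{(t)})\|},\qquad D^{(t)}=D(x^{(t)}).$$ Let $\Lambda_D^{(t)}\ge1$ satisfy $\|D^{(t)}\|\le\Lambda_D^{(t)}$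 for $t<T$, let $\eta^{(t)}<1/(2\Lambda_D^{(t)})$ and $T\max_t\eta^{(t)}\le c_0$, and put $\Lambda=\max_t\Lambda_D^{(t)}$. Let $0<\delta\le1$. *Algorithms* are adaptive quantum programs built from arbitrary one- and two-qubit gates, single-qubit measurements with classical branching, fresh qubits in $|0\rangle$, oracle queries, fresh copies of a given $n$-qubit state, and a reported failure. Gates and measurements are counted as gates; all counts are worst-case counts over the branches. Accuracy of states is measured by the trace distance $\frac12\|\cdot\|_1$, accuracy of channels by half the diamond norm. *Simulation method.* For each step $t<T$, each $\tau\in\mathbb R$ and each $0<\varepsilon<1$ we are given an algorithm that, fed with copies of any density matrix $\rho$ from a class $\mathcal S_t$ of states encoding $x^{(t)}$ to accuracy at most $\delta$, simulates $e^{-i|1\rangle\langle1|\otimes D\tau}$ to accuracy $\varepsilon$. Here $D$ is a Hermitian operator independent of $\tau,\varepsilon$ with $\|D-D^{(t)}\|\le L\cdot\frac12\|\rho-|x^{(t)}\rangle\langle x^{(t)}|\|_1$; so $D=D^{(t)}$ for exact copies. (This covers both $D=D^{(t)}$, with $L=0$, and the gradient operator $D=\sum_j\mathrm{tr}_{i\ne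 j}\{(\rho^{\otimes (p-1)}\otimes1_j)A\}$ of $\rho$, if it is $L$-Lipschitz near $x^{(t)}$.) The algorithms of the method depend on $A$ only through oracle queries. **Part 1 (generic simulation method).** For all polynomials $P,G$ with nonnegative integer coefficients there is a polynomial $R$, independent of $T,c_0,L$ and of all the constants below, such that the following holds for every $T,c_0,L$. Suppose that $\mathcal S_t$ consists of all density matrices encoding $x^{(t)}$ to accuracy $\delta$, and that the simulation method uses at most $P(p,s_A,\Lambda_D^{(t)},|\tau|,1/\varepsilon)$ copies and at most as many queries, and at most $P(p,s_A,\Lambda_D^{(t)},|\tau|,1/\varepsilon)\cdot\tilde O\big(G(p,s_A,\Lambda_D^{(t)})\log N\big)$ gates. Then there is an algorithm, which does not depend on $A$ and $x^{(0)}$ except through the oracles and the copies of $|x^{(0)}\rangle$, that with probability at least $2/3$ succeeds (failure being reported), and on success outputs a state encoding $x^{(T)}$ to accuracy $\delta$. It uses $$O\big(R(p,s_A,\Lambda,1/\delta)^T\big)\ \text{copies of }|x^{(0)}\rangle\quad\text{and}\quad\tilde O\big(R(p,s_A,\Lambda,1/\delta)^T\log N\big)\ \text{gates.}$$ **Part 2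 (i.i.d. error model, resources of the sample-based simulation).** Let $\beta>0$. Suppose instead that $\mathcal S_t$ consists only of those density matrices encoding $x^{(t)}$ to accuracy $\delta$ that obey the i.i.d. error model: the copies are independent samples of a random unit vector $|x^{(t)}\rangle+v$ with $|v|\le\beta$, so that $\rho=\mathbb E\,(|x^{(t)}\rangle+v)(\langle x^{(t)}|+v^\dagger)$. Suppose that the simulation method uses $O\big(\max\{1,\,p^5(\Lambda_D^{(t)})^2\tau^2/\varepsilon^2\}\big)$ copies, $O\big(\max\{1,\,p^4(\Lambda_D^{(t)})^3\tau^2s_A/\varepsilon^2\}\big)$ queries and $\tilde O\big(\max\{1,\,p^5(\Lambda_D^{(t)})^3\tau^2s_A\log N/\varepsilon^2\}\big)$ gates. Then there is such an algorithm with $$O\Big(\frac{p^{5T}\Lambda^{2T}}{\delta^{4T}}\Big)\ \text{copies of }|x^{(0)}\rangle\quad\text{and}\quad\tilde O\Big(\frac{p^{5T}\Lambda^{3T}s_A^{T}}{\delta^{4T}}\log N\Big)\ \text{gates.}$$ In the conclusions the constants in $O$ and $\tilde O$, and the exponent of the logarithm in $\tilde O(Y)=O\big(Y\log^K(2+Y)\big)$,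 depend only on $T$, $c_0$, $L$, the constants and polynomials in the assumed bounds (and $\beta$ in Part 2). They do not depend on $n,p,s_A,\delta,\eta^{(t)},\Lambda_D^{(t)},A,x^{(0)}$. -/

import Mathlib

open scoped Matrix.Norms.L2Operator ComplexOrder

noncomputable section

namespace QGD

/-! ### The optimisation problem

The dimension is `N = 2 ^ n`.  Coordinates of vectors are labelled by bit strings `Fin n → Bool`
and `x` is stored in the amplitudes of `n` qubits. -/

/-- Vectors of `ℝ ^ N`, `N = 2 ^ n`, with the Euclidean norm. -/
abbrev Vec (n : ℕ) : Type := EuclideanSpace ℝ (Fin n → Bool)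

/-- Labels of the rows and columns of the `N ^ p × N ^ p` coefficient matrix. -/
abbrev Idx (n p : ℕ) : Type := Fin p → Fin n → Bool

/-- The homogeneous polynomial
`f(x) = 1/2 ∑ A_{i_1 … i_p, j_1 … j_p} x_{i_1} ⋯ x_{i_p} x_{j_1} ⋯ x_{j_p}` of degree `2 p`. -/
def objective {n p : ℕ} (A : Matrix (Idx n p) (Idx n p) ℝ) (x : Vec n) : ℝ :=
  (1 / 2) * ∑ u, ∑ v, A u v * ((∏ i, x (u i)) * ∏ i, x (v i))

/-- Every row (for a symmetric matrix: every row and column) has at most `s` nonzero entries. -/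
def IsSparse {ι : Type} [Fintype ι] (A : Matrix ι ι ℝ) (s : ℕ) : Prop :=
  ∀ j, {k | A j k ≠ 0}.ncard ≤ s

/-- One step of projected gradient descent on the unit sphere. -/
def descentStep {n p : ℕ} (A : Matrix (Idx n p) (Idx n p) ℝ) (η : ℝ) (x : Vec n) : Vec n :=
  ‖x - η • gradient (objective A) x‖⁻¹ • (x - η • gradient (objective A) x)

/-- The iterates `x^(0), x^(1), …` of projected gradient descent. -/
def trajectory {n p : ℕ} (A : Matrix (Idx n p) (Idx n p) ℝ) (x₀ : Vec n) (η : ℕ → ℝ) : ℕ → Vec n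
  | 0 => x₀
  | t + 1 => descentStep A (η t) (trajectory A x₀ η t)

/-! ### States and operators on qubit registers -/

/-- Operators on a register whose qubits are labelled by `Q`; the computational basis is
`Q → Bool`. -/
abbrev Op (Q : Type) : Type := Matrix (Q → Bool) (Q → Bool) ℂ

/-- Density matrices. -/
def IsDensity {ι : Type} [Fintype ι] (ρ : Matrix ι ι ℂ) : Prop :=
  ρ.PosSemidef ∧ ρ.trace = 1

/-- The trace norm, as the dual of the operator norm. -/
def traceNorm {ι : Type} [Fintype ι] [DecidableEq ι] (M : Matrix ι ι ℂ) : ℝ :=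
  ⨆ X : {X : Matrix ι ι ℂ // ‖X‖ ≤ 1}, ‖(X.1 * M).trace‖

/-- The trace distance `1/2 ‖ρ - σ‖₁`. -/
def traceDist {ι : Type} [Fintype ι] [DecidableEq ι] (ρ σ : Matrix ι ι ℂ) : ℝ :=
  traceNorm (ρ - σ) / 2

/-- The pure state `|x⟩⟨x|` of the amplitude encoding `|x⟩ = ∑ x_j |j⟩`. -/
def pureState {n : ℕ} (x : Vec n) : Op (Fin n) :=
  Matrix.of fun a b => (x a : ℂ) * (x b : ℂ)

/-- The gradient operator `D = tr_{1 … p-1} {(ρ^{⊗ (p-1)} ⊗ 1) M_D}` of a state `ρ`, written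
directly in the entries of `A`: a sum over the `p` tensor factors `j`, in which all the factors
`i ≠ j` of `A` are contracted with `ρ`.  For symmetric `A` and `ρ = |x⟩⟨x|` it satisfies
`D x = ∇ f (x)`. -/
def gradOp {n p : ℕ} (A : Matrix (Idx n p) (Idx n p) ℝ) (ρ : Op (Fin n)) : Op (Fin n) :=
  Matrix.of fun a b =>
    ∑ j : Fin p, ∑ u : Idx n p, ∑ v : Idx n p,
      if u j = a ∧ v j = b then
        (A u v : ℂ) * ∏ i ∈ Finset.univ.erase j, ρ (v i) (u i)
      else 0

/-- `D^(t) = D(x^(t))`, the gradient operator of a vector. -/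
def gradOpAt {n p : ℕ} (A : Matrix (Idx n p) (Idx n p) ℝ) (x : Vec n) : Op (Fin n) :=
  gradOp A (pureState x)

/-- The operator `U` acting on the qubits `e k` of the register `Q`, and as the identity on the
other ones. -/
def onQubits {K Q : Type} (e : K ↪ Q) (U : Op K) : Op Q := by
  classical
  exact Matrix.of fun x y => if ∀ q ∉ Set.range e, x q = y q then U (x ∘ e) (y ∘ e) else 0

/-- The operator `|x⟩ ↦ |f x⟩`. -/
def basisMap {Q : Type} (f : (Q → Bool) → Q → Bool) : Op Q := by
  classical
  exact Matrix.of fun x y => if x = f y then 1 else 0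

/-- The projection onto the states in which qubit `q` has the value `c`. -/
def proj {Q : Type} (q : Q) (c : Bool) : Op Q := by
  classical
  exact Matrix.diagonal fun x => if x q = c then 1 else 0

/-- Discard the contents of the qubits `e k` and put them into the state `ρ`. -/
def reload {K Q : Type} [Fintype K] [DecidableEq K] (e : K ↪ Q) (ρ : Op K) (σ : Op Q) : Op Q :=
  Matrix.of fun x y =>
    ρ (x ∘ e) (y ∘ e) *
      ∑ z : K → Bool, σ (Function.extend e z x) (Function.extend e z y)

/-- Add a workspace register in the state `|0 … 0⟩`. -/
def addZeros {K W : Type} [DecidableEq W] [Fintype W] (σ : Op K) : Op (K ⊕ W) :=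
  Matrix.of fun x y =>
    if (∀ q, x (Sum.inr q) = false) ∧ ∀ q, y (Sum.inr q) = false then
      σ (x ∘ Sum.inl) (y ∘ Sum.inl)
    else 0

/-- Trace out the workspace register. -/
def traceOut {K W : Type} [DecidableEq W] [Fintype W] (σ : Op (K ⊕ W)) : Op K :=
  Matrix.of fun x y => ∑ z : W → Bool, σ (Sum.elim x z) (Sum.elim y z)

/-- The state `|0 … 0⟩`. -/
def zeroState (K : Type) [DecidableEq K] [Fintype K] : Op K :=
  Matrix.of fun x y => if (∀ q, x q = false) ∧ ∀ q, y q = false then 1 else 0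

/-! ### Oracles for the coefficient matrix -/

/-- The data of the two oracles: the `b`-bit code of every matrix entry, and for every row `j` a
permutation of the labels, which sends the number `l` to the column index `g_A(j, l)`. -/
structure Oracles (n p b : ℕ) : Type where
  coeff : Idx n p → Idx n p → Fin b → Bool
  col : Idx n p → Equiv.Perm (Idx n p)

/-- The (offset binary, fixed point) number with `χ` fractional bits that a `b`-bit word codes. -/
def decode (b χ : ℕ) (z : Fin b → Bool) : ℝ :=
  ((∑ k : Fin b, if z k then (2 : ℝ) ^ (k : ℕ) else 0) - 2 ^ b / 2) / 2 ^ χ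

/-- The number `0, 1, …, N ^ p - 1` that a label stands for. -/
def idxVal {n p : ℕ} (l : Idx n p) : ℕ :=
  ∑ i : Fin p, ∑ k : Fin n, if l i k then 2 ^ ((i : ℕ) * n + (k : ℕ)) else 0

/-- The oracles describe `A`: entries are coded to accuracy `2 ^ (-χ)`, and in each row `j` the
nonzero entries are exactly the ones in the columns `g_A(j, l)`, where `l` runs through the
numbers below the number of nonzero entries of the row. -/
structure Oracles.Describe {n p b : ℕ} (O : Oracles n p b) (χ : ℕ)
    (A : Matrix (Idx n p) (Idx n p) ℝ) : Prop where
  coeff_acc : ∀ j k, |decode b χ (O.coeff j k) - A j k| ≤ ((2 : ℝ) ^ χ)⁻¹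
  col_spec : ∀ j l, A j (O.col j l) ≠ 0 ↔ idxVal l < {k | A j k ≠ 0}.ncard

/-- Qubits of the coefficient oracle: `|j, k⟩|z⟩`. -/
abbrev CoeffReg (n p b : ℕ) : Type := ((Fin p × Fin n) ⊕ (Fin p × Fin n)) ⊕ Fin b

/-- Qubits of the sparsity oracle: `|j, l⟩`. -/
abbrev SparseReg (n p : ℕ) : Type := (Fin p × Fin n) ⊕ (Fin p × Fin n)

/-- The oracle `|j, k⟩|z⟩ ↦ |j, k⟩|z ⊕ A_{jk}⟩`. -/
def Oracles.coeffGate {n p b : ℕ} (O : Oracles n p b) : Op (CoeffReg n p b) :=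
  basisMap fun x => Sum.elim (x ∘ Sum.inl) fun c =>
    xor (x (Sum.inr c))
      (O.coeff (fun i k => x (Sum.inl (Sum.inl (i, k)))) (fun i k => x (Sum.inl (Sum.inr (i, k)))) c)

/-- The oracle `|j, l⟩ ↦ |j, g_A(j, l)⟩`. -/
def Oracles.sparseGate {n p b : ℕ} (O : Oracles n p b) : Op (SparseReg n p) :=
  basisMap fun x => Sum.elim (x ∘ Sum.inl) fun c =>
    O.col (fun i k => x (Sum.inl (i, k))) (fun i k => x (Sum.inr (i, k))) c.1 c.2

/-! ### Quantum algorithms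

An algorithm is an adaptive program on a register of qubits `Q`.  Its elementary operations are
arbitrary unitary gates on at most two qubits and measurements of a qubit, after which the program
may branch.  It can query the oracles (and the inverse oracles), can put a fresh copy of a given
`n`-qubit state into the register, and can report a failure. -/

/-- Programs on the register `Q`. -/
inductive Prog (n p b : ℕ) (Q : Type) : Type where
  /-- stop; the contents of the register are the result -/
  | done : Prog n p b Q
  /-- stop and report a failure -/
  | halt : Prog n p b Q
  /-- a unitary gate on `k ≤ 2` qubits -/
  | gate (k : ℕ) (hk : k ≤ 2) (e : Fin k ↪ Q) (U : Matrix.unitaryGroup (Fin k → Bool) ℂ)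
      (next : Prog n p b Q) : Prog n p b Q
  /-- a query to the coefficient oracle (which is its own inverse) -/
  | queryCoeff (e : CoeffReg n p b ↪ Q) (next : Prog n p b Q) : Prog n p b Q
  /-- a query to the sparsity oracle, or to its inverse -/
  | querySparse (inv : Bool) (e : SparseReg n p ↪ Q) (next : Prog n p b Q) : Prog n p b Q
  /-- put a fresh copy of the given state into `n` qubits -/
  | copy (e : Fin n ↪ Q) (next : Prog n p b Q) : Prog n p b Q
  /-- measure a qubit and continue according to the outcome -/
  | measure (q : Q) (next : Bool → Prog n p b Q) : Prog n p b Q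

namespace Prog

variable {n p b : ℕ} {Q : Type}

/-- The number of copies of the given state that are used in the worst case. -/
def copies : Prog n p b Q → ℕ
  | done => 0
  | halt => 0
  | gate _ _ _ _ P => P.copies
  | queryCoeff _ P => P.copies
  | querySparse _ _ P => P.copies
  | copy _ P => P.copies + 1
  | measure _ P => max (P false).copies (P true).copies

/-- The number of oracle queries in the worst case. -/
def queries : Prog n p b Q → ℕ
  | done => 0
  | halt => 0
  | gate _ _ _ _ P => P.queries
  | queryCoeff _ P => P.queries + 1
  | querySparse _ _ P => P.queries + 1
  | copy _ P => P.queries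
  | measure _ P => max (P false).queries (P true).queries

/-- The number of elementary operations (gates and measurements) in the worst case. -/
def gates : Prog n p b Q → ℕ
  | done => 0
  | halt => 0
  | gate _ _ _ _ P => P.gates + 1
  | queryCoeff _ P => P.gates
  | querySparse _ _ P => P.gates
  | copy _ P => P.gates
  | measure _ P => max (P false).gates (P true).gates + 1

/-- The action of a program on (subnormalised) states, when the copies are in the state `ρ`.  The
trace of the result is the probability that no failure is reported. -/
def run [Fintype Q] [DecidableEq Q] (O : Oracles n p b) (ρ : Op (Fin n)) :
    Prog n p b Q → Op Q → Op Q
  | done, σ => σ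
  | halt, _ => 0
  | gate _ _ e U P, σ => P.run O ρ (onQubits e U.1 * σ * (onQubits e U.1).conjTranspose)
  | queryCoeff e P, σ =>
      P.run O ρ (onQubits e O.coeffGate * σ * (onQubits e O.coeffGate).conjTranspose)
  | querySparse false e P, σ =>
      P.run O ρ (onQubits e O.sparseGate * σ * (onQubits e O.sparseGate).conjTranspose)
  | querySparse true e P, σ =>
      P.run O ρ ((onQubits e O.sparseGate).conjTranspose * σ * onQubits e O.sparseGate)
  | copy e P, σ => P.run O ρ (reload e ρ σ)
  | measure q P, σ =>
      (P false).run O ρ (proj q false * σ * proj q false) +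
        (P true).run O ρ (proj q true * σ * proj q true)

end Prog

/-- A program with input and output register `K` and a workspace of `w` qubits, which starts in
`|0 … 0⟩` and is discarded at the end. -/
structure Circuit (n p b : ℕ) (K : Type) : Type where
  w : ℕ
  prog : Prog n p b (K ⊕ Fin w)

/-- The quantum operation of a circuit on the register `K`. -/
def Circuit.channel {n p b : ℕ} {K : Type} [Fintype K] [DecidableEq K] (C : Circuit n p b K)
    (O : Oracles n p b) (ρ : Op (Fin n)) (σ : Op K) : Op K :=
  traceOut (C.prog.run O ρ (addZeros σ))

/-- The circuit, run on `|0 … 0⟩` with copies of `|x₀⟩`, succeeds with probability at least `2/3`,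
and the state that it has then prepared is `|x⟩` to accuracy `δ`. -/
def Circuit.Prepares {n p b : ℕ} (C : Circuit n p b (Fin n)) (O : Oracles n p b)
    (x₀ x : Vec n) (δ : ℝ) : Prop :=
  let ω := C.channel O (pureState x₀) (zeroState (Fin n))
  2 / 3 ≤ ω.trace.re ∧ traceDist (ω.trace⁻¹ • ω) (pureState x) ≤ δ

/-! ### Simulation of the gradient operator -/

/-- Two operations on the register `K` are `ε`-close in (half) the diamond norm: also in the
presence of a reference system, they lead to states of trace distance at most `ε`. -/
def ChannelClose {K : Type} [Fintype K] [DecidableEq K] (Φ Ψ : Op K → Op K) (ε : ℝ) : Prop :=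
  ∀ (m : ℕ) (σ : Matrix ((K → Bool) × Fin m) ((K → Bool) × Fin m) ℂ), IsDensity σ →
    traceDist
      (Matrix.of fun a b : (K → Bool) × Fin m => Φ (Matrix.of fun x y => σ (x, a.2) (y, b.2)) a.1 b.1)
      (Matrix.of fun a b : (K → Bool) × Fin m => Ψ (Matrix.of fun x y => σ (x, a.2) (y, b.2)) a.1 b.1) ≤ ε

/-- `|1⟩⟨1| ⊗ D`, where the control is the qubit `none`. -/
def controlled {n : ℕ} (D : Op (Fin n)) : Op (Option (Fin n)) :=
  Matrix.of fun x y =>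
    if x none = true ∧ y none = true then D (x ∘ some) (y ∘ some) else 0

/-- The controlled evolution `exp (-i |1⟩⟨1| ⊗ D τ)`. -/
def controlledEvolution {n : ℕ} (D : Op (Fin n)) (τ : ℝ) : Op (Option (Fin n)) :=
  NormedSpace.exp ((-Complex.I * (τ : ℂ)) • controlled D)

/-- The circuit, supplied with copies of `ρ`, simulates `exp (-i |1⟩⟨1| ⊗ D τ)` to accuracy
`ε`. -/
def Circuit.Simulates {n p b : ℕ} (C : Circuit n p b (Option (Fin n))) (O : Oracles n p b)
    (ρ D : Op (Fin n)) (τ ε : ℝ) : Prop :=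
  ChannelClose (C.channel O ρ)
    (fun σ => controlledEvolution D τ * σ * (controlledEvolution D τ).conjTranspose) ε

/-- A simulation method: a circuit for every step `t`, evolution time `τ` and accuracy `ε`. -/
abbrev SimMethod (n p b : ℕ) : Type := ℕ → ℝ → ℝ → Circuit n p b (Option (Fin n))

/-- `S` is a simulation method for the gradient operator of `x`, from copies of any of the states
`ρ` in `𝒮`, which encode `x` up to some error.  The operator that is simulated is `D(x)` if the
copies are exact; the error of the copies may perturb it by at most `L` times this error.
This allows both for methods that always simulate `D(x)` (any `L ≥ 0`), and for those that
simulate the gradient operator `gradOp A ρ` of the copies, if that is `L`-Lipschitz near `x`. -/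
def SimulatesGradient {n p b : ℕ} (S : ℝ → ℝ → Circuit n p b (Option (Fin n)))
    (O : Oracles n p b) (A : Matrix (Idx n p) (Idx n p) ℝ) (x : Vec n) (L : ℝ)
    (𝒮 : Set (Op (Fin n))) : Prop :=
  ∀ ρ ∈ 𝒮, ∃ D : Op (Fin n), D.IsHermitian ∧
    ‖D - gradOpAt A x‖ ≤ L * traceDist ρ (pureState x) ∧
    ∀ τ ε : ℝ, 0 < ε → ε < 1 → (S τ ε).Simulates O ρ D τ ε

/-- The states that encode `x` to accuracy `δ`. -/
def encodings {n : ℕ} (x : Vec n) (δ : ℝ) : Set (Op (Fin n)) :=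
  {ρ | IsDensity ρ ∧ traceDist ρ (pureState x) ≤ δ}

/-- The i.i.d. error model: the copies are independent, identically distributed samples of a
random pure state `|x⟩ + v`, where `v` is a random vector with `|v| ≤ β`.  Several copies are
then in a product of states `ρ = 𝔼 (|x⟩ + v)(⟨x| + v†)`. -/
def iidErrorModel {n : ℕ} (x : Vec n) (β : ℝ) : Set (Op (Fin n)) :=
  {ρ | ∃ μ : MeasureTheory.Measure (EuclideanSpace ℂ (Fin n → Bool)),
    MeasureTheory.IsProbabilityMeasure μ ∧
    (∀ᵐ v ∂μ, ‖v‖ ≤ β ∧ ∑ a, ‖(x a : ℂ) + v a‖ ^ 2 = 1) ∧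
    ∀ a b, ρ a b = ∫ v, ((x a : ℂ) + v a) * (starRingEnd ℂ) ((x b : ℂ) + v b) ∂μ}

/-! ### Parameters and resource bounds -/

/-- The `Õ(Y)` bound `C Y (log (2 + Y)) ^ k`. -/
def softO (C : ℝ) (k : ℕ) (Y : ℝ) : ℝ := C * Y * Real.log (2 + Y) ^ k

/-- The value of a polynomial with nonnegative coefficients at a real point. -/
def polyVal {m : ℕ} (P : MvPolynomial (Fin m) ℕ) (v : Fin m → ℝ) : ℝ := MvPolynomial.aeval v P

/-- `Λ = max_{t < T} Λ_D^(t)`. -/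
def maxNorm (T : ℕ) (ΛD : ℕ → ℝ) : ℝ := ⨆ t : Fin T, ΛD t

/-- The parameters of the task: sizes, final accuracy `δ`, step sizes `η^(t)` and bounds
`Λ_D^(t)` on the gradient operator, with `T max_t η^(t) ≤ c₀`. -/
structure Schedule (n p s T : ℕ) (c₀ δ : ℝ) (η ΛD : ℕ → ℝ) : Prop where
  n_pos : 1 ≤ n
  p_pos : 1 ≤ p
  s_pos : 1 ≤ s
  δ_pos : 0 < δ
  δ_le : δ ≤ 1
  η_pos : ∀ t < T, 0 < η t
  ΛD_ge : ∀ t < T, 1 ≤ ΛD t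
  η_lt : ∀ t < T, η t < 1 / (2 * ΛD t)
  explored : ∀ t < T, (T : ℝ) * η t ≤ c₀

/-- The optimisation problem: a symmetric `s`-sparse coefficient matrix `A`, described by the
oracles, a normalised initial guess, and `‖D^(t)‖ ≤ Λ_D^(t)` along the iterates. -/
structure Problem {n p b : ℕ} (s T χ : ℕ) (η ΛD : ℕ → ℝ) (A : Matrix (Idx n p) (Idx n p) ℝ)
    (x₀ : Vec n) (O : Oracles n p b) : Prop where
  symm : A.IsSymm
  sparse : IsSparse A s
  oracles : O.Describe χ A
  init : ‖x₀‖ = 1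
  norm_le : ∀ t < T, ‖gradOpAt A (trajectory A x₀ η t)‖ ≤ ΛD t

end QGD

end

namespace QGD

noncomputable section

set_option linter.unusedSectionVars false

/-! One descent step is a postselected linear map. Put a control qubit into the state with
amplitudes u/√2, u*/√2, where u = exp(iθ). Evolve under D for time τ on one value of the control and
for time -τ on the other, apply a Hadamard gate, and measure. Outcome 0 applies (u exp(iDτ) + u*
exp(-iDτ))/2 = cos(θ + Dτ) to the system (`bl_success`). With tan θ = η/τ this is cos θ · (1 - ηD)
up to a relative error of order (τ‖D‖)² and η τ²‖D‖³ (`norm_cos_sub_sin_le`,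
`norm_successOp_sub_le`). If copies of x^(t) have accuracy a, the time τ = √a/(4Λ) keeps this error
of order a, and the success probability, about cos²θ · ‖x - η∇f‖², is at least a constant times a
(`le_stepCos_sq`, `norm_descentVec`).

After outcome 1 the step is repeated with a fresh copy, up to r times, and after that a plain copy
is returned. So failure is never reported; it only enters the error. The error obeys an affine
recursion with contraction factor 1 - Q/8, Q = cos²θ, whose solution is a constant times a plus 2(1
- a/80)^r (`attempt_error`, `step_recursion`, `stepCircuit_spec`). A minimal r with (1 - a/80)^r ≤ a
makes the new error a constant multiple of a.

The simulation accuracy is not uniform over the trials. With j trials left it is proportional to a(1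
- a/80)^j, the rate at which the error bound itself decays. The costs, of order 1/ε², then form a
geometric sum of order a⁻⁵ (`exists_attempts`). Multiplied by τ², of order a/Λ², this gives a⁻⁴
without a logarithm, which is the power of 1/δ in Part 2.

The circuit for one step overwrites its register by a fixed state whatever was there
(`Circuit.Replaces`). It can therefore stand in for the copy instruction of the next step
(`exists_subst`). If a step uses at most m copies and g gates, T steps use at most m^T copies and
g·(1 + m + ⋯ + m^(T-1)) gates (`exists_descentCircuit`). The accuracies a_t grow by a constant
factor per step and are chosen backwards from δ (`exists_accuracies`), so each is comparable to δ
with constants that depend on T and L, and in Part 2 also on β.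

In Part 2 the given method only accepts copies in the i.i.d. error model. This is no restriction:
every density matrix close to |x⟩ is a uniform mixture of unit vectors all close to |x⟩, obtained
from random signs in a spectral decomposition (`mem_iidErrorModel`). -/

/-! ### Programs on larger registers -/

section Registers

variable {n p b : ℕ} {K Q Q' : Type}

/-- The matrix of the map `w ↦ w ∘ f`, restricted to the strings that agree with `z` off the range
of `f`. -/
def cut (f : Q ↪ Q') (z : Q' → Bool) : Matrix (Q → Bool) (Q' → Bool) ℂ := by
  classical
  exact Matrix.of fun x w => if w = Function.extend f x z then 1 else 0

/-- The block of `σ` on the qubits `f q`, when the other qubits are in the basis states `z` and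
`z'`. -/
def blk (f : Q ↪ Q') (z z' : Q' → Bool) (σ : Op Q') : Op Q :=
  Matrix.of fun x y => σ (Function.extend f x z) (Function.extend f y z')

lemma extend_comp (f : Q ↪ Q') (x : Q → Bool) (z : Q' → Bool) :
    Function.extend f x z ∘ f = x := by
  funext q; simp [f.injective.extend_apply]

lemma extend_eq_iff (f : Q ↪ Q') (x : Q → Bool) (z w : Q' → Bool) :
    w = Function.extend f x z ↔ w ∘ f = x ∧ ∀ q ∉ Set.range f, w q = z q := by
  constructor
  · rintro rfl
    refine ⟨extend_comp f x z, fun q hq => ?_⟩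
    rw [Function.extend_apply']
    simpa using hq
  · rintro ⟨rfl, h⟩
    funext q
    by_cases hq : ∃ a, f a = q
    · obtain ⟨a, rfl⟩ := hq
      simp [f.injective.extend_apply]
    · rw [Function.extend_apply' _ _ _ hq]
      exact h q hq

lemma extend_trans (e : K ↪ Q) (f : Q ↪ Q') (w : K → Bool) (x : Q → Bool) (z : Q' → Bool) :
    Function.extend (e.trans f) w (Function.extend f x z) =
      Function.extend f (Function.extend e w x) z := by
  rw [eq_comm, extend_eq_iff]
  constructor
  · funext k
    simp [f.injective.extend_apply, e.injective.extend_apply]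
  · intro q hq
    by_cases hq' : ∃ a, f a = q
    · obtain ⟨a, rfl⟩ := hq'
      rw [f.injective.extend_apply, f.injective.extend_apply, Function.extend_apply']
      rintro ⟨k, rfl⟩
      exact hq ⟨k, rfl⟩
    · rw [Function.extend_apply' _ _ _ hq', Function.extend_apply' _ _ _ hq']

variable [Fintype Q] [DecidableEq Q] [Fintype Q'] [DecidableEq Q']

lemma cut_mul (f : Q ↪ Q') (z : Q' → Bool) {ι : Type} (M : Matrix (Q' → Bool) ι ℂ) :
    cut f z * M = Matrix.of fun x i => M (Function.extend f x z) i := by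
  ext x i
  simp [cut, Matrix.mul_apply]

lemma blk_eq (f : Q ↪ Q') (z z' : Q' → Bool) (σ : Op Q') :
    blk f z z' σ = cut f z * σ * (cut f z').conjTranspose := by
  rw [cut_mul]
  ext x y
  simp [cut, Matrix.mul_apply, blk, apply_ite]

/-- A gate on qubits inside the image of `f` does not see the other qubits. Fixing those to `z`
therefore intertwines the gate on the large register with the gate on the small one. -/
lemma cut_mul_onQubits (e : K ↪ Q) (f : Q ↪ Q') (z : Q' → Bool) (U : Op K) :
    cut f z * onQubits (e.trans f) U = onQubits e U * cut f z := by
  classical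
  rw [cut_mul]
  ext x w
  have h1 : ∀ x', (w = Function.extend f x' z) ↔
      (x' = w ∘ f ∧ ∀ q ∉ Set.range f, w q = z q) := by
    intro x'
    rw [extend_eq_iff, eq_comm]
  simp only [cut, Matrix.mul_apply, Matrix.of_apply, h1, mul_ite, mul_one, mul_zero]
  by_cases hw : ∀ q ∉ Set.range f, w q = z q
  · simp only [and_iff_left hw, Finset.sum_ite_eq', Finset.mem_univ, if_true]
    simp only [onQubits, Matrix.of_apply]
    have h2 : (∀ q ∉ Set.range (e.trans f), Function.extend f x z q = w q) ↔
        ∀ q ∉ Set.range e, x q = (w ∘ f) q := by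
      constructor
      · intro h q hq
        have := h (f q) (by rintro ⟨k, hk⟩; exact hq ⟨k, f.injective hk⟩)
        rwa [f.injective.extend_apply] at this
      · intro h q hq
        by_cases hq' : ∃ a, f a = q
        · obtain ⟨a, rfl⟩ := hq'
          rw [f.injective.extend_apply]
          exact h a (by rintro ⟨k, rfl⟩; exact hq ⟨k, rfl⟩)
        · rw [Function.extend_apply' _ _ _ hq']
          exact (hw q hq').symm
    simp only [h2]
    congr 2
    funext k
    simp [f.injective.extend_apply]
  · simp only [hw, and_false, if_false, Finset.sum_const_zero]
    simp only [onQubits, Matrix.of_apply]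
    rw [if_neg]
    intro h
    apply hw
    intro q hq
    rw [← h q (by rintro ⟨k, rfl⟩; exact hq ⟨e k, rfl⟩), Function.extend_apply' _ _ _ hq]

lemma onQubits_conjTranspose (e : K ↪ Q) (U : Op K) :
    (onQubits e U).conjTranspose = onQubits e U.conjTranspose := by
  classical
  ext x y
  simp only [Matrix.conjTranspose_apply, onQubits, Matrix.of_apply, apply_ite star, star_zero]
  congr 1
  simp only [eq_comm]

lemma cut_mul_proj (f : Q ↪ Q') (z : Q' → Bool) (q : Q) (c : Bool) :
    cut f z * proj (f q) c = proj q c * cut f z := by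
  classical
  rw [cut_mul]
  ext x w
  simp only [proj, Matrix.diagonal_mul, Matrix.of_apply, Matrix.diagonal_apply, cut]
  by_cases h : w = Function.extend f x z
  · subst h
    simp [f.injective.extend_apply]
  · simp [h, Ne.symm h]

lemma proj_conjTranspose (q : Q) (c : Bool) : (proj q c).conjTranspose = proj q c := by
  classical
  ext x y
  by_cases h : x = y
  · subst h
    simp [proj, apply_ite (starRingEnd ℂ)]
  · simp [proj, h, Ne.symm h]

lemma blk_conj (f : Q ↪ Q') (z z' : Q' → Bool) {A : Op Q'} {a : Op Q}
    (h : ∀ z, cut f z * A = a * cut f z) (σ : Op Q') :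
    blk f z z' (A * σ * A.conjTranspose) = a * blk f z z' σ * a.conjTranspose := by
  have h' : A.conjTranspose * (cut f z').conjTranspose =
      (cut f z').conjTranspose * a.conjTranspose := by
    rw [← Matrix.conjTranspose_mul, h, Matrix.conjTranspose_mul]
  rw [blk_eq, blk_eq]
  calc _ = (cut f z * A) * σ * (A.conjTranspose * (cut f z').conjTranspose) := by
        simp only [Matrix.mul_assoc]
    _ = _ := by rw [h, h']; simp only [Matrix.mul_assoc]

lemma blk_add (f : Q ↪ Q') (z z' : Q' → Bool) (σ τ : Op Q') :
    blk f z z' (σ + τ) = blk f z z' σ + blk f z z' τ := rfl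

lemma blk_reload [Fintype K] [DecidableEq K] (e : K ↪ Q) (f : Q ↪ Q') (z z' : Q' → Bool)
    (ρ : Op K) (σ : Op Q') :
    blk f z z' (reload (e.trans f) ρ σ) = reload e ρ (blk f z z' σ) := by
  ext x y
  simp only [blk, reload, Matrix.of_apply, extend_trans]
  congr 2 <;> · funext k; simp [f.injective.extend_apply]

end Registers

/-! ### Relabelling, composition and linearity of programs -/

namespace Prog

variable {n p b : ℕ} {Q Q' : Type}

/-- The program on the qubits `f q` of a larger register. -/
def map (f : Q ↪ Q') : Prog n p b Q → Prog n p b Q'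
  | done => done
  | halt => halt
  | gate k hk e U P => gate k hk (e.trans f) U (P.map f)
  | queryCoeff e P => queryCoeff (e.trans f) (P.map f)
  | querySparse i e P => querySparse i (e.trans f) (P.map f)
  | copy e P => copy (e.trans f) (P.map f)
  | measure q P => measure (f q) fun c => (P c).map f

@[simp] lemma copies_map (f : Q ↪ Q') (P : Prog n p b Q) : (P.map f).copies = P.copies := by
  induction P <;> simp_all [map, copies]

@[simp] lemma gates_map (f : Q ↪ Q') (P : Prog n p b Q) : (P.map f).gates = P.gates := by
  induction P <;> simp_all [map, gates]

/-- First `P`, then `R`. -/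
def seq (P R : Prog n p b Q) : Prog n p b Q :=
  match P with
  | done => R
  | halt => halt
  | gate k hk e U P => gate k hk e U (P.seq R)
  | queryCoeff e P => queryCoeff e (P.seq R)
  | querySparse i e P => querySparse i e (P.seq R)
  | copy e P => copy e (P.seq R)
  | measure q P => measure q fun c => (P c).seq R

lemma copies_seq (P R : Prog n p b Q) : (P.seq R).copies ≤ P.copies + R.copies := by
  induction P <;> simp_all only [seq, copies] <;> grind

lemma gates_seq (P R : Prog n p b Q) : (P.seq R).gates ≤ P.gates + R.gates := by
  induction P <;> simp_all only [seq, gates] <;> grind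

/-- The program that stops where `P` reports a failure. -/
def noHalt : Prog n p b Q → Prog n p b Q
  | done => done
  | halt => done
  | gate k hk e U P => gate k hk e U P.noHalt
  | queryCoeff e P => queryCoeff e P.noHalt
  | querySparse i e P => querySparse i e P.noHalt
  | copy e P => copy e P.noHalt
  | measure q P => measure q fun c => (P c).noHalt

@[simp] lemma copies_noHalt (P : Prog n p b Q) : P.noHalt.copies = P.copies := by
  induction P <;> simp_all [noHalt, copies]

@[simp] lemma gates_noHalt (P : Prog n p b Q) : P.noHalt.gates = P.gates := by
  induction P <;> simp_all [noHalt, gates]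

variable [Fintype Q] [DecidableEq Q] [Fintype Q'] [DecidableEq Q']

/-- This is the precise form of "acts as the identity on the remaining qubits", including the
off-diagonal blocks `z ≠ z'`. Every later statement about registers is obtained by applying it to a
suitable embedding. -/
lemma run_map (f : Q ↪ Q') (z z' : Q' → Bool) (O : Oracles n p b) (ρ : Op (Fin n))
    (P : Prog n p b Q) (σ : Op Q') :
    blk f z z' ((P.map f).run O ρ σ) = P.run O ρ (blk f z z' σ) := by
  induction P generalizing σ with
  | done => rfl
  | halt => rfl
  | gate k hk e U P ih =>
    simp only [map, run, ih]
    rw [blk_conj f z z' fun z => cut_mul_onQubits e f z U.1]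
  | queryCoeff e P ih =>
    simp only [map, run, ih]
    rw [blk_conj f z z' fun z => cut_mul_onQubits e f z _]
  | querySparse i e P ih =>
    cases i
    · simp only [map, run, ih]
      rw [blk_conj f z z' fun z => cut_mul_onQubits e f z _]
    · simp only [map, run, ih, onQubits_conjTranspose]
      have := blk_conj f z z' (fun z => cut_mul_onQubits e f z O.sparseGate.conjTranspose) σ
      rw [onQubits_conjTranspose, onQubits_conjTranspose, Matrix.conjTranspose_conjTranspose] at this
      rw [this]
  | copy e P ih => simp only [map, run, ih, blk_reload]
  | measure q P ih =>
    simp only [map, run, blk_add, ih]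
    have h : ∀ c, blk f z z' (proj (f q) c * σ * proj (f q) c) =
        proj q c * blk f z z' σ * proj q c := by
      intro c
      have := blk_conj f z z' (fun z => cut_mul_proj f z q c) σ
      rwa [proj_conjTranspose, proj_conjTranspose] at this
    rw [h, h]

lemma run_add (O : Oracles n p b) (ρ : Op (Fin n)) (P : Prog n p b Q) (σ τ : Op Q) :
    P.run O ρ (σ + τ) = P.run O ρ σ + P.run O ρ τ := by
  induction P generalizing σ τ with
  | done => rfl
  | halt => simp [run]
  | gate k hk e U P ih => simp only [run, ← ih, Matrix.mul_add, Matrix.add_mul]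
  | queryCoeff e P ih => simp only [run, ← ih, Matrix.mul_add, Matrix.add_mul]
  | querySparse i e P ih =>
    cases i <;> simp only [run, ← ih, Matrix.mul_add, Matrix.add_mul]
  | copy e P ih =>
    simp only [run, ← ih]
    congr 1
    ext x y
    simp [reload, Finset.sum_add_distrib, mul_add]
  | measure q P ih =>
    simp only [run, Matrix.mul_add, Matrix.add_mul, ih]
    abel

lemma run_smul (O : Oracles n p b) (ρ : Op (Fin n)) (P : Prog n p b Q) (c : ℂ) (σ : Op Q) :
    P.run O ρ (c • σ) = c • P.run O ρ σ := by
  induction P generalizing σ with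
  | done => rfl
  | halt => simp [run]
  | gate k hk e U P ih => simp only [run, ← ih, Matrix.mul_smul, Matrix.smul_mul]
  | queryCoeff e P ih => simp only [run, ← ih, Matrix.mul_smul, Matrix.smul_mul]
  | querySparse i e P ih => cases i <;> simp only [run, ← ih, Matrix.mul_smul, Matrix.smul_mul]
  | copy e P ih =>
    simp only [run, ← ih]
    congr 1
    ext x y
    simp only [reload, Matrix.of_apply, Matrix.smul_apply, smul_eq_mul, ← Finset.mul_sum]
    ring
  | measure q P ih => simp only [run, Matrix.mul_smul, Matrix.smul_mul, ih, smul_add]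

lemma run_zero (O : Oracles n p b) (ρ : Op (Fin n)) (P : Prog n p b Q) : P.run O ρ 0 = 0 := by
  simpa using P.run_smul O ρ 0 0

lemma run_sum (O : Oracles n p b) (ρ : Op (Fin n)) (P : Prog n p b Q) {ι : Type}
    (s : Finset ι) (σ : ι → Op Q) :
    P.run O ρ (∑ i ∈ s, σ i) = ∑ i ∈ s, P.run O ρ (σ i) := by
  classical
  induction s using Finset.induction_on with
  | empty => simp [run_zero]
  | insert i s hi ih => simp [Finset.sum_insert hi, run_add, ih]

lemma run_seq (O : Oracles n p b) (ρ : Op (Fin n)) (P R : Prog n p b Q) (σ : Op Q) :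
    (P.seq R).run O ρ σ = R.run O ρ (P.run O ρ σ) := by
  induction P generalizing σ with
  | done => rfl
  | halt => simp [seq, run, run_zero]
  | gate k hk e U P ih => simp only [seq, run, ih]
  | queryCoeff e P ih => simp only [seq, run, ih]
  | querySparse i e P ih => cases i <;> simp only [seq, run, ih]
  | copy e P ih => simp only [seq, run, ih]
  | measure q P ih => simp only [seq, run, ih, run_add]

end Prog

/-! ### Programs with a workspace -/

section Workspace

variable {n p b : ℕ} {K K' W W₁ W₂ : Type}
  [Fintype K] [DecidableEq K] [Fintype K'] [DecidableEq K'] [Fintype W] [DecidableEq W]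
  [Fintype W₁] [DecidableEq W₁] [Fintype W₂] [DecidableEq W₂]

/-- The operation on the register `K` of a program with workspace `W`. -/
def chan (P : Prog n p b (K ⊕ W)) (O : Oracles n p b) (ρ : Op (Fin n)) (σ : Op K) : Op K :=
  traceOut (P.run O ρ (addZeros σ))

lemma traceOut_addZeros (σ : Op K) : traceOut (addZeros (W := W) σ) = σ := by
  ext x y
  simp only [traceOut, addZeros, Matrix.of_apply, Sum.elim_inr, and_self]
  rw [Finset.sum_eq_single (fun _ => false)]
  · simp [Function.comp_def]
  · intro z _ hz
    rw [if_neg]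
    intro h
    exact hz (funext h)
  · simp

lemma traceOut_add (σ τ : Op (K ⊕ W)) : traceOut (σ + τ) = traceOut σ + traceOut τ := by
  ext x y
  simp [traceOut, Finset.sum_add_distrib]

/-- The qubits of a register and of the first part of its workspace. -/
def wkl : K ⊕ W₁ ↪ K ⊕ (W₁ ⊕ W₂) := (Function.Embedding.refl K).sumMap .inl

/-- The qubits of a register and of the second part of its workspace. -/
def wkr : K ⊕ W₂ ↪ K ⊕ (W₁ ⊕ W₂) := (Function.Embedding.refl K).sumMap .inr

lemma extend_wkl (x : K ⊕ W₁ → Bool) (z : K ⊕ (W₁ ⊕ W₂) → Bool) :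
    Function.extend wkl x z =
      Sum.elim (x ∘ Sum.inl) (Sum.elim (x ∘ Sum.inr) (z ∘ Sum.inr ∘ Sum.inr)) := by
  rw [eq_comm, extend_eq_iff]
  constructor
  · funext q; rcases q with q | q <;> rfl
  · rintro (q | q | q) hq
    · exact (hq ⟨Sum.inl q, rfl⟩).elim
    · exact (hq ⟨Sum.inr q, rfl⟩).elim
    · rfl

lemma extend_wkr (x : K ⊕ W₂ → Bool) (z : K ⊕ (W₁ ⊕ W₂) → Bool) :
    Function.extend wkr x z =
      Sum.elim (x ∘ Sum.inl) (Sum.elim (z ∘ Sum.inr ∘ Sum.inl) (x ∘ Sum.inr)) := by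
  rw [eq_comm, extend_eq_iff]
  constructor
  · funext q; rcases q with q | q <;> rfl
  · rintro (q | q | q) hq
    · exact (hq ⟨Sum.inl q, rfl⟩).elim
    · rfl
    · exact (hq ⟨Sum.inr q, rfl⟩).elim

/-- First `P`, then `R`, with separate workspaces. -/
def seqW (P : Prog n p b (K ⊕ W₁)) (R : Prog n p b (K ⊕ W₂)) : Prog n p b (K ⊕ (W₁ ⊕ W₂)) :=
  (P.map wkl).seq (R.map wkr)

lemma sum_sum_arrow {M : Type*} [AddCommMonoid M] (F : (W₁ ⊕ W₂ → Bool) → M) :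
    ∑ z, F z = ∑ z₁ : W₁ → Bool, ∑ z₂ : W₂ → Bool, F (Sum.elim z₁ z₂) := by
  rw [← Fintype.sum_prod_type']
  exact (Equiv.sum_comp (Equiv.sumArrowEquivProdArrow W₁ W₂ Bool).symm F).symm

/-- The second program leaves the first workspace untouched, so tracing that workspace out at the
end is the same as tracing it out before the second program starts. -/
theorem chan_seqW (P : Prog n p b (K ⊕ W₁)) (R : Prog n p b (K ⊕ W₂)) (O : Oracles n p b)
    (ρ : Op (Fin n)) (σ : Op K) : chan (seqW P R) O ρ σ = chan R O ρ (chan P O ρ σ) := by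
  set τ := (P.map (wkl (W₂ := W₂))).run O ρ (addZeros σ) with hτ
  let B : (W₁ → Bool) → K ⊕ (W₁ ⊕ W₂) → Bool := fun z₁ =>
    Sum.elim (fun _ => false) (Sum.elim z₁ fun _ => false)
  -- The sum over the diagonal values `z₁` of the first workspace is the partial trace. The second
  -- workspace still contains zeros because `P` does not touch it.
  have h1 : ∑ z₁, blk wkr (B z₁) (B z₁) τ = addZeros (chan P O ρ σ) := by
    ext X Y
    have h2 : ∀ z₁, blk wkr (B z₁) (B z₁) τ X Y =
        P.run O ρ (blk wkl (Function.extend wkr X fun _ => false)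
          (Function.extend wkr Y fun _ => false) (addZeros σ))
          (Sum.elim (X ∘ Sum.inl) z₁) (Sum.elim (Y ∘ Sum.inl) z₁) := by
      intro z₁
      rw [← Prog.run_map, ← hτ]
      simp only [blk, Matrix.of_apply, extend_wkl, extend_wkr, B]
      congr 1
    have h3 : blk (wkl (W₁ := W₁)) (Function.extend wkr X fun _ => false)
          (Function.extend wkr Y fun _ => false) (addZeros σ) =
        if (∀ q, X (Sum.inr q) = false) ∧ ∀ q, Y (Sum.inr q) = false then addZeros σ else 0 := by
      ext x y
      simp only [blk, addZeros, extend_wkl, extend_wkr, Matrix.of_apply, Sum.forall, Sum.elim_inr,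
        Sum.elim_inl, Function.comp_apply, ← Function.comp_assoc, Sum.elim_comp_inl]
      by_cases hX : ∀ q, X (Sum.inr q) = false <;> by_cases hY : ∀ q, Y (Sum.inr q) = false <;>
        simp [hX, hY]
    rw [Matrix.sum_apply]
    simp only [h2, h3]
    simp only [addZeros, chan, traceOut, Matrix.of_apply]
    split_ifs
    · rfl
    · simp [Prog.run_zero]
  ext x y
  simp only [chan, traceOut, Matrix.of_apply, seqW, Prog.run_seq, sum_sum_arrow, ← hτ]
  change _ = ∑ z, R.run O ρ (addZeros (chan P O ρ σ)) (Sum.elim x z) (Sum.elim y z)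
  rw [← h1, Prog.run_sum, Finset.sum_comm]
  refine Finset.sum_congr rfl fun z₂ _ => ?_
  rw [Matrix.sum_apply]
  refine Finset.sum_congr rfl fun z₁ _ => ?_
  rw [← Prog.run_map]
  simp only [blk, Matrix.of_apply, extend_wkr, B]
  congr 1

lemma Prog.seq_done {Q : Type} (P : Prog n p b Q) : P.seq .done = P := by
  induction P with
  | measure q P ih => simp [Prog.seq, ih]
  | _ => simp_all [Prog.seq]

/-- Extra idle workspace is harmless. This is needed when two branches after a measurement share one
register but have workspaces of different sizes. -/
lemma traceOut_run_padl (P : Prog n p b (K ⊕ W₁)) (O : Oracles n p b) (ρ : Op (Fin n))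
    (σ : Op K) : chan (P.map (wkl (W₂ := W₂))) O ρ σ = chan P O ρ σ := by
  have := chan_seqW P (Prog.done : Prog n p b (K ⊕ W₂)) O ρ σ
  rw [seqW, Prog.map, Prog.seq_done] at this
  rw [this]
  exact traceOut_addZeros _

lemma traceOut_run_padr (P : Prog n p b (K ⊕ W₂)) (O : Oracles n p b) (ρ : Op (Fin n))
    (σ : Op K) : chan (P.map (wkr (W₁ := W₁))) O ρ σ = chan P O ρ σ := by
  have := chan_seqW (Prog.done : Prog n p b (K ⊕ W₁)) P O ρ σ
  rw [seqW, Prog.map, Prog.seq] at this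
  rw [this]
  congr 1
  exact traceOut_addZeros _

lemma run_map_inl (P : Prog n p b K) (O : Oracles n p b) (ρ : Op (Fin n)) (σ : Op K) :
    (P.map (Function.Embedding.inl : K ↪ K ⊕ W)).run O ρ (addZeros σ) =
      addZeros (P.run O ρ σ) := by
  have hext : ∀ (x : K → Bool) (z : K ⊕ W → Bool),
      Function.extend (Function.Embedding.inl : K ↪ K ⊕ W) x z = Sum.elim x (z ∘ Sum.inr) := by
    intro x z
    rw [eq_comm, extend_eq_iff]
    constructor
    · rfl
    · rintro (q | q) hq
      · exact (hq ⟨q, rfl⟩).elim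
      · rfl
  ext X Y
  have h := congrFun (congrFun (Prog.run_map (Function.Embedding.inl : K ↪ K ⊕ W) X Y O ρ P
    (addZeros σ)) (X ∘ Sum.inl)) (Y ∘ Sum.inl)
  have h3 : blk (Function.Embedding.inl : K ↪ K ⊕ W) X Y (addZeros σ) =
      if (∀ q, X (Sum.inr q) = false) ∧ ∀ q, Y (Sum.inr q) = false then σ else 0 := by
    ext x y
    simp only [blk, addZeros, hext, Matrix.of_apply, Sum.elim_inr, Function.comp_apply,
      Sum.elim_comp_inl]
    by_cases hX : (∀ q, X (Sum.inr q) = false) ∧ ∀ q, Y (Sum.inr q) = false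
    · rw [if_pos hX]; exact if_pos hX
    · rw [if_neg hX]; exact if_neg hX
  rw [h3] at h
  simp only [blk, hext, Matrix.of_apply] at h
  have h4 : ∀ X : K ⊕ W → Bool, Sum.elim (X ∘ Sum.inl) (X ∘ Sum.inr) = X :=
    fun X => Sum.elim_comp_inl_inr X
  rw [h4, h4] at h
  rw [h]
  simp only [addZeros, Matrix.of_apply]
  split_ifs
  · rfl
  · simp [Prog.run_zero]

lemma chan_map_inl_seq (P : Prog n p b K) (R : Prog n p b (K ⊕ W)) (O : Oracles n p b)
    (ρ : Op (Fin n)) (σ : Op K) :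
    chan ((P.map Function.Embedding.inl).seq R) O ρ σ = chan R O ρ (P.run O ρ σ) := by
  rw [chan, Prog.run_seq, run_map_inl, chan]

lemma extend_sumMap_refl (f : K ↪ K') (x : K ⊕ W → Bool) (z : K' → Bool) (z' : W → Bool) :
    Function.extend (f.sumMap (Function.Embedding.refl W)) x (Sum.elim z z') =
      Sum.elim (Function.extend f (x ∘ Sum.inl) z) (x ∘ Sum.inr) := by
  rw [eq_comm, extend_eq_iff]
  constructor
  · funext q
    rcases q with q | q
    · simp [f.injective.extend_apply]
    · rfl
  · rintro (q | q) hq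
    · simp only [Sum.elim_inl]
      rw [Function.extend_apply']
      rintro ⟨k, rfl⟩
      exact hq ⟨Sum.inl k, rfl⟩
    · exact (hq ⟨Sum.inr q, rfl⟩).elim

/-- The analogue of `Prog.run_map` for operations with workspace: `f` enlarges the register while
the workspace stays the same. -/
lemma blk_chan_map (f : K ↪ K') (z z' : K' → Bool) (P : Prog n p b (K ⊕ W)) (O : Oracles n p b)
    (ρ : Op (Fin n)) (σ : Op K') :
    blk f z z' (chan (P.map (f.sumMap (Function.Embedding.refl W))) O ρ σ) =
      chan P O ρ (blk f z z' σ) := by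
  have h : blk (f.sumMap (Function.Embedding.refl W)) (Sum.elim z fun _ => false)
      (Sum.elim z' fun _ => false) (addZeros σ) = addZeros (blk f z z' σ) := by
    ext x y
    simp only [blk, addZeros, Matrix.of_apply, extend_sumMap_refl, Sum.elim_inr,
      Function.comp_apply, Sum.elim_comp_inl]
    congr 1
  ext x y
  simp only [chan, traceOut, ← h, ← Prog.run_map]
  simp only [blk, Matrix.of_apply, extend_sumMap_refl, Sum.elim_comp_inl, Sum.elim_comp_inr]

lemma chan_map_workspace (g : W₁ ≃ W₂) (P : Prog n p b (K ⊕ W₁)) (O : Oracles n p b)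
    (ρ : Op (Fin n)) (σ : Op K) :
    chan (P.map ((Function.Embedding.refl K).sumMap g.toEmbedding)) O ρ σ = chan P O ρ σ := by
  have hext : ∀ (x : K ⊕ W₁ → Bool) (z : K ⊕ W₂ → Bool),
      Function.extend ((Function.Embedding.refl K).sumMap g.toEmbedding) x z =
        Sum.elim (x ∘ Sum.inl) (x ∘ Sum.inr ∘ g.symm) := by
    intro x z
    rw [eq_comm, extend_eq_iff]
    constructor
    · funext q; rcases q with q | q <;> simp
    · rintro (q | q) hq
      · exact (hq ⟨Sum.inl q, rfl⟩).elim
      · exact (hq ⟨Sum.inr (g.symm q), by simp⟩).elim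
  have h : blk ((Function.Embedding.refl K).sumMap g.toEmbedding) (fun _ => false)
      (fun _ => false) (addZeros σ) = addZeros σ := by
    ext x y
    simp only [blk, addZeros, Matrix.of_apply, hext, Sum.elim_inr,
      Function.comp_apply, Sum.elim_comp_inl]
    refine if_congr (and_congr ?_ ?_) rfl rfl
    · exact g.symm.forall_congr_left.trans (by simp)
    · exact g.symm.forall_congr_left.trans (by simp)
  ext x y
  simp only [chan, traceOut]
  conv_rhs => rw [← h]
  simp only [← Prog.run_map]
  simp only [blk, Matrix.of_apply, hext]
  rw [← Equiv.sum_comp (g.arrowCongr (Equiv.refl Bool))]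
  simp only [← Function.comp_assoc, Sum.elim_comp_inl, Sum.elim_comp_inr]
  rfl

/-- The part `W` of the register is made a part of the workspace. -/
def assocW (P : Prog n p b ((K ⊕ W₁) ⊕ W₂)) : Prog n p b (K ⊕ (W₁ ⊕ W₂)) :=
  P.map (Equiv.sumAssoc K W₁ W₂).toEmbedding

lemma chan_assocW (P : Prog n p b ((K ⊕ W₁) ⊕ W₂)) (O : Oracles n p b) (ρ : Op (Fin n))
    (σ : Op K) : chan (assocW P) O ρ σ = traceOut (chan P O ρ (addZeros σ)) := by
  have hext : ∀ (x : (K ⊕ W₁) ⊕ W₂ → Bool) (z : K ⊕ (W₁ ⊕ W₂) → Bool),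
      Function.extend (Equiv.sumAssoc K W₁ W₂).toEmbedding x z =
        Sum.elim (x ∘ Sum.inl ∘ Sum.inl) (Sum.elim (x ∘ Sum.inl ∘ Sum.inr) (x ∘ Sum.inr)) := by
    intro x z
    rw [eq_comm, extend_eq_iff]
    constructor
    · funext q; rcases q with (q | q) | q <;> rfl
    · intro q hq
      exact (hq ⟨(Equiv.sumAssoc K W₁ W₂).symm q, by simp⟩).elim
  have h : blk (Equiv.sumAssoc K W₁ W₂).toEmbedding (fun _ => false)
      (fun _ => false) (addZeros σ) = addZeros (addZeros σ) := by
    ext x y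
    simp only [blk, addZeros, Matrix.of_apply, hext, Sum.elim_inr, Sum.forall, Sum.elim_inl,
      Function.comp_apply, Sum.elim_comp_inl, ← Function.comp_assoc]
    split_ifs <;> first | rfl | grind
  ext x y
  simp only [chan, traceOut, sum_sum_arrow]
  rw [← h]
  simp only [← Prog.run_map]
  simp only [blk, Matrix.of_apply, hext, assocW]
  rfl

end Workspace

/-! ### Combining circuits -/

namespace Circuit

variable {n p b : ℕ} {K K' : Type} [Fintype K] [DecidableEq K] [Fintype K'] [DecidableEq K']

/-- The program `P` as a circuit. -/
def ofProg {W : Type} [Fintype W] (P : Prog n p b (K ⊕ W)) : Circuit n p b K where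
  w := Fintype.card W
  prog := P.map ((Function.Embedding.refl K).sumMap (Fintype.equivFin W).toEmbedding)

@[simp] lemma copies_ofProg {W : Type} [Fintype W] (P : Prog n p b (K ⊕ W)) :
    (ofProg P).prog.copies = P.copies := Prog.copies_map _ _

@[simp] lemma gates_ofProg {W : Type} [Fintype W] (P : Prog n p b (K ⊕ W)) :
    (ofProg P).prog.gates = P.gates := Prog.gates_map _ _

@[simp] lemma channel_ofProg {W : Type} [Fintype W] [DecidableEq W] (P : Prog n p b (K ⊕ W))
    (O : Oracles n p b) (ρ : Op (Fin n)) (σ : Op K) :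
    (ofProg P).channel O ρ σ = chan P O ρ σ := chan_map_workspace _ _ _ _ _

lemma channel_eq (C : Circuit n p b K) (O : Oracles n p b) (ρ : Op (Fin n)) (σ : Op K) :
    C.channel O ρ σ = chan C.prog O ρ σ := rfl

/-- A program on the register itself, followed by a circuit. -/
def prepend (P : Prog n p b K) (C : Circuit n p b K) : Circuit n p b K where
  w := C.w
  prog := (P.map Function.Embedding.inl).seq C.prog

lemma copies_prepend (P : Prog n p b K) (C : Circuit n p b K) :
    (prepend P C).prog.copies ≤ P.copies + C.prog.copies := by
  simpa [prepend] using Prog.copies_seq (P.map Function.Embedding.inl) C.prog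

lemma gates_prepend (P : Prog n p b K) (C : Circuit n p b K) :
    (prepend P C).prog.gates ≤ P.gates + C.prog.gates := by
  simpa [prepend] using Prog.gates_seq (P.map Function.Embedding.inl) C.prog

lemma channel_prepend (P : Prog n p b K) (C : Circuit n p b K) (O : Oracles n p b)
    (ρ : Op (Fin n)) (σ : Op K) :
    (prepend P C).channel O ρ σ = C.channel O ρ (P.run O ρ σ) := chan_map_inl_seq _ _ _ _ _

/-- First `C`, then `D`. -/
def seq (C D : Circuit n p b K) : Circuit n p b K := ofProg (seqW C.prog D.prog)

lemma copies_seq (C D : Circuit n p b K) :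
    (seq C D).prog.copies ≤ C.prog.copies + D.prog.copies := by
  simpa [seq, seqW] using Prog.copies_seq (C.prog.map wkl) (D.prog.map wkr)

lemma gates_seq (C D : Circuit n p b K) :
    (seq C D).prog.gates ≤ C.prog.gates + D.prog.gates := by
  simpa [seq, seqW] using Prog.gates_seq (C.prog.map wkl) (D.prog.map wkr)

lemma channel_seq (C D : Circuit n p b K) (O : Oracles n p b) (ρ : Op (Fin n)) (σ : Op K) :
    (seq C D).channel O ρ σ = D.channel O ρ (C.channel O ρ σ) := by
  rw [seq, channel_ofProg, chan_seqW]
  rfl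

/-- Measure the qubit `q`; for the outcome `1` continue with `C` on the qubits `f k`. -/
def retry (q : K') (f : K ↪ K') (C : Circuit n p b K) : Circuit n p b K' where
  w := C.w
  prog := .measure (Sum.inl q) fun c =>
    bif c then C.prog.map (f.sumMap (Function.Embedding.refl (Fin C.w))) else .done

lemma copies_retry (q : K') (f : K ↪ K') (C : Circuit n p b K) :
    (retry q f C).prog.copies = C.prog.copies := by
  simp [retry, Prog.copies]

lemma gates_retry (q : K') (f : K ↪ K') (C : Circuit n p b K) :
    (retry q f C).prog.gates = C.prog.gates + 1 := by
  simp [retry, Prog.gates]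

lemma extend_comp_self (f : K ↪ K') (x : K' → Bool) : Function.extend f (x ∘ f) x = x :=
  ((extend_eq_iff f _ _ _).2 ⟨rfl, fun _ _ => rfl⟩).symm

lemma addZeros_proj {W : Type} [Fintype W] [DecidableEq W] (q : K) (c : Bool) (σ : Op K) :
    proj (Sum.inl q) c * addZeros (W := W) σ * proj (Sum.inl q) c =
      addZeros (proj q c * σ * proj q c) := by
  classical
  ext x y
  simp only [proj, Matrix.mul_diagonal, Matrix.diagonal_mul, addZeros, Matrix.of_apply,
    Function.comp_apply]
  split_ifs <;> simp

/-- Measurement sums the two branches incoherently; the branch with outcome 1 is described block by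
block through `blk_chan_map`. -/
lemma channel_retry (q : K') (f : K ↪ K') (C : Circuit n p b K) (O : Oracles n p b)
    (ρ : Op (Fin n)) (σ : Op K') (x y : K' → Bool) :
    (retry q f C).channel O ρ σ x y = (proj q false * σ * proj q false) x y +
      C.channel O ρ (blk f x y (proj q true * σ * proj q true)) (x ∘ f) (y ∘ f) := by
  change chan (W := Fin C.w) (Prog.measure (Sum.inl q) fun c =>
    bif c then C.prog.map (f.sumMap (Function.Embedding.refl (Fin C.w))) else .done) O ρ σ x y = _
  simp only [chan, Prog.run, cond_false, cond_true, traceOut_add, Matrix.add_apply,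
    addZeros_proj, traceOut_addZeros]
  congr 1
  have := congrFun (congrFun (blk_chan_map f x y C.prog O ρ (proj q true * σ * proj q true))
    (x ∘ f)) (y ∘ f)
  refine Eq.trans ?_ this
  simp only [blk, chan, Matrix.of_apply, extend_comp_self]

/-- The register `Option K` as `K` and one more qubit. -/
def optionEmb : Option K ↪ K ⊕ Unit := (Equiv.optionEquivSumPUnit.{0, 0} K).toEmbedding

/-- The qubit `none` becomes a part of the workspace. -/
def hide (C : Circuit n p b (Option K)) : Circuit n p b K :=
  ofProg (assocW (C.prog.map (optionEmb.sumMap (Function.Embedding.refl (Fin C.w)))))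

@[simp] lemma copies_hide (C : Circuit n p b (Option K)) :
    (hide C).prog.copies = C.prog.copies := by
  simp [hide, assocW]

@[simp] lemma gates_hide (C : Circuit n p b (Option K)) :
    (hide C).prog.gates = C.prog.gates := by
  simp [hide, assocW]

/-- The bit string with the bit `c` at `none`. -/
def consBit (c : Bool) (x : K → Bool) : Option K → Bool := fun q => q.elim c x

/-- Add a qubit `none` in the state `|0⟩`. -/
def addQubit (σ : Op K) : Op (Option K) :=
  Matrix.of fun x y => if x none = false ∧ y none = false then σ (x ∘ some) (y ∘ some) else 0

lemma channel_hide (C : Circuit n p b (Option K)) (O : Oracles n p b) (ρ : Op (Fin n)) (σ : Op K)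
    (x y : K → Bool) :
    (hide C).channel O ρ σ x y =
      ∑ c, C.channel O ρ (addQubit σ) (consBit c x) (consBit c y) := by
  have hext : ∀ (x : Option K → Bool) (z : K ⊕ Unit → Bool),
      Function.extend optionEmb x z = Sum.elim (x ∘ some) fun _ => x none := by
    intro x z
    rw [eq_comm, extend_eq_iff]
    constructor
    · funext q; rcases q with _ | q <;> rfl
    · rintro (q | q) hq
      · exact (hq ⟨some q, rfl⟩).elim
      · exact (hq ⟨none, rfl⟩).elim
  have h : blk (optionEmb (K := K)) (fun _ => false) (fun _ => false) (addZeros σ) =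
      addQubit σ := by
    ext x y
    simp [blk, addZeros, addQubit, hext]
  simp only [hide, channel_ofProg, chan_assocW]
  rw [channel_eq, ← h, ← blk_chan_map]
  simp only [traceOut, Matrix.of_apply, blk, hext]
  rw [← Equiv.sum_comp (Equiv.funUnique Unit Bool).symm]
  refine Finset.sum_congr rfl fun c _ => ?_
  rfl

/-- The circuit that stops where `C` reports a failure. -/
def noHalt (C : Circuit n p b K) : Circuit n p b K := ⟨C.w, C.prog.noHalt⟩

/-- The circuit replaces the contents of its register by the state `ω`. -/
def Replaces (C : Circuit n p b K) (O : Oracles n p b) (ρ : Op (Fin n)) (ω : Op K) : Prop :=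
  ∀ σ, C.channel O ρ σ = σ.trace • ω

end Circuit

section Subst

variable {n p b : ℕ}

/-- On each block, `Replaces` yields the trace of the block times `ω`, and the block traces are
exactly the partial trace in `reload`. Hence correlations with the rest of the register are treated
as by a genuine copy instruction. -/
lemma chan_reload {Q : Type} [Fintype Q] [DecidableEq Q] (Z : Circuit n p b (Fin n))
    {O : Oracles n p b} {ρ ω : Op (Fin n)} (hZ : Z.Replaces O ρ ω) (e : Fin n ↪ Q) (σ : Op Q) :
    chan (Z.prog.map (e.sumMap (Function.Embedding.refl (Fin Z.w)))) O ρ σ = reload e ω σ := by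
  ext x y
  have := congrFun (congrFun (blk_chan_map e x y Z.prog O ρ σ) (x ∘ e)) (y ∘ e)
  rw [← Circuit.channel_eq, hZ] at this
  rw [blk] at this
  simp only [Matrix.of_apply, Circuit.extend_comp_self] at this
  rw [this]
  simp only [Matrix.trace, Matrix.diag, blk, reload, Matrix.of_apply, Matrix.smul_apply,
    smul_eq_mul]
  ring

/-- The copies that a program uses can be prepared by a circuit. -/
theorem exists_subst {Q : Type} [Fintype Q] [DecidableEq Q] (Z : Circuit n p b (Fin n))
    (P : Prog n p b Q) : ∃ (w : ℕ) (P' : Prog n p b (Q ⊕ Fin w)),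
      P'.copies ≤ P.copies * Z.prog.copies ∧
      P'.gates ≤ P.gates + P.copies * Z.prog.gates ∧
      ∀ (O : Oracles n p b) (ρ ω : Op (Fin n)), Z.Replaces O ρ ω →
        ∀ σ, chan P' O ρ σ = P.run O ω σ := by
  induction P with
  | done =>
    exact ⟨0, .done, by simp [Prog.copies], by simp [Prog.gates],
      fun O ρ ω _ σ => traceOut_addZeros σ⟩
  | halt =>
    refine ⟨0, .halt, by simp [Prog.copies], by simp [Prog.gates], fun O ρ ω _ σ => ?_⟩
    ext x y
    simp [chan, Prog.run, traceOut]
  | gate k hk e U P ih =>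
    obtain ⟨w, P', hc, hg, h⟩ := ih
    refine ⟨w, ((Prog.gate k hk e U .done).map .inl).seq P', hc, ?_,
      fun O ρ ω hZ σ => ?_⟩
    · simp only [Prog.map, Prog.seq, Prog.gates, Prog.copies]; omega
    · rw [chan_map_inl_seq, h O ρ ω hZ]; rfl
  | queryCoeff e P ih =>
    obtain ⟨w, P', hc, hg, h⟩ := ih
    refine ⟨w, ((Prog.queryCoeff e .done).map .inl).seq P', hc, ?_,
      fun O ρ ω hZ σ => ?_⟩
    · simp only [Prog.map, Prog.seq, Prog.gates, Prog.copies]; omega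
    · rw [chan_map_inl_seq, h O ρ ω hZ]; rfl
  | querySparse i e P ih =>
    obtain ⟨w, P', hc, hg, h⟩ := ih
    refine ⟨w, ((Prog.querySparse i e .done).map .inl).seq P', hc, ?_,
      fun O ρ ω hZ σ => ?_⟩
    · simp only [Prog.map, Prog.seq, Prog.gates, Prog.copies]; omega
    · rw [chan_map_inl_seq, h O ρ ω hZ]; cases i <;> rfl
  | copy e P ih =>
    obtain ⟨w, P', hc, hg, h⟩ := ih
    -- Every copy gets a workspace of its own for `Z`, since `Z` relies on its workspace being
    -- initially zero.
    let f := e.sumMap (Function.Embedding.refl (Fin Z.w))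
    refine ⟨_, (Circuit.ofProg (seqW (Z.prog.map f) P')).prog, ?_, ?_, fun O ρ ω hZ σ => ?_⟩
    · have := Prog.copies_seq ((Z.prog.map f).map (wkl (W₂ := Fin w))) (P'.map wkr)
      simp only [Prog.copies_map] at this
      simp only [Circuit.copies_ofProg, seqW, Prog.copies]
      linarith
    · have := Prog.gates_seq ((Z.prog.map f).map (wkl (W₂ := Fin w))) (P'.map wkr)
      simp only [Prog.gates_map] at this
      simp only [Circuit.gates_ofProg, seqW, Prog.gates, Prog.copies]
      linarith
    · rw [← Circuit.channel_eq, Circuit.channel_ofProg, chan_seqW, chan_reload Z hZ, h O ρ ω hZ]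
      rfl
  | measure q P ih =>
    obtain ⟨w₀, P₀, hc₀, hg₀, h₀⟩ := ih false
    obtain ⟨w₁, P₁, hc₁, hg₁, h₁⟩ := ih true
    -- Both workspaces are present but only one branch runs, so the counts combine by a maximum.
    let R : Prog n p b (Q ⊕ (Fin w₀ ⊕ Fin w₁)) :=
      .measure (.inl q) fun c => bif c then P₁.map wkr else P₀.map wkl
    refine ⟨_, (Circuit.ofProg R).prog, ?_, ?_, fun O ρ ω hZ σ => ?_⟩
    · simp only [Circuit.copies_ofProg, R, Prog.copies, cond_true, cond_false, Prog.copies_map]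
      refine max_le (hc₀.trans ?_) (hc₁.trans ?_) <;> gcongr <;> simp
    · simp only [Circuit.gates_ofProg, R, Prog.gates, Prog.copies, cond_true, cond_false,
        Prog.gates_map]
      have : max P₀.gates P₁.gates ≤ max (P false).gates (P true).gates +
          max (P false).copies (P true).copies * Z.prog.gates := by
        refine max_le (hg₀.trans ?_) (hg₁.trans ?_) <;> gcongr <;> simp
      omega
    · rw [← Circuit.channel_eq, Circuit.channel_ofProg]
      simp only [chan, R, Prog.run, cond_true, cond_false, traceOut_add, Circuit.addZeros_proj]
      rw [← h₀ O ρ ω hZ, ← h₁ O ρ ω hZ, ← traceOut_run_padl (W₂ := Fin w₁) P₀,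
        ← traceOut_run_padr (W₁ := Fin w₀) P₁]
      rfl

theorem Circuit.exists_subst {K : Type} [Fintype K] [DecidableEq K] (Z : Circuit n p b (Fin n))
    (Y : Circuit n p b K) : ∃ X : Circuit n p b K,
      X.prog.copies ≤ Y.prog.copies * Z.prog.copies ∧
      X.prog.gates ≤ Y.prog.gates + Y.prog.copies * Z.prog.gates ∧
      ∀ (O : Oracles n p b) (ρ ω : Op (Fin n)), Z.Replaces O ρ ω →
        ∀ σ, X.channel O ρ σ = Y.channel O ω σ := by
  obtain ⟨w, P', hc, hg, h⟩ := QGD.exists_subst Z Y.prog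
  refine ⟨ofProg (assocW P'), by simpa [assocW] using hc, by simpa [assocW] using hg,
    fun O ρ ω hZ σ => ?_⟩
  rw [channel_ofProg, chan_assocW, h O ρ ω hZ]
  rfl

end Subst

/-! ### The trace norm -/

section TraceNorm

variable {ι κ : Type} [Fintype ι] [DecidableEq ι] [Fintype κ] [DecidableEq κ]

lemma bddAbove_traceNorm (M : Matrix ι ι ℂ) :
    BddAbove (Set.range fun X : {X : Matrix ι ι ℂ // ‖X‖ ≤ 1} => ‖(X.1 * M).trace‖) := by
  let φ : Matrix ι ι ℂ →ₗ[ℂ] ℂ := (Matrix.traceLinearMap ι ℂ ℂ).comp (LinearMap.mulRight ℂ M)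
  refine ⟨‖LinearMap.toContinuousLinearMap φ‖, ?_⟩
  rintro _ ⟨X, rfl⟩
  have := (LinearMap.toContinuousLinearMap φ).le_opNorm X.1
  calc _ ≤ ‖LinearMap.toContinuousLinearMap φ‖ * ‖X.1‖ := this
    _ ≤ ‖LinearMap.toContinuousLinearMap φ‖ * 1 := by gcongr; exact X.2
    _ = _ := mul_one _

lemma norm_trace_mul_le (X M : Matrix ι ι ℂ) : ‖(X * M).trace‖ ≤ ‖X‖ * traceNorm M := by
  rcases eq_or_ne X 0 with rfl | hX
  · simp
  have hX' : 0 < ‖X‖ := norm_pos_iff.2 hX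
  have h := le_ciSup (bddAbove_traceNorm M) ⟨((‖X‖ : ℂ)⁻¹) • X, by
    rw [norm_smul, norm_inv, Complex.norm_real, norm_norm, inv_mul_cancel₀ hX'.ne']⟩
  simp only [Matrix.smul_mul, Matrix.trace_smul, smul_eq_mul, norm_mul, norm_inv,
    Complex.norm_real, norm_norm] at h
  rwa [inv_mul_le_iff₀ hX'] at h

lemma norm_trace_le (M : Matrix ι ι ℂ) : ‖M.trace‖ ≤ traceNorm M := by
  rcases isEmpty_or_nonempty ι with hι | hι
  · rw [Matrix.trace, Finset.univ_eq_empty, Finset.sum_empty, norm_zero]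
    exact Real.iSup_nonneg fun _ => norm_nonneg _
  simpa using norm_trace_mul_le 1 M

lemma traceNorm_le {M : Matrix ι ι ℂ} {c : ℝ} (h : ∀ X, ‖X‖ ≤ 1 → ‖(X * M).trace‖ ≤ c) :
    traceNorm M ≤ c := by
  have : Nonempty {X : Matrix ι ι ℂ // ‖X‖ ≤ 1} := ⟨⟨0, by simp⟩⟩
  exact ciSup_le fun X => h X.1 X.2

lemma traceNorm_nonneg (M : Matrix ι ι ℂ) : 0 ≤ traceNorm M :=
  (norm_nonneg _).trans (norm_trace_le M)

lemma traceNorm_add_le (M N : Matrix ι ι ℂ) : traceNorm (M + N) ≤ traceNorm M + traceNorm N := by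
  refine traceNorm_le fun X hX => ?_
  rw [Matrix.mul_add, Matrix.trace_add]
  refine (norm_add_le _ _).trans (add_le_add ?_ ?_)
  · exact (norm_trace_mul_le X M).trans (mul_le_of_le_one_left (traceNorm_nonneg _) hX)
  · exact (norm_trace_mul_le X N).trans (mul_le_of_le_one_left (traceNorm_nonneg _) hX)

lemma traceNorm_smul_le (c : ℂ) (M : Matrix ι ι ℂ) : traceNorm (c • M) ≤ ‖c‖ * traceNorm M := by
  refine traceNorm_le fun X hX => ?_
  rw [Matrix.mul_smul, Matrix.trace_smul, norm_smul]
  gcongr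
  exact (norm_trace_mul_le X M).trans (mul_le_of_le_one_left (traceNorm_nonneg _) hX)

lemma traceNorm_sub_comm (M N : Matrix ι ι ℂ) : traceNorm (M - N) = traceNorm (N - M) := by
  have h : ∀ M N : Matrix ι ι ℂ, traceNorm (M - N) ≤ traceNorm (N - M) := fun M N => by
    simpa using traceNorm_smul_le (-1) (N - M)
  exact le_antisymm (h M N) (h N M)

lemma traceNorm_sub_le (M N R : Matrix ι ι ℂ) :
    traceNorm (M - R) ≤ traceNorm (M - N) + traceNorm (N - R) := by
  simpa using traceNorm_add_le (M - N) (N - R)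

/-- With the trace norm defined by duality, cyclicity of the trace moves `A` and `B` onto the test
operator. Rectangular `A` and `B` are allowed so that compressions to a block and rank-one operators
are covered too. -/
lemma traceNorm_mul_mul_le (A : Matrix κ ι ℂ) (M : Matrix ι ι ℂ) (B : Matrix ι κ ℂ) :
    traceNorm (A * M * B) ≤ ‖A‖ * ‖B‖ * traceNorm M := by
  refine traceNorm_le fun X hX => ?_
  have h : (X * (A * M * B)).trace = ((B * X * A) * M).trace := by
    rw [← Matrix.mul_assoc, Matrix.trace_mul_comm, ← Matrix.mul_assoc, ← Matrix.mul_assoc]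
  rw [h]
  refine (norm_trace_mul_le _ M).trans ?_
  gcongr
  · exact traceNorm_nonneg M
  calc ‖B * X * A‖ ≤ ‖B‖ * ‖X‖ * ‖A‖ :=
        (Matrix.l2_opNorm_mul _ _).trans (by gcongr; exact Matrix.l2_opNorm_mul _ _)
    _ ≤ ‖B‖ * 1 * ‖A‖ := by gcongr
    _ = ‖A‖ * ‖B‖ := by ring

lemma norm_unit (M : Matrix Unit Unit ℂ) : ‖M‖ = ‖M () ()‖ := by
  have : M = Matrix.diagonal fun _ => M () () := by ext; simp
  conv_lhs => rw [this]
  rw [Matrix.l2_opNorm_diagonal, pi_norm_const]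

lemma traceNorm_unit_le : traceNorm (1 : Matrix Unit Unit ℂ) ≤ 1 := by
  refine traceNorm_le fun X hX => ?_
  rw [norm_unit] at hX
  simpa [Matrix.trace] using hX

lemma norm_conjTranspose (A : Matrix ι κ ℂ) : ‖A.conjTranspose‖ = ‖A‖ :=
  Matrix.l2_opNorm_conjTranspose A

lemma norm_le_one_of_conjTranspose_mul_self {J : Matrix ι κ ℂ} (h : J.conjTranspose * J = 1) :
    ‖J‖ ≤ 1 := by
  have h1 := Matrix.l2_opNorm_conjTranspose_mul_self J
  have h2 : ‖(1 : Matrix κ κ ℂ)‖ ≤ 1 := by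
    rw [← Matrix.diagonal_one, Matrix.l2_opNorm_diagonal]
    exact (pi_norm_le_iff_of_nonneg zero_le_one).2 fun i => by simp
  rw [h] at h1
  nlinarith [norm_nonneg J]

lemma traceNorm_rankOne_le (u v : Matrix ι Unit ℂ) :
    traceNorm (u * v.conjTranspose) ≤ ‖u‖ * ‖v‖ := by
  have := traceNorm_mul_mul_le u 1 v.conjTranspose
  rw [Matrix.mul_one, norm_conjTranspose] at this
  exact this.trans (mul_le_of_le_one_right (by positivity) traceNorm_unit_le)

-- Writing M = B*B and moving B by cyclicity turns tr(XM) into tr(BXB*), whose i-th diagonal entry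
-- is at most ‖X‖ times the squared norm of the i-th row of B. Those squared norms add up to tr M.
open scoped MatrixOrder in
lemma traceNorm_le_trace {M : Matrix ι ι ℂ} (hM : M.PosSemidef) : traceNorm M ≤ M.trace.re := by
  refine traceNorm_le fun X hX => ?_
  obtain ⟨B, rfl⟩ := CStarAlgebra.nonneg_iff_eq_star_mul_self.1 hM.nonneg
  rw [Matrix.star_eq_conjTranspose]
  have h1 : (X * (B.conjTranspose * B)).trace = (B * X * B.conjTranspose).trace := by
    rw [← Matrix.mul_assoc, Matrix.trace_mul_comm, Matrix.mul_assoc]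
  rw [h1, Matrix.trace_mul_comm B.conjTranspose, Matrix.trace, Matrix.trace, Complex.re_sum]
  refine (norm_sum_le _ _).trans (Finset.sum_le_sum fun i _ => ?_)
  let r : Matrix Unit ι ℂ := B.submatrix (fun _ => i) id
  have h2 : (B * X * B.conjTranspose).diag i = (r * X * r.conjTranspose) () () := by
    simp [r, Matrix.mul_apply]
  have h3 : ((B * B.conjTranspose).diag i).re = ‖r * r.conjTranspose‖ := by
    rw [norm_unit]
    have : (B * B.conjTranspose).diag i = ((∑ j, ‖B i j‖ ^ 2 : ℝ) : ℂ) := by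
      simp [Matrix.mul_apply, Complex.mul_conj']
    have h4 : (r * r.conjTranspose) () () = (B * B.conjTranspose).diag i := by
      simp [r, Matrix.mul_apply]
    rw [h4, this, Complex.ofReal_re, Complex.norm_real, Real.norm_of_nonneg]
    positivity
  rw [h2, h3, ← norm_unit]
  have h4 : ‖r * r.conjTranspose‖ = ‖r‖ * ‖r‖ := by
    have := Matrix.l2_opNorm_conjTranspose_mul_self r.conjTranspose
    rwa [Matrix.conjTranspose_conjTranspose, norm_conjTranspose] at this
  rw [h4]
  calc ‖r * X * r.conjTranspose‖ ≤ ‖r‖ * ‖X‖ * ‖r.conjTranspose‖ :=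
        (Matrix.l2_opNorm_mul _ _).trans (by gcongr; exact Matrix.l2_opNorm_mul _ _)
    _ ≤ ‖r‖ * 1 * ‖r‖ := by rw [norm_conjTranspose]; gcongr
    _ = _ := by ring

lemma traceNorm_of_isDensity {ρ : Matrix ι ι ℂ} (h : IsDensity ρ) : traceNorm ρ ≤ 1 := by
  simpa [h.2] using traceNorm_le_trace h.1

lemma traceNorm_sub_le_two {ρ σ : Matrix ι ι ℂ} (h : IsDensity ρ) (h' : IsDensity σ) :
    traceNorm (ρ - σ) ≤ 2 := by
  have := traceNorm_sub_le ρ 0 σ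
  rw [sub_zero, traceNorm_sub_comm 0, sub_zero] at this
  linarith [traceNorm_of_isDensity h, traceNorm_of_isDensity h']

lemma traceNorm_submatrix_le (e : κ ≃ ι) (M : Matrix ι ι ℂ) :
    traceNorm (M.submatrix e e) ≤ traceNorm M := by
  let J : Matrix ι κ ℂ := (1 : Matrix ι ι ℂ).submatrix id e
  have hJ : J.conjTranspose * J = 1 := by
    ext x y
    simp [J, Matrix.mul_apply, Matrix.one_apply, e.injective.eq_iff]
  have h : M.submatrix e e = J.conjTranspose * M * J := by
    ext x y
    simp [J, Matrix.mul_apply, Matrix.one_apply]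
  rw [h]
  refine (traceNorm_mul_mul_le _ _ _).trans ?_
  rw [norm_conjTranspose]
  have := norm_le_one_of_conjTranspose_mul_self hJ
  exact mul_le_of_le_one_left (traceNorm_nonneg _) (by nlinarith [norm_nonneg J])

end TraceNorm

/-! ### Positivity and normalisation of the output of a program -/

section Positivity

variable {n p b : ℕ} {K Q : Type} [Fintype K] [DecidableEq K] [Fintype Q] [DecidableEq Q]

lemma onQubits_one (e : K ↪ Q) : onQubits e (1 : Op K) = 1 := by
  classical
  ext x y
  simp only [onQubits, Matrix.of_apply, Matrix.one_apply]
  by_cases h : x = y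
  · subst h; simp
  · rw [if_neg h]
    split_ifs with h1 h2
    · exact (h (funext fun q => by
        by_cases hq : q ∈ Set.range e
        · obtain ⟨k, rfl⟩ := hq; exact congrFun h2 k
        · exact h1 q hq)).elim
    · rfl
    · rfl

lemma onQubits_mul (e : K ↪ Q) (U V : Op K) :
    onQubits e (U * V) = onQubits e U * onQubits e V := by
  classical
  ext x y
  have h1 : ∀ w : Q → Bool, (∀ q ∉ Set.range e, x q = w q) ↔
      w = Function.extend e (w ∘ e) x := by
    intro w
    rw [extend_eq_iff]
    simp [eq_comm]
  simp only [onQubits, Matrix.of_apply, Matrix.mul_apply]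
  have h2 : ∀ F : (Q → Bool) → ℂ, (∑ w, if ∀ q ∉ Set.range e, x q = w q then F w else 0) =
      ∑ k : K → Bool, F (Function.extend e k x) := by
    intro F
    rw [← Finset.sum_filter]
    refine Finset.sum_bij' (fun w _ => w ∘ e) (fun k _ => Function.extend e k x) ?_ ?_ ?_ ?_ ?_
    · simp
    · intro k _
      simp only [Finset.mem_filter, Finset.mem_univ, true_and]
      rw [h1, extend_comp]
    · intro w hw
      simp only [Finset.mem_filter, Finset.mem_univ, true_and] at hw
      exact ((h1 w).1 hw).symm
    · intro k _; exact extend_comp e k x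
    · intro w hw
      simp only [Finset.mem_filter, Finset.mem_univ, true_and] at hw
      rw [← (h1 w).1 hw]
  simp only [ite_mul, zero_mul]
  rw [h2]
  simp only [extend_comp]
  have h3 : ∀ k : K → Bool, (∀ q ∉ Set.range e, Function.extend e k x q = y q) ↔
      ∀ q ∉ Set.range e, x q = y q := by
    intro k
    refine forall₂_congr fun q hq => ?_
    rw [Function.extend_apply' _ _ _ (by simpa using hq)]
  simp only [h3]
  split_ifs <;> simp

lemma onQubits_mem_unitaryGroup (e : K ↪ Q) {U : Op K}
    (hU : U ∈ Matrix.unitaryGroup (K → Bool) ℂ) :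
    onQubits e U ∈ Matrix.unitaryGroup (Q → Bool) ℂ := by
  rw [Matrix.mem_unitaryGroup_iff] at hU ⊢
  rw [Matrix.star_eq_conjTranspose] at hU ⊢
  rw [onQubits_conjTranspose, ← onQubits_mul, hU, onQubits_one]

lemma basisMap_mem_unitaryGroup {f : (Q → Bool) → Q → Bool} (hf : Function.Injective f) :
    basisMap f ∈ Matrix.unitaryGroup (Q → Bool) ℂ := by
  classical
  rw [Matrix.mem_unitaryGroup_iff', Matrix.star_eq_conjTranspose]
  ext x y
  simp [basisMap, Matrix.mul_apply, Matrix.one_apply, hf.eq_iff, eq_comm]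

lemma Oracles.coeffGate_mem (O : Oracles n p b) :
    O.coeffGate ∈ Matrix.unitaryGroup (CoeffReg n p b → Bool) ℂ := by
  refine basisMap_mem_unitaryGroup (Function.Involutive.injective fun x => ?_)
  funext q
  rcases q with q | q
  · rfl
  · simp

lemma Oracles.sparseGate_mem (O : Oracles n p b) :
    O.sparseGate ∈ Matrix.unitaryGroup (SparseReg n p → Bool) ℂ := by
  refine basisMap_mem_unitaryGroup fun x y hxy => ?_
  have h1 : ∀ q, x (Sum.inl q) = y (Sum.inl q) := fun q => congrFun hxy (Sum.inl q)
  have h2 : (fun i k => x (Sum.inr (i, k))) = fun i k => y (Sum.inr (i, k)) := by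
    have h3 : (fun i k => x (Sum.inl (i, k))) = fun i k => y (Sum.inl (i, k)) := by
      funext i k; exact h1 (i, k)
    have h4 : O.col (fun i k => x (Sum.inl (i, k))) (fun i k => x (Sum.inr (i, k))) =
        O.col (fun i k => y (Sum.inl (i, k))) (fun i k => y (Sum.inr (i, k))) := by
      funext i k; exact congrFun hxy (Sum.inr (i, k))
    rw [h3] at h4
    exact (O.col _).injective h4
  funext q
  rcases q with q | ⟨i, k⟩
  · exact h1 q
  · exact congrFun (congrFun h2 i) k

/-- The reloaded state is a Hadamard product of two pullbacks, so the Schur product theorem applies.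
-/
lemma reload_posSemidef (e : K ↪ Q) {ρ : Op K} {σ : Op Q} (hρ : ρ.PosSemidef)
    (hσ : σ.PosSemidef) : (reload e ρ σ).PosSemidef := by
  have h1 : (ρ.submatrix (fun x : Q → Bool => x ∘ e) (fun x => x ∘ e)).PosSemidef := hρ.submatrix _
  have h2 : (∑ z : K → Bool, σ.submatrix (fun x => Function.extend e z x)
      (fun x => Function.extend e z x)).PosSemidef :=
    Matrix.posSemidef_sum _ fun z _ => hσ.submatrix _
  have h3 := Matrix.PosSemidef.hadamard (𝕜 := ℂ) h1 h2
  have h4 : reload e ρ σ = (ρ.submatrix (fun x : Q → Bool => x ∘ e) (fun x => x ∘ e)).hadamard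
      (∑ z : K → Bool, σ.submatrix (fun x => Function.extend e z x)
        (fun x => Function.extend e z x)) := by
    ext x y
    simp [reload, Matrix.hadamard, Matrix.sum_apply]
  rw [h4]
  exact h3

/-- Exchanging the bits at `e` with the summation variable is an involution of the index set and
decouples the two sums. -/
lemma trace_reload (e : K ↪ Q) (ρ : Op K) (σ : Op Q) :
    (reload e ρ σ).trace = ρ.trace * σ.trace := by
  have hinv : Function.Involutive fun X : (Q → Bool) × (K → Bool) =>
      (Function.extend e X.2 X.1, X.1 ∘ e) := by
    rintro ⟨x, z⟩
    simp only [extend_comp, Prod.mk.injEq, and_true]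
    rw [eq_comm, extend_eq_iff]
    refine ⟨rfl, fun q hq => ?_⟩
    rw [Function.extend_apply' _ _ _ (by simpa using hq)]
  calc (reload e ρ σ).trace = ∑ X : (Q → Bool) × (K → Bool), ρ (X.1 ∘ e) (X.1 ∘ e) *
        σ (Function.extend e X.2 X.1) (Function.extend e X.2 X.1) := by
        rw [Fintype.sum_prod_type]
        simp [Matrix.trace, reload, Finset.mul_sum]
    _ = ∑ X : (Q → Bool) × (K → Bool), ρ X.2 X.2 * σ X.1 X.1 := by
        rw [← Equiv.sum_comp hinv.toPerm fun X => ρ X.2 X.2 * σ X.1 X.1]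
        rfl
    _ = ρ.trace * σ.trace := by
        rw [Fintype.sum_prod_type, Finset.sum_comm]
        simp only [Matrix.trace, Matrix.diag, Finset.mul_sum, Finset.sum_mul]
        exact Finset.sum_comm

lemma proj_add_proj (q : Q) : proj q false + proj q true = 1 := by
  classical
  ext x y
  by_cases h : x = y
  · subst h; cases hx : x q <;> simp [proj, hx]
  · simp [proj, h]

lemma proj_mul_self (q : Q) (c : Bool) : proj q c * proj q c = proj q c := by
  classical
  ext x y
  by_cases h : x = y
  · subst h; simp [proj]
  · simp [proj, h]

lemma trace_proj_add (q : Q) (σ : Op Q) :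
    (proj q false * σ * proj q false).trace + (proj q true * σ * proj q true).trace =
      σ.trace := by
  have h : ∀ c, (proj q c * σ * proj q c).trace = (proj q c * σ).trace := fun c => by
    rw [Matrix.trace_mul_comm, ← Matrix.mul_assoc, proj_mul_self]
  rw [h, h, ← Matrix.trace_add, ← Matrix.add_mul, proj_add_proj, Matrix.one_mul]

lemma trace_conj {U : Op Q} (hU : U ∈ Matrix.unitaryGroup (Q → Bool) ℂ) (σ : Op Q) :
    (U * σ * U.conjTranspose).trace = σ.trace := by
  rw [Matrix.trace_mul_comm, ← Matrix.mul_assoc]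
  rw [Matrix.mem_unitaryGroup_iff', Matrix.star_eq_conjTranspose] at hU
  rw [hU, Matrix.one_mul]

lemma conjTranspose_mem_unitaryGroup {U : Op Q} (hU : U ∈ Matrix.unitaryGroup (Q → Bool) ℂ) :
    U.conjTranspose ∈ Matrix.unitaryGroup (Q → Bool) ℂ := Unitary.star_mem hU

/-- Elementary operations preserve positivity and the trace; the probability that a program
reports a failure is the trace that is lost. -/
theorem Prog.run_noHalt (O : Oracles n p b) {ρ : Op (Fin n)} (hρ : IsDensity ρ)
    (P : Prog n p b Q) {σ : Op Q} (hσ : σ.PosSemidef) :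
    (P.noHalt.run O ρ σ).PosSemidef ∧ (P.noHalt.run O ρ σ).trace = σ.trace ∧
      (P.noHalt.run O ρ σ - P.run O ρ σ).PosSemidef := by
  induction P generalizing σ with
  | done => simpa [noHalt, run] using ⟨hσ, Matrix.PosSemidef.zero⟩
  | halt => simpa [noHalt, run] using hσ
  | gate k hk e U P ih =>
    have := ih (hσ.mul_mul_conjTranspose_same (onQubits e U.1))
    rwa [trace_conj (onQubits_mem_unitaryGroup e U.2)] at this
  | queryCoeff e P ih =>
    have := ih (hσ.mul_mul_conjTranspose_same (onQubits e O.coeffGate))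
    rwa [trace_conj (onQubits_mem_unitaryGroup e O.coeffGate_mem)] at this
  | querySparse i e P ih =>
    cases i
    · have := ih (hσ.mul_mul_conjTranspose_same (onQubits e O.sparseGate))
      rwa [trace_conj (onQubits_mem_unitaryGroup e O.sparseGate_mem)] at this
    · have h := trace_conj (conjTranspose_mem_unitaryGroup
        (onQubits_mem_unitaryGroup e O.sparseGate_mem)) σ
      rw [Matrix.conjTranspose_conjTranspose] at h
      have := ih (hσ.conjTranspose_mul_mul_same (onQubits e O.sparseGate))
      rwa [h] at this
  | copy e P ih =>
    have := ih (reload_posSemidef e hρ.1 hσ)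
    rwa [trace_reload, hρ.2, one_mul] at this
  | measure q P ih =>
    have h : ∀ c, (proj q c * σ * proj q c).PosSemidef := fun c => by
      simpa [proj_conjTranspose] using hσ.mul_mul_conjTranspose_same (proj q c)
    obtain ⟨h1, h2, h3⟩ := ih false (h false)
    obtain ⟨h4, h5, h6⟩ := ih true (h true)
    refine ⟨h1.add h4, ?_, ?_⟩
    · simp only [noHalt, run, Matrix.trace_add, h2, h5, trace_proj_add]
    · simp only [noHalt, run]
      rw [add_sub_add_comm]
      exact h3.add h6

lemma addZeros_posSemidef {W : Type} [Fintype W] [DecidableEq W] {σ : Op K}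
    (hσ : σ.PosSemidef) : (addZeros (W := W) σ).PosSemidef := by
  let J : Matrix (K ⊕ W → Bool) (K → Bool) ℂ :=
    Matrix.of fun X x => if X = Sum.elim x fun _ => false then 1 else 0
  have h : addZeros (W := W) σ = J * σ * J.conjTranspose := by
    ext X Y
    have h1 : ∀ (X : K ⊕ W → Bool) (x : K → Bool), (X = Sum.elim x fun _ => false) ↔
        x = X ∘ Sum.inl ∧ ∀ q, X (Sum.inr q) = false := by
      intro X x
      constructor
      · rintro rfl; exact ⟨rfl, fun _ => rfl⟩
      · rintro ⟨rfl, h⟩; funext q; rcases q with q | q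
        · rfl
        · exact h q
    by_cases hX : ∀ q, X (Sum.inr q) = false <;> by_cases hY : ∀ q, Y (Sum.inr q) = false <;>
      simp [J, Matrix.mul_apply, addZeros, h1, hX, hY, apply_ite]
  rw [h]
  exact hσ.mul_mul_conjTranspose_same J

lemma trace_traceOut {W : Type} [Fintype W] [DecidableEq W] (σ : Op (K ⊕ W)) :
    (traceOut σ).trace = σ.trace := by
  simp only [Matrix.trace, Matrix.diag, traceOut, Matrix.of_apply]
  rw [← sum_sum_arrow (W₁ := K) (W₂ := W) fun z => σ z z]

lemma traceOut_posSemidef {W : Type} [Fintype W] [DecidableEq W] {σ : Op (K ⊕ W)}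
    (hσ : σ.PosSemidef) : (traceOut σ).PosSemidef := by
  have h : traceOut σ = ∑ z : W → Bool, σ.submatrix (fun x => Sum.elim x z)
      (fun x => Sum.elim x z) := by
    ext x y
    simp [traceOut, Matrix.sum_apply]
  rw [h]
  exact Matrix.posSemidef_sum _ fun z _ => hσ.submatrix _

lemma traceOut_sub {W : Type} [Fintype W] [DecidableEq W] (σ τ : Op (K ⊕ W)) :
    traceOut (σ - τ) = traceOut σ - traceOut τ := by
  ext x y
  simp [traceOut]

theorem Circuit.channel_noHalt (C : Circuit n p b K) (O : Oracles n p b) {ρ : Op (Fin n)}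
    (hρ : IsDensity ρ) {σ : Op K} (hσ : σ.PosSemidef) :
    (C.noHalt.channel O ρ σ).PosSemidef ∧ (C.noHalt.channel O ρ σ).trace = σ.trace ∧
      (C.noHalt.channel O ρ σ - C.channel O ρ σ).PosSemidef := by
  obtain ⟨h1, h2, h3⟩ := C.prog.run_noHalt O hρ (addZeros_posSemidef (W := Fin C.w) hσ)
  refine ⟨traceOut_posSemidef h1, ?_, ?_⟩
  · change (traceOut _).trace = _
    rw [trace_traceOut]
    refine h2.trans ?_
    rw [← trace_traceOut, traceOut_addZeros]
  · have := traceOut_posSemidef h3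
    rwa [traceOut_sub] at this

/-- A circuit that never reports a failure simulates almost as well. -/
theorem Circuit.Simulates.noHalt {C : Circuit n p b (Option (Fin n))} {O : Oracles n p b}
    {ρ D : Op (Fin n)} {τ ε : ℝ} (h : C.Simulates O ρ D τ ε) (hρ : IsDensity ρ)
    (hU : controlledEvolution D τ ∈ Matrix.unitaryGroup (Option (Fin n) → Bool) ℂ)
    {σ : Op (Option (Fin n))} (hσ : IsDensity σ) :
    traceNorm (C.noHalt.channel O ρ σ -
      controlledEvolution D τ * σ * (controlledEvolution D τ).conjTranspose) ≤ 4 * ε := by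
  obtain ⟨h1, h2, h3⟩ := C.channel_noHalt O hρ hσ.1
  set Φ := C.channel O ρ σ
  set Φ' := C.noHalt.channel O ρ σ
  set Ψ := controlledEvolution D τ * σ * (controlledEvolution D τ).conjTranspose with hΨ
  -- The diamond norm bound is only used with a one-dimensional reference system; the factor 2
  -- undoes the 1/2 in `traceDist`.
  have h4 : traceNorm (Φ - Ψ) ≤ 2 * ε := by
    let e : (Option (Fin n) → Bool) × Fin 1 ≃ (Option (Fin n) → Bool) := Equiv.prodUnique _ _
    have h5 := h 1 (σ.submatrix e e) ⟨hσ.1.submatrix _, by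
      rw [← hσ.2, Matrix.trace, Matrix.trace, ← Equiv.sum_comp e]; rfl⟩
    have h6 : traceNorm ((Φ - Ψ).submatrix e e) / 2 ≤ ε := h5
    have h7 := traceNorm_submatrix_le e.symm ((Φ - Ψ).submatrix e e)
    rw [Matrix.submatrix_submatrix, e.self_comp_symm, Matrix.submatrix_id_id] at h7
    linarith
  -- The difference is positive, so its trace norm is the lost probability. The ideal evolution
  -- loses none, hence the loss is at most the distance of `Φ` from it.
  have h8 : traceNorm (Φ' - Φ) ≤ 2 * ε := by
    have h9 : ((Φ' - Φ).trace).re ≤ traceNorm (Φ - Ψ) := by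
      have h10 : (Φ' - Φ).trace = (Ψ - Φ).trace := by
        rw [Matrix.trace_sub, Matrix.trace_sub, h2, hΨ, trace_conj hU]
      rw [h10, traceNorm_sub_comm]
      exact (Complex.re_le_norm _).trans (norm_trace_le _)
    linarith [traceNorm_le_trace h3]
  linarith [traceNorm_sub_le Φ' Φ Ψ]

end Positivity

/-! ### Registers with a control qubit -/

section Control

variable {K : Type} [Fintype K] [DecidableEq K]

/-- The block of an operator between two values of the qubit `none`. -/
def bl (M : Op (Option K)) (c d : Bool) : Op K :=
  M.submatrix (Circuit.consBit c) (Circuit.consBit d)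

lemma bl_sub (M N : Op (Option K)) (c d : Bool) : bl (M - N) c d = bl M c d - bl N c d := rfl

lemma bl_smul (a : ℂ) (M : Op (Option K)) (c d : Bool) : bl (a • M) c d = a • bl M c d := rfl

lemma bl_conjTranspose (M : Op (Option K)) (c d : Bool) :
    bl M.conjTranspose c d = (bl M d c).conjTranspose := rfl

/-- Bit strings on `Option K` as bit strings on `K` and a bit. -/
def bitsOption : (Option K → Bool) ≃ (K → Bool) × Bool where
  toFun X := (X ∘ some, X none)
  invFun z := Circuit.consBit z.2 z.1
  left_inv X := by funext q; cases q <;> rfl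
  right_inv z := rfl

lemma sum_bits {M : Type*} [AddCommMonoid M] (F : (Option K → Bool) → M) :
    ∑ X, F X = ∑ c, ∑ x, F (Circuit.consBit c x) := by
  rw [Finset.sum_comm, ← Fintype.sum_prod_type']
  exact (Equiv.sum_comp bitsOption.symm F).symm

lemma bl_mul (M N : Op (Option K)) (c d : Bool) :
    bl (M * N) c d = bl M c false * bl N false d + bl M c true * bl N true d := by
  ext x y
  simp only [bl, Matrix.submatrix_apply, Matrix.mul_apply, Matrix.add_apply, sum_bits,
    Fintype.sum_bool]
  rw [add_comm]

lemma consBit_injective (c : Bool) : Function.Injective (Circuit.consBit (K := K) c) :=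
  fun _ _ h => funext fun q => congrFun h (some q)

lemma traceNorm_bl_le (M : Op (Option K)) (c : Bool) : traceNorm (bl M c c) ≤ traceNorm M := by
  let J : Matrix (Option K → Bool) (K → Bool) ℂ :=
    (1 : Op (Option K)).submatrix id (Circuit.consBit c)
  have hJ : J.conjTranspose * J = 1 := by
    ext x y
    simp [J, Matrix.mul_apply, Matrix.one_apply, (consBit_injective c).eq_iff]
  have h : bl M c c = J.conjTranspose * M * J := by
    ext x y
    simp [J, Matrix.mul_apply, Matrix.one_apply, bl]
  rw [h]
  refine (traceNorm_mul_mul_le _ _ _).trans ?_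
  rw [norm_conjTranspose]
  have := norm_le_one_of_conjTranspose_mul_self hJ
  exact mul_le_of_le_one_left (traceNorm_nonneg _) (by nlinarith [norm_nonneg J])

lemma trace_eq_bl (M : Op (Option K)) : M.trace = (bl M false false).trace + (bl M true true).trace := by
  simp only [Matrix.trace, Matrix.diag, sum_bits, Fintype.sum_bool, bl, Matrix.submatrix_apply]
  rw [add_comm]

lemma bl_posSemidef {M : Op (Option K)} (hM : M.PosSemidef) (c : Bool) :
    (bl M c c).PosSemidef := hM.submatrix _

lemma bl_addQubit (σ : Op K) (c d : Bool) :
    bl (Circuit.addQubit σ) c d = if c = false ∧ d = false then σ else 0 := by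
  ext x y
  simp only [bl, Circuit.addQubit, Matrix.submatrix_apply, Matrix.of_apply, Circuit.consBit,
    Option.elim_none]
  by_cases h : c = false ∧ d = false
  · rw [if_pos h]; exact if_pos h
  · rw [if_neg h]; exact if_neg h

lemma isDensity_addQubit {ρ : Op K} (hρ : IsDensity ρ) : IsDensity (Circuit.addQubit ρ) := by
  constructor
  · have h : Circuit.addQubit ρ = (Matrix.of fun (X : Option K → Bool) (x : K → Bool) =>
        if X none = false ∧ X ∘ some = x then (1 : ℂ) else 0) * ρ *
        (Matrix.of fun (X : Option K → Bool) (x : K → Bool) =>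
        if X none = false ∧ X ∘ some = x then (1 : ℂ) else 0).conjTranspose := by
      ext X Y
      cases hX : X none <;> cases hY : Y none <;>
        simp [Circuit.addQubit, Matrix.mul_apply, hX, hY, apply_ite]
    rw [h]
    exact hρ.1.mul_mul_conjTranspose_same _
  · rw [trace_eq_bl]
    simp [bl_addQubit, hρ.2]

lemma bl_proj (e c d : Bool) :
    bl (K := K) (proj none e) c d = if c = e ∧ d = e then 1 else 0 := by
  classical
  ext x y
  simp only [bl, proj, Matrix.submatrix_apply, Matrix.diagonal_apply]
  by_cases hxy : x = y
  · subst hxy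
    cases c <;> cases d <;> cases e <;> simp [Circuit.consBit, funext_iff, Option.forall]
  · have : Circuit.consBit c x ≠ Circuit.consBit d y := fun h =>
      hxy (funext fun q => congrFun h (some q))
    rw [if_neg this]
    split_ifs <;> simp [hxy]

lemma bitsOption_apply (X : Option K → Bool) : bitsOption X = (X ∘ some, X none) := rfl

/-- The qubit `none`. -/
def ctrl : Fin 1 ↪ Option K := ⟨fun _ => none, fun _ _ _ => Subsingleton.elim _ _⟩

/-- A one-qubit operator. -/
def op₁ (M : Matrix Bool Bool ℂ) : Op (Fin 1) := M.submatrix (fun x => x 0) fun x => x 0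

lemma bl_onQubits_ctrl (M : Matrix Bool Bool ℂ) (c d : Bool) :
    bl (K := K) (onQubits ctrl (op₁ M)) c d = M c d • (1 : Op K) := by
  classical
  ext x y
  have h : (∀ q ∉ Set.range (ctrl (K := K)), Circuit.consBit c x q = Circuit.consBit d y q) ↔
      x = y := by
    constructor
    · intro h
      funext q
      exact h (some q) (by rintro ⟨_, h⟩; exact Option.some_ne_none _ h.symm)
    · rintro rfl q hq
      cases q with
      | none => exact (hq ⟨0, rfl⟩).elim
      | some q => rfl
  simp only [bl, onQubits, Matrix.submatrix_apply, Matrix.of_apply, h, Matrix.smul_apply,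
    Matrix.one_apply, smul_eq_mul]
  split_ifs
  · simp only [mul_one]; rfl
  · simp

lemma op₁_mem {M : Matrix Bool Bool ℂ} (hM : M * M.conjTranspose = 1) :
    op₁ M ∈ Matrix.unitaryGroup (Fin 1 → Bool) ℂ := by
  rw [Matrix.mem_unitaryGroup_iff, Matrix.star_eq_conjTranspose, op₁,
    Matrix.conjTranspose_submatrix]
  let e : (Fin 1 → Bool) ≃ Bool := Equiv.funUnique (Fin 1) Bool
  change M.submatrix e e * M.conjTranspose.submatrix e e = 1
  rw [Matrix.submatrix_mul_equiv, hM, Matrix.submatrix_one_equiv]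

/-- A Hadamard gate, followed by the phases `ph`. -/
def hadamardMat (ph : Bool → ℂ) : Matrix Bool Bool ℂ :=
  Matrix.of fun c d => ph c * (((√2)⁻¹ : ℝ) : ℂ) * (if c = true ∧ d = true then -1 else 1)

lemma sqrt_two_inv_sq : (((√2)⁻¹ : ℝ) : ℂ) * (((√2)⁻¹ : ℝ) : ℂ) = 1 / 2 := by
  rw [← Complex.ofReal_mul, ← mul_inv, Real.mul_self_sqrt (by norm_num)]
  norm_num

lemma hadamardMat_mul {ph : Bool → ℂ} (h : ∀ c, ‖ph c‖ = 1) :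
    hadamardMat ph * (hadamardMat ph).conjTranspose = 1 := by
  have h1 : ∀ c, ph c * (starRingEnd ℂ) (ph c) = 1 := fun c => by
    rw [Complex.mul_conj', h]; simp
  ext c d
  simp only [Matrix.mul_apply, hadamardMat, Matrix.conjTranspose_apply, Matrix.of_apply,
    Fintype.sum_bool, star_mul', RCLike.star_def, Complex.conj_ofReal]
  have h2 := sqrt_two_inv_sq
  set r : ℂ := (((√2)⁻¹ : ℝ) : ℂ)
  cases c <;> cases d
  · simp only [Bool.false_eq_true, false_and, and_true, if_false, Matrix.one_apply_eq, map_one]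
    linear_combination 2 * r * r * h1 false + 2 * h2
  · simp
  · simp
  · simp only [Bool.false_eq_true, and_false, and_true, if_false, if_true, Matrix.one_apply_eq,
      map_one, map_neg]
    linear_combination 2 * r * r * h1 true + 2 * h2

/-- The Pauli matrix `X`. -/
def flipMat : Matrix Bool Bool ℂ := Matrix.of fun c d => if c = d then 0 else 1

lemma flipMat_mul : flipMat * flipMat.conjTranspose = 1 := by
  ext c d
  cases c <;> cases d <;> simp [Matrix.mul_apply, flipMat]

lemma controlled_eq {n : ℕ} (D : Op (Fin n)) : controlled D =
    Matrix.reindexAlgEquiv ℂ ℂ bitsOption.symm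
      (Matrix.blockDiagonal fun c : Bool => if c then D else 0) := by
  ext X Y
  simp only [controlled, Matrix.of_apply, Matrix.coe_reindexAlgEquiv, Matrix.reindex_apply,
    Matrix.submatrix_apply, Equiv.symm_symm, bitsOption_apply,
    Matrix.blockDiagonal_apply]
  cases X none <;> cases Y none <;> simp

/-- The generator is block diagonal in the control qubit and the exponential respects block
diagonals and reindexing. This gives the identity on control 0 and exp(-iDτ) on control 1. -/
lemma controlledEvolution_eq {n : ℕ} (D : Op (Fin n)) (τ : ℝ) : controlledEvolution D τ =
    Matrix.reindexAlgEquiv ℂ ℂ bitsOption.symm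
      (Matrix.blockDiagonal fun c : Bool =>
        NormedSpace.exp (if c then (-Complex.I * (τ : ℂ)) • D else 0)) := by
  have h1 : (-Complex.I * (τ : ℂ)) • controlled D =
    Matrix.reindexAlgEquiv ℂ ℂ bitsOption.symm
      (Matrix.blockDiagonal fun c : Bool => if c then (-Complex.I * (τ : ℂ)) • D else 0) := by
    rw [controlled_eq, ← map_smul, ← Matrix.blockDiagonal_smul]
    congr 2
    funext c
    cases c <;> simp
  have h2 : Continuous (Matrix.reindexAlgEquiv ℂ ℂ (bitsOption (K := Fin n)).symm) :=
    LinearMap.continuous_of_finiteDimensional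
      (Matrix.reindexAlgEquiv ℂ ℂ (bitsOption (K := Fin n)).symm).toLinearMap
  rw [controlledEvolution, h1]
  let _ : NormedAlgebra ℚ (Matrix ((Fin n → Bool) × Bool) ((Fin n → Bool) × Bool) ℂ) :=
    NormedAlgebra.restrictScalars ℚ ℂ _
  have := NormedSpace.map_exp (Matrix.reindexAlgEquiv ℂ ℂ (bitsOption (K := Fin n)).symm) h2
    (Matrix.blockDiagonal fun c : Bool => if c then (-Complex.I * (τ : ℂ)) • D else 0)
  let _ : NormedAlgebra ℚ (Op (Fin n)) := NormedAlgebra.restrictScalars ℚ ℂ _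
  rw [← this, Matrix.exp_blockDiagonal, Pi.exp_def]

lemma bl_controlledEvolution {n : ℕ} (D : Op (Fin n)) (τ : ℝ) (c d : Bool) :
    bl (controlledEvolution D τ) c d = if c = d then
      (if c then NormedSpace.exp ((-Complex.I * (τ : ℂ)) • D) else 1) else 0 := by
  rw [controlledEvolution_eq]
  ext x y
  simp only [bl, Matrix.coe_reindexAlgEquiv, Matrix.reindex_apply,
    Matrix.submatrix_apply, Equiv.symm_symm, bitsOption_apply,
    Matrix.blockDiagonal_apply]
  cases c <;> cases d <;> simp [Circuit.consBit, Function.comp_def]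

lemma controlledEvolution_mem {n : ℕ} {D : Op (Fin n)} (hD : D.IsHermitian) (τ : ℝ) :
    controlledEvolution D τ ∈ Matrix.unitaryGroup (Option (Fin n) → Bool) ℂ := by
  rw [Matrix.mem_unitaryGroup_iff', Matrix.star_eq_conjTranspose, controlledEvolution,
    ← Matrix.exp_conjTranspose]
  have h : ((-Complex.I * (τ : ℂ)) • controlled D).conjTranspose =
      -((-Complex.I * (τ : ℂ)) • controlled D) := by
    have h1 : (controlled D).conjTranspose = controlled D := by
      ext X Y
      simp only [controlled, Matrix.conjTranspose_apply, Matrix.of_apply, apply_ite star,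
        star_zero]
      rw [hD.apply]
      simp only [and_comm]
    rw [Matrix.conjTranspose_smul, h1, ← neg_smul]
    congr 1
    simp
  set Y := (-Complex.I * (τ : ℂ)) • controlled D
  have hY : Commute (-Y) Y := (Commute.refl Y).neg_left
  rw [h, ← Matrix.exp_add_of_commute _ _ hY, neg_add_cancel, NormedSpace.exp_zero]

end Control

/-! ### One attempt of a descent step -/

section Attempt

variable {n p b : ℕ}

lemma Circuit.channel_smul {K : Type} [Fintype K] [DecidableEq K] (C : Circuit n p b K)
    (O : Oracles n p b) (ρ : Op (Fin n)) (c : ℂ) (σ : Op K) :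
    C.channel O ρ (c • σ) = c • C.channel O ρ σ := by
  have h1 : addZeros (W := Fin C.w) (c • σ) = c • addZeros σ := by
    ext x y
    simp only [addZeros, Matrix.of_apply, Matrix.smul_apply]
    split_ifs <;> simp
  ext x y
  simp only [channel, h1, Prog.run_smul]
  simp [traceOut, Finset.mul_sum]

/-- The system qubits, next to the control qubit. -/
def sysEmb : Fin n ↪ Option (Fin n) := Function.Embedding.some

lemma extend_sysEmb (x : Fin n → Bool) (z : Option (Fin n) → Bool) :
    Function.extend sysEmb x z = Circuit.consBit (z none) x := by
  rw [eq_comm, extend_eq_iff]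
  refine ⟨rfl, fun q hq => ?_⟩
  cases q with
  | none => rfl
  | some q => exact (hq ⟨q, rfl⟩).elim

lemma reload_addQubit (ρ σ : Op (Fin n)) :
    reload sysEmb ρ (Circuit.addQubit σ) = σ.trace • Circuit.addQubit ρ := by
  ext x y
  have h1 : ∀ z, Circuit.addQubit σ (Circuit.consBit (x none) z) (Circuit.consBit (y none) z) =
      if x none = false ∧ y none = false then σ z z else 0 := fun z => rfl
  simp only [reload, Matrix.of_apply, extend_sysEmb, Matrix.smul_apply, smul_eq_mul, h1]
  by_cases h : x none = false ∧ y none = false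
  · have h2 : Circuit.addQubit ρ x y = ρ (x ∘ sysEmb) (y ∘ sysEmb) := if_pos h
    simp only [if_pos h, h2]
    exact mul_comm _ _
  · have h2 : Circuit.addQubit ρ x y = 0 := if_neg h
    simp only [if_neg h, h2]
    simp

/-- The gate `op₁ M` on the control qubit. -/
def ctrlGate (M : Matrix Bool Bool ℂ) (hM : M * M.conjTranspose = 1)
    (P : Prog n p b (Option (Fin n))) : Prog n p b (Option (Fin n)) :=
  .gate 1 one_le_two ctrl ⟨op₁ M, op₁_mem hM⟩ P

/-- Prepare a copy of the given state and the control qubit, evolve with `S₁` and `S₂` under the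
two values of the control qubit, and measure it.  If the outcome is `1`, continue with `Y`. -/
def attempt (ph : Bool → ℂ) (hph : ∀ c, ‖ph c‖ = 1) (S₁ S₂ : Circuit n p b (Option (Fin n)))
    (Y : Circuit n p b (Fin n)) : Circuit n p b (Fin n) :=
  .hide <| .prepend (.copy sysEmb (ctrlGate (hadamardMat ph) (hadamardMat_mul hph) .done)) <|
    .seq S₁.noHalt <| .prepend (ctrlGate flipMat flipMat_mul .done) <| .seq S₂.noHalt <|
      .prepend (ctrlGate (hadamardMat fun _ => 1) (hadamardMat_mul (by simp)) .done) <|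
        .retry none sysEmb Y

lemma copies_attempt (ph : Bool → ℂ) (hph : ∀ c, ‖ph c‖ = 1)
    (S₁ S₂ : Circuit n p b (Option (Fin n))) (Y : Circuit n p b (Fin n)) :
    (attempt ph hph S₁ S₂ Y).prog.copies ≤
      1 + S₁.prog.copies + S₂.prog.copies + Y.prog.copies := by
  rw [attempt, Circuit.copies_hide]
  refine (Circuit.copies_prepend _ _).trans ?_
  have h1 := Circuit.copies_seq S₁.noHalt (.prepend (ctrlGate flipMat flipMat_mul .done) <|
    .seq S₂.noHalt <|
      .prepend (ctrlGate (hadamardMat fun _ => 1) (hadamardMat_mul (by simp)) .done) <|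
        .retry none sysEmb Y)
  have h2 := Circuit.copies_prepend (ctrlGate flipMat flipMat_mul .done) (.seq S₂.noHalt <|
      .prepend (ctrlGate (hadamardMat fun _ => 1) (hadamardMat_mul (by simp)) .done) <|
        .retry none sysEmb Y)
  have h3 := Circuit.copies_seq S₂.noHalt (
      .prepend (ctrlGate (hadamardMat fun _ => 1) (hadamardMat_mul (by simp)) .done) <|
        .retry none sysEmb Y)
  have h4 := Circuit.copies_prepend
    (ctrlGate (hadamardMat fun _ => 1) (hadamardMat_mul (by simp)) .done)
    (.retry none sysEmb Y)
  rw [Circuit.copies_retry] at h4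
  simp only [ctrlGate, Prog.copies, Circuit.noHalt, Prog.copies_noHalt] at h1 h2 h3 h4 ⊢
  omega

lemma gates_attempt (ph : Bool → ℂ) (hph : ∀ c, ‖ph c‖ = 1)
    (S₁ S₂ : Circuit n p b (Option (Fin n))) (Y : Circuit n p b (Fin n)) :
    (attempt ph hph S₁ S₂ Y).prog.gates ≤
      4 + S₁.prog.gates + S₂.prog.gates + Y.prog.gates := by
  rw [attempt, Circuit.gates_hide]
  refine (Circuit.gates_prepend _ _).trans ?_
  have h1 := Circuit.gates_seq S₁.noHalt (.prepend (ctrlGate flipMat flipMat_mul .done) <|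
    .seq S₂.noHalt <|
      .prepend (ctrlGate (hadamardMat fun _ => 1) (hadamardMat_mul (by simp)) .done) <|
        .retry none sysEmb Y)
  have h2 := Circuit.gates_prepend (ctrlGate flipMat flipMat_mul .done) (.seq S₂.noHalt <|
      .prepend (ctrlGate (hadamardMat fun _ => 1) (hadamardMat_mul (by simp)) .done) <|
        .retry none sysEmb Y)
  have h3 := Circuit.gates_seq S₂.noHalt (
      .prepend (ctrlGate (hadamardMat fun _ => 1) (hadamardMat_mul (by simp)) .done) <|
        .retry none sysEmb Y)
  have h4 := Circuit.gates_prepend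
    (ctrlGate (hadamardMat fun _ => 1) (hadamardMat_mul (by simp)) .done)
    (.retry none sysEmb Y)
  rw [Circuit.gates_retry] at h4
  simp only [ctrlGate, Prog.gates, Circuit.noHalt, Prog.gates_noHalt] at h1 h2 h3 h4 ⊢
  omega

/-- The unitary of a gate on the control qubit. -/
def ctrlOp (M : Matrix Bool Bool ℂ) : Op (Option (Fin n)) := onQubits ctrl (op₁ M)

lemma ctrlOp_mem {M : Matrix Bool Bool ℂ} (hM : M * M.conjTranspose = 1) :
    ctrlOp (n := n) M ∈ Matrix.unitaryGroup (Option (Fin n) → Bool) ℂ :=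
  onQubits_mem_unitaryGroup _ (op₁_mem hM)

/-- The state of system and control qubit before the measurement. -/
def attemptState (ph : Bool → ℂ) (S₁ S₂ : Circuit n p b (Option (Fin n)))
    (O : Oracles n p b) (ρ : Op (Fin n)) : Op (Option (Fin n)) :=
  ctrlOp (hadamardMat fun _ => 1) * S₂.noHalt.channel O ρ (ctrlOp flipMat *
    S₁.noHalt.channel O ρ (ctrlOp (hadamardMat ph) * Circuit.addQubit ρ *
      (ctrlOp (hadamardMat ph)).conjTranspose) * (ctrlOp flipMat).conjTranspose) *
    (ctrlOp (hadamardMat fun _ => 1)).conjTranspose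

/-- Loading the fresh copy erases the input up to its trace. Outcome 0 keeps the block of the
measured state; after outcome 1 the circuit `Y` overwrites the system by `ω`, so only the
probability of that outcome matters. -/
lemma attempt_replaces (ph : Bool → ℂ) (hph : ∀ c, ‖ph c‖ = 1)
    (S₁ S₂ : Circuit n p b (Option (Fin n))) {Y : Circuit n p b (Fin n)} {O : Oracles n p b}
    {ρ ω : Op (Fin n)} (hY : Y.Replaces O ρ ω) :
    (attempt ph hph S₁ S₂ Y).Replaces O ρ (bl (attemptState ph S₁ S₂ O ρ) false false +
      (bl (attemptState ph S₁ S₂ O ρ) true true).trace • ω) := by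
  intro σ
  have hb : ∀ (c d : Bool) (τ : Op (Option (Fin n))), bl (proj none c * τ * proj none c) d d =
      if d = c then bl τ d d else 0 := by
    intro c d τ
    simp only [bl_mul, bl_proj]
    cases c <;> cases d <;> simp
  have hτ : (ctrlOp (hadamardMat fun _ => 1) * S₂.noHalt.channel O ρ (ctrlOp flipMat *
    S₁.noHalt.channel O ρ (ctrlOp (hadamardMat ph) * (σ.trace • Circuit.addQubit ρ) *
      (ctrlOp (hadamardMat ph)).conjTranspose) * (ctrlOp flipMat).conjTranspose) *
    (ctrlOp (hadamardMat fun _ => 1)).conjTranspose) =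
      σ.trace • attemptState ph S₁ S₂ O ρ := by
    simp only [attemptState, Matrix.mul_smul, Matrix.smul_mul, Circuit.channel_smul]
  ext x y
  rw [attempt, Circuit.channel_hide]
  simp only [Circuit.channel_prepend, Circuit.channel_seq, ctrlGate, Prog.run, reload_addQubit]
  change ∑ c, (Circuit.retry none sysEmb Y).channel O ρ
    (ctrlOp (hadamardMat fun _ => 1) * S₂.noHalt.channel O ρ (ctrlOp flipMat *
    S₁.noHalt.channel O ρ (ctrlOp (hadamardMat ph) * (σ.trace • Circuit.addQubit ρ) *
      (ctrlOp (hadamardMat ph)).conjTranspose) * (ctrlOp flipMat).conjTranspose) *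
    (ctrlOp (hadamardMat fun _ => 1)).conjTranspose) (Circuit.consBit c x)
      (Circuit.consBit c y) = _
  rw [hτ]
  set τ := attemptState ph S₁ S₂ O ρ
  simp only [Circuit.channel_retry]
  have h1 : ∀ c, blk sysEmb (Circuit.consBit c x) (Circuit.consBit c y)
      (proj none true * (σ.trace • τ) * proj none true) =
        bl (proj none true * (σ.trace • τ) * proj none true) c c := by
    intro c
    ext x' y'
    simp [blk, bl, extend_sysEmb, Circuit.consBit]
  have h2 : ∀ c, ((proj none false * (σ.trace • τ) * proj none false : Op (Option (Fin n)))) (Circuit.consBit c x)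
      (Circuit.consBit c y) = bl (proj none false * (σ.trace • τ) * proj none false) c c x y :=
    fun c => rfl
  simp only [h1, h2, hb, hY _]
  have h3 : ∀ (c : Bool) (x : Fin n → Bool), Circuit.consBit c x ∘ sysEmb = x := fun c x => rfl
  simp only [h3, Fintype.sum_bool, bl_smul, Bool.false_eq_true, Bool.true_eq_false, if_true,
    if_false, Matrix.trace_smul, Matrix.trace_zero, Matrix.zero_apply,
    zero_add, Matrix.add_apply, Matrix.smul_apply, smul_eq_mul]
  ring

/-- The operator on the system that a successful attempt applies. -/
def successOp (D : Op (Fin n)) (τ : ℝ) (u : ℂ) : Op (Fin n) :=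
  (u / 2) • NormedSpace.exp ((Complex.I * (τ : ℂ)) • D) +
    ((starRingEnd ℂ) u / 2) • NormedSpace.exp (-((Complex.I * (τ : ℂ)) • D))

/-- The phases `u` and `u*` of the control qubit. -/
def phases (u : ℂ) (c : Bool) : ℂ := if c then (starRingEnd ℂ) u else u

/-- The component u* on control 1 acquires exp(-iDτ). The flip exchanges the components, so the one
with u acquires exp(iDτ) from the evolution for time -τ. The last Hadamard gate adds them in the
block of outcome 0. -/
lemma bl_success (D : Op (Fin n)) (τ : ℝ) (u : ℂ) :
    bl (ctrlOp (hadamardMat fun _ => 1) * controlledEvolution D (-τ) * ctrlOp flipMat *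
      controlledEvolution D τ * ctrlOp (hadamardMat (phases u))) false false =
      successOp D τ u := by
  have h : (-Complex.I * ((-τ : ℝ) : ℂ)) • D = (Complex.I * (τ : ℂ)) • D := by
    congr 1; push_cast; ring
  have h' : (-Complex.I * (τ : ℂ)) • D = -((Complex.I * (τ : ℂ)) • D) := by
    rw [← neg_smul]; congr 1; ring
  have h2 := sqrt_two_inv_sq
  simp only [bl_mul, ctrlOp, bl_onQubits_ctrl, bl_controlledEvolution, h, h']
  set E := NormedSpace.exp ((Complex.I * (τ : ℂ)) • D)
  set E' := NormedSpace.exp (-((Complex.I * (τ : ℂ)) • D))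
  simp only [hadamardMat, flipMat, phases, Matrix.of_apply, successOp]
  set r : ℂ := (((√2)⁻¹ : ℝ) : ℂ)
  have h3 : u / 2 = r * (u * r) := by linear_combination -u * h2
  have h4 : (starRingEnd ℂ) u / 2 = r * ((starRingEnd ℂ) u * r) := by
    linear_combination -((starRingEnd ℂ) u) * h2
  rw [h3, h4]
  simp [smul_smul, mul_comm, mul_left_comm, E, E']

/-- Each simulation without halting costs 4ε in trace norm. Unitary conjugation and the compression
to outcome 0 do not increase the trace norm, so the two errors add. -/
theorem attemptState_spec {S₁ S₂ : Circuit n p b (Option (Fin n))} {O : Oracles n p b}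
    {ρ D : Op (Fin n)} {τ ε : ℝ} {u : ℂ} (hu : ‖u‖ = 1) (hρ : IsDensity ρ) (hD : D.IsHermitian)
    (h₁ : S₁.Simulates O ρ D τ ε) (h₂ : S₂.Simulates O ρ D (-τ) ε) :
    (attemptState (phases u) S₁ S₂ O ρ).PosSemidef ∧
      (attemptState (phases u) S₁ S₂ O ρ).trace = 1 ∧
      traceNorm (bl (attemptState (phases u) S₁ S₂ O ρ) false false -
        successOp D τ u * ρ * (successOp D τ u).conjTranspose) ≤ 8 * ε := by
  have hph : ∀ c, ‖phases u c‖ = 1 := by intro c; cases c <;> simp [phases, hu]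
  set G₀ := ctrlOp (n := n) (hadamardMat (phases u))
  set G₁ := ctrlOp (n := n) flipMat
  set G₂ := ctrlOp (n := n) (hadamardMat fun _ => 1)
  have hG₀ : G₀ ∈ Matrix.unitaryGroup _ ℂ := ctrlOp_mem (hadamardMat_mul hph)
  have hG₁ : G₁ ∈ Matrix.unitaryGroup _ ℂ := ctrlOp_mem flipMat_mul
  have hG₂ : G₂ ∈ Matrix.unitaryGroup _ ℂ := ctrlOp_mem (hadamardMat_mul (by simp))
  have hdens : ∀ {U : Op (Option (Fin n))}, U ∈ Matrix.unitaryGroup _ ℂ → ∀ {σ}, IsDensity σ →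
      IsDensity (U * σ * U.conjTranspose) := fun hU σ hσ =>
    ⟨hσ.1.mul_mul_conjTranspose_same _, (trace_conj hU σ).trans hσ.2⟩
  have hnoHalt : ∀ (C : Circuit n p b (Option (Fin n))) {σ}, IsDensity σ →
      IsDensity (C.noHalt.channel O ρ σ) := fun C σ hσ =>
    ⟨(C.channel_noHalt O hρ hσ.1).1, ((C.channel_noHalt O hρ hσ.1).2.1).trans hσ.2⟩
  have hnorm : ∀ {U : Op (Option (Fin n))}, U ∈ Matrix.unitaryGroup _ ℂ → ∀ σ τ,
      traceNorm (U * σ * U.conjTranspose - U * τ * U.conjTranspose) ≤ traceNorm (σ - τ) := by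
    intro U hU σ τ
    rw [← Matrix.sub_mul, ← Matrix.mul_sub]
    refine (traceNorm_mul_mul_le _ _ _).trans ?_
    rw [norm_conjTranspose]
    have : ‖U‖ ≤ 1 := norm_le_one_of_conjTranspose_mul_self
      (by rw [← Matrix.star_eq_conjTranspose]; exact Matrix.mem_unitaryGroup_iff'.1 hU)
    exact mul_le_of_le_one_left (traceNorm_nonneg _) (by nlinarith [norm_nonneg U])
  have hU₁ := controlledEvolution_mem hD τ
  have hU₂ := controlledEvolution_mem hD (-τ)
  set U₁ := controlledEvolution D τ with hU₁_def
  set U₂ := controlledEvolution D (-τ) with hU₂_def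
  have d0 := hdens hG₀ (isDensity_addQubit hρ)
  set σ₀ := G₀ * Circuit.addQubit ρ * G₀.conjTranspose
  have e1 := h₁.noHalt hρ hU₁ d0
  have d1 := hdens hG₁ (hnoHalt S₁ d0)
  set σ₁ := G₁ * S₁.noHalt.channel O ρ σ₀ * G₁.conjTranspose
  have e2 := h₂.noHalt hρ hU₂ d1
  have d2 := hdens hG₂ (hnoHalt S₂ d1)
  have hstate : attemptState (phases u) S₁ S₂ O ρ =
    G₂ * S₂.noHalt.channel O ρ σ₁ * G₂.conjTranspose := rfl
  rw [hstate]
  refine ⟨d2.1, d2.2, ?_⟩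
  have f1 : traceNorm (σ₁ - G₁ * (U₁ * σ₀ * U₁.conjTranspose) * G₁.conjTranspose) ≤ 4 * ε :=
    (hnorm hG₁ _ _).trans e1
  have f2 : traceNorm (S₂.noHalt.channel O ρ σ₁ - U₂ * (G₁ * (U₁ * σ₀ * U₁.conjTranspose) *
      G₁.conjTranspose) * U₂.conjTranspose) ≤ 8 * ε := by
    refine (traceNorm_sub_le _ (U₂ * σ₁ * U₂.conjTranspose) _).trans ?_
    linarith [(hnorm hU₂ _ _).trans f1]
  have f3 := (hnorm hG₂ _ _).trans f2
  set W := G₂ * U₂ * G₁ * U₁ * G₀ with hW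
  have f4 : G₂ * (U₂ * (G₁ * (U₁ * σ₀ * U₁.conjTranspose) * G₁.conjTranspose) *
      U₂.conjTranspose) * G₂.conjTranspose = W * Circuit.addQubit ρ * W.conjTranspose := by
    simp only [hW, σ₀, Matrix.conjTranspose_mul, Matrix.mul_assoc]
  rw [f4] at f3
  have f5 : bl (W * Circuit.addQubit ρ * W.conjTranspose) false false =
      successOp D τ u * ρ * (successOp D τ u).conjTranspose := by
    rw [← bl_success D τ u]
    simp only [bl_mul (W * Circuit.addQubit ρ), bl_mul W, bl_addQubit, bl_conjTranspose]
    simp [hW, G₀, G₁, G₂, U₁, U₂]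
  rw [← f5, ← bl_sub]
  exact (traceNorm_bl_le _ _).trans f3

end Attempt

/-! ### The gradient and its operator -/

section Gradient

variable {n p : ℕ}

lemma hasFDerivAt_prod_coord (u : Idx n p) (x : Vec n) :
    HasFDerivAt (fun x : Vec n => ∏ i, x (u i))
      (∑ j, (∏ i ∈ Finset.univ.erase j, x (u i)) • (EuclideanSpace.proj (𝕜 := ℝ) (u j))) x := by
  have := HasFDerivAt.finsetProd (u := Finset.univ) (x := x) (𝕜 := ℝ)
    (g := fun i (x : Vec n) => x (u i)) (g' := fun i => EuclideanSpace.proj (𝕜 := ℝ) (u i))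
    fun i _ => (EuclideanSpace.proj (𝕜 := ℝ) (u i) : Vec n →L[ℝ] ℝ).hasFDerivAt
  exact this

/-- The product rule gives one sum from the row indices and one from the column indices. They agree
by symmetry of `A`, which cancels the factor 1/2. -/
lemma gradient_objective_apply (A : Matrix (Idx n p) (Idx n p) ℝ) (hA : A.IsSymm) (x : Vec n)
    (a : Fin n → Bool) : gradient (objective A) x a =
      ∑ j, ∑ u : Idx n p, ∑ v : Idx n p, if u j = a then
        A u v * (∏ i ∈ Finset.univ.erase j, x (u i)) * ∏ i, x (v i) else 0 := by
  have h1 : HasFDerivAt (objective A) ((1 / 2 : ℝ) • ∑ u, ∑ v, A u v •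
      ((∏ i, x (u i)) • (∑ j, (∏ i ∈ Finset.univ.erase j, x (v i)) •
        (EuclideanSpace.proj (𝕜 := ℝ) (v j) : Vec n →L[ℝ] ℝ)) +
      (∏ i, x (v i)) • (∑ j, (∏ i ∈ Finset.univ.erase j, x (u i)) •
        (EuclideanSpace.proj (𝕜 := ℝ) (u j) : Vec n →L[ℝ] ℝ)))) x := by
    refine HasFDerivAt.const_mul (HasFDerivAt.fun_sum fun u _ => HasFDerivAt.fun_sum fun v _ =>
      HasFDerivAt.const_mul ?_ _) _
    exact (hasFDerivAt_prod_coord u x).mul (hasFDerivAt_prod_coord v x)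
  have h2 : gradient (objective A) x a =
      fderiv ℝ (objective A) x (EuclideanSpace.single a 1) := by
    rw [gradient, ← InnerProductSpace.toDual_symm_apply (𝕜 := ℝ), EuclideanSpace.inner_single_right]
    simp
  have h3 : ∀ b : Fin n → Bool, (EuclideanSpace.proj (𝕜 := ℝ) b : Vec n →L[ℝ] ℝ)
      (EuclideanSpace.single a 1) = if b = a then 1 else 0 := by
    intro b
    simp
  rw [h2, h1.fderiv]
  simp only [smul_apply, sum_apply,
    add_apply, h3, smul_eq_mul, mul_ite, mul_one, mul_zero]
  set F : Idx n p → Idx n p → ℝ := fun u v => A u v * ((∏ i, x (v i)) *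
    ∑ j, if u j = a then ∏ i ∈ Finset.univ.erase j, x (u i) else 0) with hF
  -- The symmetry of `A` turns the first half into `F` with its arguments exchanged.
  have h4 : ∑ u, ∑ v, A u v * ((∏ i, x (u i)) *
      (∑ j, if v j = a then ∏ i ∈ Finset.univ.erase j, x (v i) else 0) + (∏ i, x (v i)) *
      ∑ j, if u j = a then ∏ i ∈ Finset.univ.erase j, x (u i) else 0) =
      ∑ u, ∑ v, F v u + ∑ u, ∑ v, F u v := by
    simp only [← Finset.sum_add_distrib]
    refine Finset.sum_congr rfl fun u _ => Finset.sum_congr rfl fun v _ => ?_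
    simp only [hF]
    rw [mul_add, hA.apply u v]
  rw [h4, Finset.sum_comm]
  have h5 : ∑ u, ∑ v, F u v = ∑ j, ∑ u : Idx n p, ∑ v : Idx n p, if u j = a then
        A u v * (∏ i ∈ Finset.univ.erase j, x (u i)) * ∏ i, x (v i) else 0 := by
    rw [Finset.sum_comm]
    conv_rhs => enter [2, j]; rw [Finset.sum_comm]
    rw [Finset.sum_comm (s := Finset.univ (α := Fin p))]
    refine Finset.sum_congr rfl fun v _ => ?_
    rw [Finset.sum_comm (s := Finset.univ (α := Fin p))]
    refine Finset.sum_congr rfl fun u _ => ?_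
    simp only [hF]
    rw [Finset.mul_sum, Finset.mul_sum]
    refine Finset.sum_congr rfl fun j _ => ?_
    split_ifs <;> ring
  rw [h5]
  ring

/-- The amplitudes of `|x⟩` as a column. -/
def cvec (x : Vec n) : Matrix (Fin n → Bool) Unit ℂ := Matrix.of fun a _ => (x a : ℂ)

lemma pureState_eq (x : Vec n) : pureState x = cvec x * (cvec x).conjTranspose := by
  ext a b
  simp [pureState, cvec, Matrix.mul_apply]

lemma norm_cvec (x : Vec n) : ‖cvec x‖ = ‖x‖ := by
  have h1 := Matrix.l2_opNorm_conjTranspose_mul_self (cvec x)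
  have h2 : ((cvec x).conjTranspose * cvec x) () () = ((‖x‖ ^ 2 : ℝ) : ℂ) := by
    rw [EuclideanSpace.real_norm_sq_eq]
    simp [cvec, Matrix.mul_apply, sq]
  rw [norm_unit, h2, Complex.norm_real, norm_pow, norm_norm] at h1
  nlinarith [norm_nonneg x, norm_nonneg (cvec x)]

lemma cvec_sub (x y : Vec n) : cvec (x - y) = cvec x - cvec y := by
  ext; simp [cvec]

lemma cvec_smul (c : ℝ) (x : Vec n) : cvec (c • x) = (c : ℂ) • cvec x := by
  ext; simp [cvec]

lemma gradOpAt_mul_cvec (A : Matrix (Idx n p) (Idx n p) ℝ) (hA : A.IsSymm) (x : Vec n) :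
    gradOpAt A x * cvec x = cvec (gradient (objective A) x) := by
  ext a _
  simp only [cvec, Matrix.mul_apply, Matrix.of_apply, gradient_objective_apply A hA, gradOpAt,
    gradOp, pureState, Finset.sum_mul]
  push_cast
  rw [Finset.sum_comm]
  refine Finset.sum_congr rfl fun j _ => ?_
  rw [Finset.sum_comm]
  refine Finset.sum_congr rfl fun u _ => ?_
  rw [Finset.sum_comm]
  refine Finset.sum_congr rfl fun v _ => ?_
  -- Applying the operator to x supplies the factor x(v j) that the contraction over i ≠ j leaves
  -- out.
  rw [Finset.sum_eq_single (v j)]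
  · by_cases h : u j = a
    · simp only [h, and_self, if_true]
      push_cast
      rw [← Finset.mul_prod_erase Finset.univ (fun i => (x (v i) : ℂ)) (Finset.mem_univ j),
        Finset.prod_mul_distrib]
      ring
    · simp [h]
  · intro b _ hb
    rw [if_neg (fun h => hb h.2.symm), zero_mul]
  · simp

/-- The vector `x - η ∇ f (x)`, before it is normalised. -/
def descentVec (A : Matrix (Idx n p) (Idx n p) ℝ) (η : ℝ) (x : Vec n) : Vec n :=
  x - η • gradient (objective A) x

lemma cvec_descentVec (A : Matrix (Idx n p) (Idx n p) ℝ) (hA : A.IsSymm) (η : ℝ) (x : Vec n) :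
    cvec (descentVec A η x) = (1 - (η : ℂ) • gradOpAt A x) * cvec x := by
  rw [descentVec, cvec_sub, cvec_smul, ← gradOpAt_mul_cvec A hA, Matrix.sub_mul, Matrix.one_mul,
    Matrix.smul_mul]

/-- The lower bound ensures that the normalisation is well defined and that a trial succeeds with
probability at least about cos²θ/4; the upper bound enters the error of the unnormalised state. -/
lemma norm_descentVec (A : Matrix (Idx n p) (Idx n p) ℝ) (hA : A.IsSymm) {η Λ : ℝ} {x : Vec n}
    (hx : ‖x‖ = 1) (hη : 0 ≤ η) (hηΛ : η * Λ ≤ 1 / 2) (hD : ‖gradOpAt A x‖ ≤ Λ) :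
    1 / 2 ≤ ‖descentVec A η x‖ ∧ ‖descentVec A η x‖ ≤ 3 / 2 := by
  have h1 : ‖η • gradient (objective A) x‖ ≤ 1 / 2 := by
    rw [norm_smul, Real.norm_of_nonneg hη, ← norm_cvec, ← gradOpAt_mul_cvec A hA]
    have := Matrix.l2_opNorm_mul (gradOpAt A x) (cvec x)
    rw [norm_cvec, hx, mul_one] at this
    nlinarith
  have h2 := norm_sub_norm_le x (η • gradient (objective A) x)
  have h3 := norm_sub_le x (η • gradient (objective A) x)
  rw [hx] at h2 h3
  exact ⟨by rw [descentVec]; linarith, by rw [descentVec]; linarith⟩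

lemma pureState_smul (c : ℝ) (x : Vec n) : pureState (c • x) = ((c ^ 2 : ℝ) : ℂ) • pureState x := by
  ext a b
  simp [pureState]
  ring

lemma isDensity_pureState {x : Vec n} (hx : ‖x‖ = 1) : IsDensity (pureState x) := by
  constructor
  · rw [pureState_eq]
    exact Matrix.posSemidef_self_mul_conjTranspose _
  · have : ∑ a, x a ^ 2 = 1 := by rw [← EuclideanSpace.real_norm_sq_eq, hx, one_pow]
    simp only [Matrix.trace, Matrix.diag, pureState, Matrix.of_apply]
    rw [← Complex.ofReal_one, ← this]
    push_cast
    exact Finset.sum_congr rfl fun a _ => by ring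

end Gradient

/-! ### The operator of a successful attempt -/

section Success

-- The Taylor tail is dominated termwise by ‖y‖³/(k+3)!, and (k+3)! ≥ 2^(k+1) makes the geometric
-- majorant sum to ‖y‖³.
open Nat in
lemma norm_exp_sub_quadratic_le {𝔸 : Type} [NormedRing 𝔸] [NormedAlgebra ℂ 𝔸] [CompleteSpace 𝔸]
    {y : 𝔸} (hy : ‖y‖ ≤ 1) :
    ‖NormedSpace.exp y - (1 + y + (1 / 2 : ℂ) • y ^ 2)‖ ≤ ‖y‖ ^ 3 := by
  have h1 := (hasSum_nat_add_iff' 3).2 (NormedSpace.exp_series_hasSum_exp' (𝕂 := ℂ) y)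
  have h2 : ∑ i ∈ Finset.range 3, ((i ! : ℂ)⁻¹) • y ^ i = 1 + y + (1 / 2 : ℂ) • y ^ 2 := by
    simp [Finset.sum_range_succ, Nat.factorial]
  rw [h2] at h1
  have h3 : HasSum (fun k : ℕ => ‖y‖ ^ 3 * ((1 / 2) * (1 / 2 : ℝ) ^ k)) (‖y‖ ^ 3 * 1) := by
    refine HasSum.mul_left _ ?_
    have := (hasSum_geometric_of_lt_one (r := 1 / 2) (by norm_num) (by norm_num)).mul_left
      (1 / 2 : ℝ)
    norm_num at this ⊢
    exact this
  rw [mul_one] at h3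
  rw [← h1.tsum_eq]
  refine tsum_of_norm_bounded h3 fun k => ?_
  rw [norm_smul, norm_inv, Complex.norm_natCast]
  have h4 : ‖y ^ (k + 3)‖ ≤ ‖y‖ ^ 3 := (norm_pow_le' y (by omega)).trans
    (pow_le_pow_of_le_one (norm_nonneg y) hy (by omega))
  have h5 : (2 : ℝ) * 2 ^ k ≤ ((k + 3)! : ℝ) := by
    have : 2 ^ (k + 1) ≤ (k + 3)! := by
      clear h4
      induction k with
      | zero => decide
      | succ k ih =>
        rw [show k + 1 + 3 = (k + 3) + 1 by ring, Nat.factorial_succ, pow_succ]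
        nlinarith [Nat.factorial_pos (k + 3)]
    rw [pow_succ, mul_comm] at this
    exact_mod_cast this
  calc ((k + 3)! : ℝ)⁻¹ * ‖y ^ (k + 3)‖ ≤ (2 * 2 ^ k)⁻¹ * ‖y‖ ^ 3 := by gcongr
    _ = _ := by rw [mul_inv, one_div, inv_pow]; ring

/-- The linear algebra behind cos θ - sin θ · Dτ: the odd part of the two expansions is w·y, which
is the wanted first-order term, and the even parts have total weight 1. -/
lemma quadratic_identity {V : Type} [AddCommGroup V] [Module ℂ V] (w : ℂ) (o y z r r' d : V)
    (hd : w • y = -d) :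
    ((1 + w) / 2) • (o + y + (1 / 2 : ℂ) • z + r) +
      ((1 - w) / 2) • (o - y + (1 / 2 : ℂ) • z + r') - (o - d) =
      (1 / 2 : ℂ) • z + (((1 + w) / 2) • r + ((1 - w) / 2) • r') := by
  rw [sub_eq_add_neg o d, ← hd]
  module

/-- The deviation from 1 - d consists of y²/2 and the cubic remainders, whose weight 1 + r may be
large because r = η/τ. The hypothesis `hrs` makes r·s³ quadratic in s, so everything is of order s².
-/
lemma norm_cos_sub_sin_le {𝔸 : Type} [NormedRing 𝔸] [NormedAlgebra ℂ 𝔸] [CompleteSpace 𝔸]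
    {y d : 𝔸} {r s : ℝ} (hr0 : 0 ≤ r) (hs0 : 0 < s) (hs1 : s ≤ 1) (hrs : r * s ≤ 2)
    (hys : ‖y‖ ≤ s / 2) (hd : (Complex.I * (r : ℂ)) • y = -d) :
    ‖((1 + Complex.I * r) / 2) • NormedSpace.exp y +
      ((1 - Complex.I * r) / 2) • NormedSpace.exp (-y) - (1 - d)‖ ≤ s ^ 2 / 2 := by
  have hy1 : ‖y‖ ≤ 1 := by linarith
  obtain ⟨R, hR⟩ : ∃ R, R = NormedSpace.exp y - (1 + y + (1 / 2 : ℂ) • y ^ 2) := ⟨_, rfl⟩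
  obtain ⟨R', hR'⟩ : ∃ R', R' = NormedSpace.exp (-y) - (1 + (-y) + (1 / 2 : ℂ) • (-y) ^ 2) :=
    ⟨_, rfl⟩
  have hRn : ‖R‖ ≤ ‖y‖ ^ 3 := hR ▸ norm_exp_sub_quadratic_le hy1
  have hRn' : ‖R'‖ ≤ ‖y‖ ^ 3 := by
    have := norm_exp_sub_quadratic_le (y := -y) (by rwa [norm_neg])
    rw [norm_neg] at this
    exact hR' ▸ this
  have hE : NormedSpace.exp y = 1 + y + (1 / 2 : ℂ) • y ^ 2 + R := by rw [hR]; abel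
  have hE' : NormedSpace.exp (-y) = 1 - y + (1 / 2 : ℂ) • y ^ 2 + R' := by
    rw [hR', neg_sq]; abel
  have hc : ∀ w : ℂ, ‖w‖ ≤ r → ‖(1 + w) / 2‖ ≤ (1 + r) / 2 := by
    intro w hw
    rw [norm_div, Complex.norm_ofNat]
    have := norm_add_le 1 w
    rw [norm_one] at this
    linarith
  have hIr : ‖Complex.I * (r : ℂ)‖ ≤ r := by
    rw [norm_mul, Complex.norm_I, one_mul, Complex.norm_real, Real.norm_of_nonneg hr0]
  have h2 := hc (Complex.I * r) hIr
  have h3 := hc (-(Complex.I * r)) (by rwa [norm_neg])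
  rw [← sub_eq_add_neg] at h3
  rw [hE, hE', quadratic_identity _ _ _ _ _ _ _ hd]
  have h4 : ‖(1 / 2 : ℂ) • y ^ 2‖ ≤ 1 / 2 * ‖y‖ ^ 2 := by
    rw [norm_smul, norm_div, norm_one, Complex.norm_ofNat]
    exact mul_le_mul_of_nonneg_left (norm_pow_le' y two_pos) (by norm_num)
  have h5 : ‖((1 + Complex.I * r) / 2) • R + ((1 - Complex.I * r) / 2) • R'‖ ≤
      (1 + r) * ‖y‖ ^ 3 := by
    refine (norm_add_le _ _).trans ?_
    rw [norm_smul, norm_smul]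
    have e1 : ‖(1 + Complex.I * r) / 2‖ * ‖R‖ ≤ (1 + r) / 2 * ‖y‖ ^ 3 := by gcongr
    have e2 : ‖(1 - Complex.I * r) / 2‖ * ‖R'‖ ≤ (1 + r) / 2 * ‖y‖ ^ 3 := by gcongr
    linarith
  refine (norm_add_le _ _).trans ((add_le_add h4 h5).trans ?_)
  have h6 : ‖y‖ ^ 2 ≤ (s / 2) ^ 2 := by gcongr
  have h7 : ‖y‖ ^ 3 ≤ (s / 2) ^ 3 := by gcongr
  have h8 : (1 + r) * ‖y‖ ^ 3 ≤ (1 + r) * (s / 2) ^ 3 := by gcongr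
  have h9 : r * s * s ^ 2 ≤ 2 * s ^ 2 := by gcongr
  have h10 : s * s ^ 2 ≤ 1 * s ^ 2 := by gcongr
  nlinarith

variable {n : ℕ}

/-- Up to the factor `c`, a successful attempt applies `1 - η D`. -/
lemma norm_successOp_sub_le {D : Op (Fin n)} {τ η c s : ℝ} (hτ : 0 < τ) (hη : 0 ≤ η)
    (hs0 : 0 < s) (hs1 : s ≤ 1) (hD : τ * ‖D‖ ≤ s / 2) (hr : η * s ≤ 2 * τ) :
    ∃ B : Op (Fin n), successOp D τ ((c : ℂ) * (1 + Complex.I * (η / τ : ℝ))) = (c : ℂ) • B ∧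
      ‖B - (1 - (η : ℂ) • D)‖ ≤ s ^ 2 / 2 := by
  have hr0 : 0 ≤ η / τ := by positivity
  have hrs : η / τ * s ≤ 2 := by rwa [div_mul_eq_mul_div, div_le_iff₀ hτ]
  have hYs : ‖(Complex.I * (τ : ℂ)) • D‖ ≤ s / 2 := by
    rw [norm_smul, norm_mul, Complex.norm_I, one_mul, Complex.norm_real,
      Real.norm_of_nonneg hτ.le]
    exact hD
  have hIY : (Complex.I * ((η / τ : ℝ) : ℂ)) • (Complex.I * (τ : ℂ)) • D = -((η : ℂ) • D) := by
    rw [smul_smul, ← neg_smul]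
    congr 1
    have : ((η / τ : ℝ) : ℂ) * τ = η := by rw [← Complex.ofReal_mul, div_mul_cancel₀ _ hτ.ne']
    linear_combination Complex.I * Complex.I * this + (η : ℂ) * Complex.I_mul_I
  refine ⟨_, ?_, norm_cos_sub_sin_le hr0 hs0 hs1 hrs hYs hIY⟩
  rw [successOp, smul_add, smul_smul, smul_smul]
  congr 2
  · ring
  · simp only [map_mul, map_add, map_one, Complex.conj_ofReal, Complex.conj_I]
    ring

/-- The unnormalised state after a successful attempt. -/
lemma traceNorm_success_le {ρ B D D₀ : Op (Fin n)} {x u : Vec n} {a η L : ℝ} (ha : 0 ≤ a)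
    (hx : ‖x‖ = 1) (hu : ‖u‖ ≤ 3 / 2) (hη : 0 ≤ η) (hη1 : η ≤ 1 / 2)
    (hD₀ : η * ‖D₀‖ ≤ 1 / 2) (hxu : cvec u = (1 - (η : ℂ) • D₀) * cvec x)
    (hρ : traceNorm (ρ - pureState x) ≤ 2 * a) (hD : ‖D - D₀‖ ≤ L * a) (hL : 0 ≤ L)
    (hLa : (1 + L) * a ≤ 1) (hB : ‖B - (1 - (η : ℂ) • D)‖ ≤ a / 2) :
    traceNorm (B * ρ * B.conjTranspose - pureState u) ≤ (29 / 2 + 2 * L) * a := by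
  set B₀ : Op (Fin n) := 1 - (η : ℂ) • D₀ with hB₀
  have hone : ‖(1 : Op (Fin n))‖ ≤ 1 :=
    norm_le_one_of_conjTranspose_mul_self (by simp)
  have h1 : ‖B - B₀‖ ≤ (1 + L) / 2 * a := by
    have e : B - B₀ = (B - (1 - (η : ℂ) • D)) - (η : ℂ) • (D - D₀) := by rw [hB₀]; module
    have e2 : ‖(η : ℂ) • (D - D₀)‖ ≤ 1 / 2 * (L * a) := by
      rw [norm_smul, Complex.norm_real, Real.norm_of_nonneg hη]
      gcongr
    rw [e]
    refine (norm_sub_le _ _).trans ?_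
    linarith
  have h2 : ‖B₀‖ ≤ 3 / 2 := by
    have e2 : ‖(η : ℂ) • D₀‖ ≤ 1 / 2 := by
      rw [norm_smul, Complex.norm_real, Real.norm_of_nonneg hη]; exact hD₀
    refine (norm_sub_le _ _).trans ?_
    linarith
  have h3 : ‖B‖ ≤ 5 / 2 := by
    have e : B = B₀ + (B - B₀) := by abel
    rw [e]
    refine (norm_add_le _ _).trans ?_
    linarith
  have h4 : traceNorm (B * ρ * B.conjTranspose - B * pureState x * B.conjTranspose) ≤
      25 / 2 * a := by
    rw [← Matrix.sub_mul, ← Matrix.mul_sub]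
    refine (traceNorm_mul_mul_le _ _ _).trans ?_
    rw [norm_conjTranspose]
    calc ‖B‖ * ‖B‖ * traceNorm (ρ - pureState x) ≤ 5 / 2 * (5 / 2) * (2 * a) := by
          gcongr; exact traceNorm_nonneg _
      _ = _ := by ring
  -- The difference of the projectors onto Bx and u is a sum of two rank-one operators, each with a
  -- small factor Bx - u.
  have h5 : B * pureState x * B.conjTranspose - pureState u =
      (B * cvec x - cvec u) * (B * cvec x).conjTranspose +
        cvec u * (B * cvec x - cvec u).conjTranspose := by
    rw [pureState_eq, pureState_eq]
    simp only [Matrix.conjTranspose_sub, Matrix.conjTranspose_mul, Matrix.mul_sub, Matrix.sub_mul,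
      Matrix.mul_assoc]
    abel
  have h6 : ‖B * cvec x - cvec u‖ ≤ (1 + L) / 2 * a := by
    rw [hxu, ← Matrix.sub_mul]
    refine (Matrix.l2_opNorm_mul _ _).trans ?_
    rw [norm_cvec, hx, mul_one]
    exact h1
  have h7 : ‖B * cvec x‖ ≤ 5 / 2 := by
    refine (Matrix.l2_opNorm_mul _ _).trans ?_
    rw [norm_cvec, hx, mul_one]
    exact h3
  have h8 : traceNorm (B * pureState x * B.conjTranspose - pureState u) ≤ 2 * (1 + L) * a := by
    rw [h5]
    refine (traceNorm_add_le _ _).trans ?_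
    have e1 := traceNorm_rankOne_le (B * cvec x - cvec u) (B * cvec x)
    have e2 := traceNorm_rankOne_le (cvec u) (B * cvec x - cvec u)
    have e3 : ‖B * cvec x - cvec u‖ * ‖B * cvec x‖ ≤ (1 + L) / 2 * a * (5 / 2) := by gcongr
    have e4 : ‖cvec u‖ * ‖B * cvec x - cvec u‖ ≤ 3 / 2 * ((1 + L) / 2 * a) := by
      rw [norm_cvec]; gcongr
    linarith
  have := traceNorm_sub_le (B * ρ * B.conjTranspose) (B * pureState x * B.conjTranspose)
    (pureState u)
  linarith

/-- The effect of one attempt on the error of the state that is returned. -/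
lemma attempt_error {g ω X N : Op (Fin n)} {f : ℂ} {w Q κ ε e : ℝ} (hg : g.PosSemidef)
    (hf : 0 ≤ f) (hgf : g.trace + f = 1) (hω : IsDensity ω) (hX : IsDensity X) (hw : 1 / 2 ≤ w)
    (hQ : 0 ≤ Q) (hN : traceNorm (N - ((w ^ 2 : ℝ) : ℂ) • X) ≤ κ)
    (hgN : traceNorm (g - (Q : ℂ) • N) ≤ ε) (he : traceNorm (ω - X) ≤ e) :
    IsDensity (g + f • ω) ∧
      traceNorm (g + f • ω - X) ≤ 2 * (Q * κ + ε) + (1 - Q / 4 + (Q * κ + ε)) * e := by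
  have h1 : traceNorm (g - ((Q * w ^ 2 : ℝ) : ℂ) • X) ≤ Q * κ + ε := by
    have e1 := traceNorm_sub_le g ((Q : ℂ) • N) (((Q * w ^ 2 : ℝ) : ℂ) • X)
    have e2 : (Q : ℂ) • N - ((Q * w ^ 2 : ℝ) : ℂ) • X =
        (Q : ℂ) • (N - ((w ^ 2 : ℝ) : ℂ) • X) := by
      rw [smul_sub, smul_smul, Complex.ofReal_mul]
    rw [e2] at e1
    have e3 := traceNorm_smul_le (Q : ℂ) (N - ((w ^ 2 : ℝ) : ℂ) • X)
    rw [Complex.norm_real, Real.norm_of_nonneg hQ] at e3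
    have e4 : Q * traceNorm (N - ((w ^ 2 : ℝ) : ℂ) • X) ≤ Q * κ := by gcongr
    linarith
  set Δ := Q * κ + ε
  have h2 : ‖g.trace - ((Q * w ^ 2 : ℝ) : ℂ)‖ ≤ Δ := by
    have e1 := norm_trace_le (g - ((Q * w ^ 2 : ℝ) : ℂ) • X)
    rw [Matrix.trace_sub, Matrix.trace_smul, hX.2, smul_eq_mul, mul_one] at e1
    exact e1.trans h1
  -- The weight Qw² is replaced by the actual success probability tr g. As X has trace 1, this costs
  -- at most another Δ.
  have h3 : traceNorm (g - g.trace • X) ≤ 2 * Δ := by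
    have e1 := traceNorm_sub_le g (((Q * w ^ 2 : ℝ) : ℂ) • X) (g.trace • X)
    rw [← sub_smul] at e1
    have e2 := traceNorm_smul_le (((Q * w ^ 2 : ℝ) : ℂ) - g.trace) X
    rw [norm_sub_rev] at e2
    have e3 : ‖g.trace - ((Q * w ^ 2 : ℝ) : ℂ)‖ * traceNorm X ≤ Δ * 1 := by
      exact mul_le_mul h2 (traceNorm_of_isDensity hX) (traceNorm_nonneg _)
        ((norm_nonneg _).trans h2)
    linarith
  -- The factor 1/4 is the square of the lower bound 1/2 for `w`, the norm of the unnormalised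
  -- descent vector.
  have h4 : ‖f‖ ≤ 1 - Q / 4 + Δ := by
    have e1 : ‖f‖ = f.re := by
      rw [← RCLike.ofReal_re (K := ℂ) ‖f‖]
      rw [Complex.nonneg_iff] at hf
      rw [Complex.norm_def, Complex.normSq_apply, ← hf.2]
      simp [Real.sqrt_mul_self hf.1]
    have e2 : f.re = 1 - g.trace.re := by
      have := congrArg Complex.re hgf
      rw [Complex.add_re, Complex.one_re] at this
      linarith
    have e3 := (abs_le.1 ((Complex.abs_re_le_norm _).trans h2)).1
    rw [Complex.sub_re, Complex.ofReal_re] at e3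
    have e4 : Q * (1 / 4) ≤ Q * w ^ 2 := by
      gcongr
      nlinarith
    rw [e1, e2]
    linarith
  refine ⟨⟨hg.add (hω.1.smul hf), ?_⟩, ?_⟩
  · rw [Matrix.trace_add, Matrix.trace_smul, hω.2, smul_eq_mul, mul_one, hgf]
  · have e1 : g + f • ω - X = (g - g.trace • X) + f • (ω - X) := by
      have : X = (g.trace + f) • X := by rw [hgf, one_smul]
      conv_lhs => rw [this]
      module
    rw [e1]
    have e2 := traceNorm_smul_le f (ω - X)
    have e3 : ‖f‖ * traceNorm (ω - X) ≤ (1 - Q / 4 + Δ) * e := by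
      gcongr
      · exact traceNorm_nonneg _
      · exact (norm_nonneg _).trans h4
    exact (traceNorm_add_le _ _).trans (by linarith)

end Success

/-! ### A descent step -/

section Step

variable {n p b : ℕ}

/-- The circuit that only loads a copy of the given state. -/
def copyCircuit : Circuit n p b (Fin n) :=
  .prepend (.copy (Function.Embedding.refl _) .done) ⟨0, .done⟩

lemma copies_copyCircuit : (copyCircuit (n := n) (p := p) (b := b)).prog.copies = 1 := rfl

lemma gates_copyCircuit : (copyCircuit (n := n) (p := p) (b := b)).prog.gates = 0 := rfl

lemma copyCircuit_replaces (O : Oracles n p b) (ρ : Op (Fin n)) :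
    (copyCircuit (p := p) (b := b)).Replaces O ρ ρ := by
  intro σ
  rw [copyCircuit, Circuit.channel_prepend]
  refine (traceOut_addZeros _).trans ?_
  have h : ∀ (z x : Fin n → Bool), Function.extend (Function.Embedding.refl (Fin n)) z x = z :=
    fun z x => funext fun q => (Function.Embedding.refl (Fin n)).injective.extend_apply z x q
  ext x y
  simp only [Prog.run, reload, Matrix.of_apply, h, Matrix.smul_apply, smul_eq_mul]
  exact mul_comm _ _

/-- The evolution time of an attempt, for copies of accuracy `a`. -/
def stepTime (Λ a : ℝ) : ℝ := √a / (4 * Λ)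

/-- The amplitude `cos θ` with `tan θ = η / τ`. -/
def stepCos (η Λ a : ℝ) : ℝ := stepTime Λ a / √(stepTime Λ a ^ 2 + η ^ 2)

/-- The phase `exp (i θ)`. -/
def stepPhase (η Λ a : ℝ) : ℂ :=
  (stepCos η Λ a : ℂ) * (1 + Complex.I * (η / stepTime Λ a : ℝ))

/-- The accuracy of the simulations in an attempt, if `j` further attempts are left. -/
def stepAcc (a : ℝ) (j : ℕ) : ℝ := a * (1 - a / 80) ^ j / 640

lemma stepTime_pos {Λ a : ℝ} (hΛ : 0 < Λ) (ha : 0 < a) : 0 < stepTime Λ a := by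
  unfold stepTime; positivity

lemma stepTime_sq {Λ a : ℝ} (ha : 0 ≤ a) : stepTime Λ a ^ 2 = a / (16 * Λ ^ 2) := by
  rw [stepTime, div_pow, Real.sq_sqrt ha, mul_pow]; norm_num

lemma stepCos_sq (η Λ a : ℝ) :
    stepCos η Λ a ^ 2 = stepTime Λ a ^ 2 / (stepTime Λ a ^ 2 + η ^ 2) := by
  rw [stepCos, div_pow, Real.sq_sqrt (by positivity)]

lemma norm_stepPhase {η Λ a : ℝ} (hΛ : 0 < Λ) (ha : 0 < a) : ‖stepPhase η Λ a‖ = 1 := by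
  have hτ := stepTime_pos hΛ ha
  have h1 : ‖stepPhase η Λ a‖ ^ 2 = 1 := by
    rw [stepPhase, norm_mul, mul_pow, Complex.norm_real, Real.norm_eq_abs, sq_abs, stepCos_sq,
      Complex.sq_norm, Complex.normSq_apply]
    simp only [Complex.add_re, Complex.add_im, Complex.one_re, Complex.one_im, Complex.mul_re,
      Complex.mul_im, Complex.I_re, Complex.I_im, Complex.ofReal_re, Complex.ofReal_im]
    field_simp
    ring
  nlinarith [norm_nonneg (stepPhase η Λ a)]

/-- In units of 1/Λ², τ² equals a/16 and η² is at most 1/4, so cos²θ ≥ a/(a + 4) ≥ a/5. -/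
lemma le_stepCos_sq {η Λ a : ℝ} (hΛ : 1 ≤ Λ) (ha : 0 < a) (ha1 : a ≤ 1) (hη : 0 < η)
    (hηΛ : η * Λ ≤ 1 / 2) : a / 5 ≤ stepCos η Λ a ^ 2 := by
  have hτ := stepTime_pos (by linarith : 0 < Λ) ha
  have h3 : Λ ^ 2 * stepTime Λ a ^ 2 = a / 16 := by
    rw [stepTime_sq ha.le]
    field_simp
  rw [stepCos_sq, le_div_iff₀ (by positivity)]
  have h1 : (η * Λ) ^ 2 ≤ (1 / 2) ^ 2 := by gcongr
  have h2 : Λ ^ 2 * (a / 5 * (stepTime Λ a ^ 2 + η ^ 2)) ≤ Λ ^ 2 * stepTime Λ a ^ 2 := by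
    have e : Λ ^ 2 * (a / 5 * (stepTime Λ a ^ 2 + η ^ 2)) =
        a / 5 * (Λ ^ 2 * stepTime Λ a ^ 2 + (η * Λ) ^ 2) := by ring
    rw [e, h3]
    nlinarith
  exact le_of_mul_le_mul_left h2 (by positivity)

/-- At most `r` attempts at a descent step. -/
def stepCircuit (S : ℝ → ℝ → Circuit n p b (Option (Fin n))) {η Λ a : ℝ}
    (h : ‖stepPhase η Λ a‖ = 1) : ℕ → Circuit n p b (Fin n)
  | 0 => copyCircuit
  | j + 1 => attempt (phases (stepPhase η Λ a)) (fun c => by cases c <;> simp [phases, h])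
      (S (stepTime Λ a) (stepAcc a j)) (S (-stepTime Λ a) (stepAcc a j)) (stepCircuit S h j)

lemma copies_stepCircuit (S : ℝ → ℝ → Circuit n p b (Option (Fin n))) {η Λ a : ℝ}
    (h : ‖stepPhase η Λ a‖ = 1) (r : ℕ) : (stepCircuit S h r).prog.copies ≤
      1 + ∑ j ∈ Finset.range r, (1 + (S (stepTime Λ a) (stepAcc a j)).prog.copies +
        (S (-stepTime Λ a) (stepAcc a j)).prog.copies) := by
  induction r with
  | zero => simp [stepCircuit, copies_copyCircuit]
  | succ r ih =>
    rw [Finset.sum_range_succ, stepCircuit]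
    refine (copies_attempt _ _ _ _ _).trans ?_
    omega

lemma gates_stepCircuit (S : ℝ → ℝ → Circuit n p b (Option (Fin n))) {η Λ a : ℝ}
    (h : ‖stepPhase η Λ a‖ = 1) (r : ℕ) : (stepCircuit S h r).prog.gates ≤
      ∑ j ∈ Finset.range r, (4 + (S (stepTime Λ a) (stepAcc a j)).prog.gates +
        (S (-stepTime Λ a) (stepAcc a j)).prog.gates) := by
  induction r with
  | zero => simp [stepCircuit, gates_copyCircuit]
  | succ r ih =>
    rw [Finset.sum_range_succ, stepCircuit]
    refine (gates_attempt _ _ _ _ _).trans ?_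
    omega

lemma norm_descentStep {A : Matrix (Idx n p) (Idx n p) ℝ} {η : ℝ} {x : Vec n}
    (h : 0 < ‖descentVec A η x‖) : ‖descentStep A η x‖ = 1 := by
  change ‖‖descentVec A η x‖⁻¹ • descentVec A η x‖ = 1
  rw [norm_smul, norm_inv, norm_norm, inv_mul_cancel₀ h.ne']

/-- The error bound 16k + 2l survives one more trial. Since k ≤ 1/16 and al/80 ≤ Q/16, the factor is
at most 1 - Q/8. Its action on 16k cancels the noise 2Qk exactly. Its action on 2l gains Ql/4 ≥
al/20, of which al/40 pays for the simulation error and al/40 remains as decay. -/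
lemma step_recursion {Q k a l : ℝ} (ha : 0 ≤ a) (hQ : a / 5 ≤ Q) (hk0 : 0 ≤ k)
    (hk : k ≤ 1 / 16) (hl0 : 0 ≤ l) (hl1 : l ≤ 1) :
    2 * (Q * k + a * l / 80) + (1 - Q / 4 + (Q * k + a * l / 80)) * (16 * k + 2 * l) ≤
      16 * k + 2 * (l * (1 - a / 80)) := by
  have hQ0 : 0 ≤ Q := by linarith
  have hal : a / 5 * l ≤ Q * l := mul_le_mul_of_nonneg_right hQ hl0
  have hal' : a * l ≤ a * 1 := mul_le_mul_of_nonneg_left hl1 ha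
  have hQk : Q * k ≤ Q * (1 / 16) := mul_le_mul_of_nonneg_left hk hQ0
  have hfac : 1 - Q / 4 + (Q * k + a * l / 80) ≤ 1 - Q / 8 := by linarith
  have h5 := mul_le_mul_of_nonneg_right hfac (by positivity : 0 ≤ 16 * k + 2 * l)
  linarith

/-- Induction on the number of trials left. The two terms of the bound are the bias of a successful
trial, which no repetition removes, and a geometrically decaying term that bounds the effect of
persistent failure and of the simulation errors. -/
theorem stepCircuit_spec {S : ℝ → ℝ → Circuit n p b (Option (Fin n))} {O : Oracles n p b}
    {A : Matrix (Idx n p) (Idx n p) ℝ} (hA : A.IsSymm) {x : Vec n} (hx : ‖x‖ = 1)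
    {η Λ a L : ℝ} (hΛ : 1 ≤ Λ) (hη : 0 < η) (hηΛ : η * Λ ≤ 1 / 2) (ha : 0 < a) (hL : 0 ≤ L)
    (haL : 16 * (29 / 2 + 2 * L) * a ≤ 1) (hnorm : ‖gradOpAt A x‖ ≤ Λ)
    {ρ D : Op (Fin n)} (hρ : IsDensity ρ) (hρx : traceNorm (ρ - pureState x) ≤ 2 * a)
    (hD : D.IsHermitian) (hDx : ‖D - gradOpAt A x‖ ≤ L * a)
    (hS : ∀ τ ε : ℝ, 0 < ε → ε < 1 → (S τ ε).Simulates O ρ D τ ε)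
    (h : ‖stepPhase η Λ a‖ = 1) (r : ℕ) :
    ∃ ω, (stepCircuit S h r).Replaces O ρ ω ∧ IsDensity ω ∧
      traceNorm (ω - pureState (descentStep A η x)) ≤
        16 * ((29 / 2 + 2 * L) * a) + 2 * (1 - a / 80) ^ r := by
  have ha1 : a ≤ 1 := by nlinarith
  have hLa : (1 + L) * a ≤ 1 := by nlinarith
  have hΛ0 : 0 < Λ := by linarith
  obtain ⟨hu1, hu2⟩ := norm_descentVec A hA hx hη.le hηΛ hnorm
  have hu0 : 0 < ‖descentVec A η x‖ := by linarith
  have hX : IsDensity (pureState (descentStep A η x)) :=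
    isDensity_pureState (norm_descentStep hu0)
  have hτ := stepTime_pos hΛ0 ha
  have hsq : √a ^ 2 = a := Real.sq_sqrt ha.le
  have hs0 : 0 < √a := Real.sqrt_pos.2 ha
  have hs1 : √a ≤ 1 := Real.sqrt_le_one.2 ha1
  have hηhalf : η ≤ 1 / 2 := by nlinarith
  -- The simulated operator is only close to D(x). As La ≤ 1 ≤ Λ, its norm at most doubles the
  -- bound, which accounts for the 4 in `stepTime`.
  have hDn : ‖D‖ ≤ 2 * Λ := by
    have e : D = gradOpAt A x + (D - gradOpAt A x) := by abel
    rw [e]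
    refine (norm_add_le _ _).trans ?_
    nlinarith
  have hτD : stepTime Λ a * ‖D‖ ≤ √a / 2 := by
    calc stepTime Λ a * ‖D‖ ≤ stepTime Λ a * (2 * Λ) := by gcongr
      _ = √a / 2 := by rw [stepTime]; field_simp; norm_num
  have hητ : η * √a ≤ 2 * stepTime Λ a := by
    have e : 2 * stepTime Λ a = (1 / 2 / Λ) * √a := by rw [stepTime]; field_simp; norm_num
    rw [e]
    gcongr
    rwa [le_div_iff₀ hΛ0]
  obtain ⟨B, hB1, hB2⟩ := norm_successOp_sub_le (D := D) (τ := stepTime Λ a) (η := η)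
    (c := stepCos η Λ a) hτ hη.le hs0 hs1 hτD hητ
  rw [hsq] at hB2
  have hN := traceNorm_success_le ha.le hx hu2 hη.le hηhalf (by nlinarith [norm_nonneg (gradOpAt A x)])
    (cvec_descentVec A hA η x) hρx hDx hL hLa hB2
  have hXu : pureState (descentVec A η x) =
      ((‖descentVec A η x‖ ^ 2 : ℝ) : ℂ) • pureState (descentStep A η x) := by
    rw [← pureState_smul]
    congr 1
    change _ = ‖descentVec A η x‖ • ‖descentVec A η x‖⁻¹ • descentVec A η x
    rw [smul_smul, mul_inv_cancel₀ hu0.ne', one_smul]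
  rw [hXu] at hN
  have hQ := le_stepCos_sq hΛ ha ha1 hη hηΛ
  have hQ0 : 0 ≤ stepCos η Λ a ^ 2 := sq_nonneg _
  have hl0 : 0 < 1 - a / 80 := by linarith
  induction r with
  | zero =>
    refine ⟨ρ, copyCircuit_replaces O ρ, hρ, ?_⟩
    -- With no trials left the copy itself is returned, and only the trivial bound 2 is used for it.
    have := traceNorm_sub_le_two hρ hX
    have h2 : 0 ≤ (29 / 2 + 2 * L) * a := by positivity
    rw [pow_zero]
    linarith
  | succ j ih =>
    obtain ⟨ω, h1, h2, h3⟩ := ih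
    have hl1 : (1 - a / 80) ^ j ≤ 1 := pow_le_one₀ hl0.le (by linarith)
    have hlj : 0 < (1 - a / 80) ^ j := pow_pos hl0 j
    have hε0 : 0 < stepAcc a j := by unfold stepAcc; positivity
    have hε1 : stepAcc a j < 1 := by unfold stepAcc; nlinarith
    obtain ⟨g1, g2, g3⟩ := attemptState_spec h hρ hD (hS (stepTime Λ a) _ hε0 hε1)
      (hS (-stepTime Λ a) _ hε0 hε1)
    refine ⟨_, attempt_replaces _ _ _ _ h1, ?_⟩
    set st := attemptState (phases (stepPhase η Λ a)) (S (stepTime Λ a) (stepAcc a j))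
      (S (-stepTime Λ a) (stepAcc a j)) O ρ
    have hgN : traceNorm (bl st false false - ((stepCos η Λ a ^ 2 : ℝ) : ℂ) •
        (B * ρ * B.conjTranspose)) ≤ 8 * stepAcc a j := by
      have e : successOp D (stepTime Λ a) (stepPhase η Λ a) * ρ *
          (successOp D (stepTime Λ a) (stepPhase η Λ a)).conjTranspose =
          ((stepCos η Λ a ^ 2 : ℝ) : ℂ) • (B * ρ * B.conjTranspose) := by
        rw [stepPhase, hB1, Matrix.conjTranspose_smul, Matrix.smul_mul, Matrix.smul_mul,
          Matrix.mul_smul, smul_smul, Complex.star_def, Complex.conj_ofReal]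
        congr 1
        push_cast
        ring
      rwa [e] at g3
    have hfin := attempt_error (bl_posSemidef g1 false) (bl_posSemidef g1 true).trace_nonneg
      (by rw [← trace_eq_bl, g2]) h2 hX hu1 hQ0 hN hgN h3
    refine ⟨hfin.1, hfin.2.trans ?_⟩
    have e8 : 8 * stepAcc a j = a * (1 - a / 80) ^ j / 80 := by unfold stepAcc; ring
    rw [e8, pow_succ]
    exact step_recursion ha.le (by linarith) (by positivity) (by linarith) hlj.le hl1

end Step

/-! ### Mixtures of nearby pure states -/

section Mixture

variable {ι : Type} [Fintype ι] [DecidableEq ι]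

/-- The sign of a bit. -/
def sgn (c : Bool) : ℂ := if c then -1 else 1

lemma norm_sgn (c : Bool) : ‖sgn c‖ = 1 := by cases c <;> simp [sgn]

lemma sum_sgn_mul (k l : ι) :
    ∑ m : ι → Bool, sgn (m k) * sgn (m l) = if k = l then (Fintype.card (ι → Bool) : ℂ) else 0 := by
  split_ifs with h
  · subst h
    have : ∀ c, sgn c * sgn c = 1 := by intro c; cases c <;> simp [sgn]
    simp [this]
  -- Flipping the bit `k` reverses the sign of every term.
  · have hinv : Function.Involutive fun m : ι → Bool => Function.update m k (!m k) := by
      intro m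
      simp
    have h1 := Equiv.sum_comp (Function.Involutive.toPerm _ hinv) fun m : ι → Bool => sgn (m k) * sgn (m l)
    have h2 : ∀ m : ι → Bool, sgn (Function.Involutive.toPerm _ hinv m k) *
        sgn (Function.Involutive.toPerm _ hinv m l) =
        -(sgn (m k) * sgn (m l)) := by
      intro m
      have e : sgn (!m k) = -sgn (m k) := by cases m k <;> simp [sgn]
      simp [Function.Involutive.coe_toPerm, Function.update_of_ne (Ne.symm h), e]
    simp only [h2, Finset.sum_neg_distrib] at h1
    linear_combination (-1 / 2 : ℂ) * h1

/-- For the index k that maximises q, the average Σ λq is at most q_k, so q_k ≥ 1 - 2a. All other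
q_j are then at most 1 - q_k ≤ 2a, and the remaining terms of the average contribute at most 2a. -/
lemma exists_dominant {lam q : ι → ℝ} {a : ℝ} (hl : ∀ k, 0 ≤ lam k) (hq : ∀ k, 0 ≤ q k)
    (hl1 : ∑ k, lam k = 1) (hq1 : ∑ k, q k = 1) (h : 1 - 2 * a ≤ ∑ k, lam k * q k) :
    ∃ k, 1 - 4 * a ≤ lam k * q k := by
  have hne : Nonempty ι := by
    by_contra h
    rw [not_nonempty_iff] at h
    simp at hl1
  obtain ⟨k, -, hk⟩ := Finset.exists_max_image Finset.univ q Finset.univ_nonempty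
  refine ⟨k, ?_⟩
  have h1 : ∑ j, lam j * q j ≤ q k := by
    calc ∑ j, lam j * q j ≤ ∑ j, lam j * q k :=
          Finset.sum_le_sum fun j hj => mul_le_mul_of_nonneg_left (hk j hj) (hl j)
      _ = q k := by rw [← Finset.sum_mul, hl1, one_mul]
  rw [← Finset.add_sum_erase _ _ (Finset.mem_univ k)] at h hq1 hl1
  have h2 : ∑ j ∈ Finset.univ.erase k, lam j * q j ≤
      ∑ j ∈ Finset.univ.erase k, lam j * (1 - q k) := by
    refine Finset.sum_le_sum fun j hj => mul_le_mul_of_nonneg_left ?_ (hl j)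
    have := Finset.single_le_sum (fun i _ => hq i) hj
    linarith
  rw [← Finset.sum_mul] at h2
  have h3 : q k ≤ 1 := by
    have := Finset.sum_nonneg fun i (_ : i ∈ Finset.univ.erase k) => hq i
    linarith
  have h4 : (∑ j ∈ Finset.univ.erase k, lam j) * (1 - q k) ≤ 1 * (1 - q k) := by
    have := hl k
    exact mul_le_mul_of_nonneg_right (by linarith) (by linarith)
  rw [← Finset.add_sum_erase _ _ (Finset.mem_univ k)] at h1
  linarith

/-- One term has modulus at least 1 - 4a. Outside it both Σ λ and Σ ‖w‖² are at most 4a, so by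
Cauchy-Schwarz the other terms sum to at most 4a whatever their phases. The bound is thus linear in
a and independent of the signs. -/
lemma le_norm_sum_of_dominant {lam : ι → ℝ} {w : ι → ℂ} {a : ℝ} (hl : ∀ k, 0 ≤ lam k)
    (hl1 : ∑ k, lam k = 1) (hq1 : ∑ k, ‖w k‖ ^ 2 = 1)
    (h : 1 - 2 * a ≤ ∑ k, lam k * ‖w k‖ ^ 2) {s : ι → ℂ} (hs : ∀ k, ‖s k‖ = 1) :
    1 - 8 * a ≤ ‖∑ k, s k * ((√(lam k) : ℝ) : ℂ) * w k‖ := by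
  obtain ⟨k, hk⟩ := exists_dominant hl (fun k => sq_nonneg ‖w k‖) hl1 hq1 h
  have hn : ∀ j, ‖s j * ((√(lam j) : ℝ) : ℂ) * w j‖ = √(lam j) * ‖w j‖ := fun j => by
    rw [norm_mul, norm_mul, hs, one_mul, Complex.norm_real, Real.norm_of_nonneg (Real.sqrt_nonneg _)]
  rw [← Finset.add_sum_erase _ _ (Finset.mem_univ k)] at hl1 hq1 ⊢
  have h1 : ‖∑ j ∈ Finset.univ.erase k, s j * ((√(lam j) : ℝ) : ℂ) * w j‖ ≤
      ∑ j ∈ Finset.univ.erase k, √(lam j) * ‖w j‖ :=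
    (norm_sum_le _ _).trans (Finset.sum_le_sum fun j _ => (hn j).le)
  have h2 := Finset.sum_mul_sq_le_sq_mul_sq (Finset.univ.erase k) (fun j => √(lam j))
    fun j => ‖w j‖
  simp only [Real.sq_sqrt (hl _)] at h2
  have p1 : 0 ≤ ∑ j ∈ Finset.univ.erase k, lam j := Finset.sum_nonneg fun j _ => hl j
  have p2 : 0 ≤ ∑ j ∈ Finset.univ.erase k, ‖w j‖ ^ 2 := Finset.sum_nonneg fun j _ => sq_nonneg _
  have hlk : lam k ≤ 1 := by linarith
  have hwk : ‖w k‖ ^ 2 ≤ 1 := by linarith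
  have hlk0 := hl k
  have hwk0 := sq_nonneg ‖w k‖
  have q1 : ∑ j ∈ Finset.univ.erase k, lam j ≤ 4 * a := by nlinarith
  have q2 : ∑ j ∈ Finset.univ.erase k, ‖w j‖ ^ 2 ≤ 4 * a := by nlinarith
  have ha : 0 ≤ 4 * a := p1.trans q1
  have h3 : ∑ j ∈ Finset.univ.erase k, √(lam j) * ‖w j‖ ≤ 4 * a := by
    refine abs_le_of_sq_le_sq' ?_ ha |>.2
    exact h2.trans ((mul_le_mul q1 q2 p2 ha).trans (by rw [sq]))
  have h4 : 1 - 4 * a ≤ √(lam k) * ‖w k‖ := by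
    have e : (√(lam k) * ‖w k‖) ^ 2 = lam k * ‖w k‖ ^ 2 := by
      rw [mul_pow, Real.sq_sqrt hlk0]
    have e0 : 0 ≤ √(lam k) * ‖w k‖ := by positivity
    have e1 : √(lam k) * ‖w k‖ ≤ 1 := by nlinarith
    nlinarith
  have h5 := norm_sub_le_norm_add (s k * ((√(lam k) : ℝ) : ℂ) * w k)
    (∑ j ∈ Finset.univ.erase k, s j * ((√(lam j) : ℝ) : ℂ) * w j)
  rw [hn] at h5
  linarith

end Mixture

/-! ### States near a pure state in the i.i.d. error model -/

section Iid

variable {ι : Type} [Fintype ι] [DecidableEq ι]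

/-- Serves three purposes: with `c = 1` and orthonormal rows or columns it is Parseval's identity,
and with `c` the eigenvalues it evaluates ⟨x|ρ|x⟩. -/
lemma sum_mul_mul_conj {κ : Type} [Fintype κ] (c : κ → ℂ) (y : ι → ℂ) (V : ι → κ → ℂ) :
    ∑ k, c k * ((∑ a, y a * V a k) * (starRingEnd ℂ) (∑ a, y a * V a k)) =
      ∑ a, ∑ b, y a * (starRingEnd ℂ) (y b) * ∑ k, c k * V a k * (starRingEnd ℂ) (V b k) := by
  have h : ∀ k, c k * ((∑ a, y a * V a k) * (starRingEnd ℂ) (∑ a, y a * V a k)) =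
      ∑ a, ∑ b, y a * (starRingEnd ℂ) (y b) * (c k * V a k * (starRingEnd ℂ) (V b k)) := by
    intro k
    rw [map_sum, Finset.sum_mul_sum, Finset.mul_sum]
    refine Finset.sum_congr rfl fun a _ => ?_
    rw [Finset.mul_sum]
    refine Finset.sum_congr rfl fun b _ => ?_
    rw [map_mul]
    ring
  simp only [h, Finset.mul_sum]
  rw [Finset.sum_comm]
  exact Finset.sum_congr rfl fun a _ => Finset.sum_comm

lemma sum_mul_conj_ofReal (c : ι → ℂ) : ∑ k, c k * (starRingEnd ℂ) (c k) =
    ((∑ k, ‖c k‖ ^ 2 : ℝ) : ℂ) := by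
  push_cast
  exact Finset.sum_congr rfl fun k _ => Complex.mul_conj' _

/-- A spectral decomposition of a density matrix. -/
lemma IsDensity.exists_spectral {ρ : Matrix ι ι ℂ} (hρ : IsDensity ρ) :
    ∃ (V : ι → ι → ℂ) (lam : ι → ℝ), (∀ k, 0 ≤ lam k) ∧ ∑ k, lam k = 1 ∧
      (∀ a b, ρ a b = ∑ k, (lam k : ℂ) * V a k * (starRingEnd ℂ) (V b k)) ∧
      (∀ a b, ∑ k, V a k * (starRingEnd ℂ) (V b k) = if a = b then 1 else 0) ∧
      (∀ k l, ∑ a, V a k * (starRingEnd ℂ) (V a l) = if k = l then 1 else 0) := by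
  have hH := hρ.1.isHermitian
  have hV := hH.eigenvectorUnitary.2
  refine ⟨fun a k => (hH.eigenvectorUnitary : Matrix ι ι ℂ) a k, hH.eigenvalues,
    hρ.1.eigenvalues_nonneg, ?_, fun a b => ?_, fun a b => ?_, fun k l => ?_⟩
  · have h1 := hH.trace_eq_sum_eigenvalues
    rw [hρ.2] at h1
    have h2 : ((∑ k, hH.eigenvalues k : ℝ) : ℂ) = 1 := by
      rw [h1, Complex.ofReal_sum]
      rfl
    exact_mod_cast h2
  · have h1 := congrFun (congrFun hH.spectral_theorem a) b
    rw [Unitary.conjStarAlgAut_apply] at h1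
    rw [h1, Matrix.mul_apply]
    refine Finset.sum_congr rfl fun k _ => ?_
    rw [Matrix.mul_diagonal, Matrix.star_apply]
    simp only [Function.comp_apply, RCLike.star_def]
    rw [mul_comm ((hH.eigenvectorUnitary : Matrix ι ι ℂ) a k)]
    rfl
  · have h1 := congrFun (congrFun (Matrix.mem_unitaryGroup_iff.1 hV) a) b
    simpa only [Matrix.mul_apply, Matrix.star_apply, RCLike.star_def, Matrix.one_apply] using h1
  · have h1 := congrFun (congrFun (Matrix.mem_unitaryGroup_iff'.1 hV) l) k
    simp only [Matrix.mul_apply, Matrix.star_apply, RCLike.star_def, Matrix.one_apply] at h1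
    simp only [mul_comm _ ((starRingEnd ℂ) _), h1, eq_comm]

lemma norm_pureState {n : ℕ} {x : Vec n} (hx : ‖x‖ = 1) : ‖pureState x‖ ≤ 1 := by
  rw [pureState_eq]
  refine (Matrix.l2_opNorm_mul _ _).trans ?_
  rw [norm_conjTranspose, norm_cvec, hx, one_mul]

/-- A random vector with uniformly distributed discrete parameter. -/
lemma mem_iidErrorModel_of_uniform {n : ℕ} {x : Vec n} {β : ℝ} {ρ : Op (Fin n)}
    {M : Type} [Fintype M] [Nonempty M] (φ : M → (Fin n → Bool) → ℂ)
    (h1 : ∀ m, ∑ a, ‖φ m a‖ ^ 2 = 1) (h2 : ∀ m, ∑ a, ‖φ m a - x a‖ ^ 2 ≤ β ^ 2) (hβ : 0 ≤ β)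
    (h3 : ∀ a b, ∑ m, φ m a * (starRingEnd ℂ) (φ m b) = Fintype.card M * ρ a b) :
    ρ ∈ iidErrorModel x β := by
  let _ : MeasurableSpace M := ⊤
  let v : M → EuclideanSpace ℂ (Fin n → Bool) := fun m => WithLp.toLp 2 fun a => φ m a - x a
  have hv : Measurable v := measurable_from_top
  have hva : ∀ m a, (x a : ℂ) + v m a = φ m a := fun m a => by
    change (x a : ℂ) + (φ m a - x a) = φ m a
    ring
  refine ⟨(PMF.uniformOfFintype M).toMeasure.map v,
    MeasureTheory.Measure.isProbabilityMeasure_map hv.aemeasurable, ?_, fun a b => ?_⟩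
  · rw [MeasureTheory.ae_map_iff hv.aemeasurable]
    · refine Filter.Eventually.of_forall fun m => ⟨?_, ?_⟩
      · refine abs_le_of_sq_le_sq' ?_ hβ |>.2
        rw [EuclideanSpace.norm_sq_eq]
        exact h2 m
      · simp only [hva, h1]
    · refine (IsClosed.inter (s₁ := {v | ‖v‖ ≤ β}) (isClosed_le (by fun_prop) (by fun_prop))
        (isClosed_eq ?_ (by fun_prop))).measurableSet
      fun_prop
  · rw [MeasureTheory.integral_map hv.aemeasurable
      (Continuous.aestronglyMeasurable (by fun_prop)), PMF.integral_eq_sum]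
    simp only [hva, PMF.uniformOfFintype_apply, ENNReal.toReal_inv, ENNReal.toReal_natCast,
      Complex.real_smul, ← Finset.mul_sum, h3]
    rw [← mul_assoc]
    have : (Fintype.card M : ℂ) ≠ 0 := by exact_mod_cast Fintype.card_ne_zero
    push_cast
    rw [inv_mul_cancel₀ this, one_mul]

/-- Every state close to `|x⟩` obeys the i.i.d. error model. -/
theorem mem_iidErrorModel {n : ℕ} {x : Vec n} (hx : ‖x‖ = 1) {a β : ℝ} {ρ : Op (Fin n)}
    (hρ : IsDensity ρ) (h : traceNorm (ρ - pureState x) ≤ 2 * a) (hβ : 0 ≤ β)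
    (haβ : 16 * a ≤ β ^ 2) : ρ ∈ iidErrorModel x β := by
  obtain ⟨V, lam, hl, hl1, hs, hV1, hV2⟩ := hρ.exists_spectral
  have hx2 : ∑ a, x a ^ 2 = 1 := by
    rw [← EuclideanSpace.real_norm_sq_eq, hx, one_pow]
  set w : (Fin n → Bool) → ℂ := fun k => ∑ a, (x a : ℂ) * V a k with hw
  have hq1 : ∑ k, ‖w k‖ ^ 2 = 1 := by
    have h1 := sum_mul_mul_conj (fun _ => 1) (fun a => (x a : ℂ)) V
    simp only [one_mul, hV1, mul_ite, mul_one, mul_zero, Finset.sum_ite_eq, Finset.mem_univ,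
      if_true, sum_mul_conj_ofReal] at h1
    have h2 : ((∑ k, ‖w k‖ ^ 2 : ℝ) : ℂ) = ((∑ a, x a ^ 2 : ℝ) : ℂ) := by
      rw [h1]
      push_cast
      exact Finset.sum_congr rfl fun a _ => by simp [← Complex.ofReal_pow]
    rw [hx2] at h2
    exact_mod_cast h2
  have hq2 : 1 - 2 * a ≤ ∑ k, lam k * ‖w k‖ ^ 2 := by
    have h1 := sum_mul_mul_conj (fun k => (lam k : ℂ)) (fun a => (x a : ℂ)) V
    simp only [← hs, Complex.mul_conj'] at h1
    have h2 : ((∑ k, lam k * ‖w k‖ ^ 2 : ℝ) : ℂ) = (pureState x * ρ).trace := by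
      push_cast
      rw [h1, Matrix.trace, Finset.sum_comm]
      refine Finset.sum_congr rfl fun a _ => ?_
      rw [Matrix.diag_apply, Matrix.mul_apply]
      refine Finset.sum_congr rfl fun b _ => ?_
      simp only [pureState, Matrix.of_apply, Complex.conj_ofReal]
      ring
    have h3 : (pureState x * pureState x).trace = 1 := by
      simp only [Matrix.trace, Matrix.diag_apply, Matrix.mul_apply, pureState, Matrix.of_apply]
      have e : ∀ a b, (x a : ℂ) * x b * (x b * x a) = ((x a ^ 2 * x b ^ 2 : ℝ) : ℂ) := by
        intro a b
        push_cast
        ring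
      simp only [e, ← Complex.ofReal_sum, ← Finset.mul_sum, ← Finset.sum_mul, hx2]
      simp
    have h4 := (norm_trace_mul_le (pureState x) (ρ - pureState x)).trans
      (mul_le_mul (norm_pureState hx) h (traceNorm_nonneg _) zero_le_one)
    rw [Matrix.mul_sub, Matrix.trace_sub, ← h2, h3, ← Complex.ofReal_one, ← Complex.ofReal_sub,
      Complex.norm_real, Real.norm_eq_abs, one_mul] at h4
    have := (abs_le.1 h4).1
    linarith
  -- A global phase makes the overlap of x with the signed superposition real and nonnegative.
  -- Closeness as vectors, and not just as states, requires this.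
  have hI : ∀ m : (Fin n → Bool) → Bool, ∃ θ : ℂ, ‖θ‖ = 1 ∧
      1 - 8 * a ≤ (θ * ∑ k, sgn (m k) * ((√(lam k) : ℝ) : ℂ) * w k).re := by
    intro m
    obtain ⟨θ, h1, h2⟩ := RCLike.exists_norm_eq_mul_self
      (∑ k, sgn (m k) * ((√(lam k) : ℝ) : ℂ) * w k)
    refine ⟨θ, h1, ?_⟩
    rw [← h2]
    exact le_norm_sum_of_dominant hl hl1 hq1 hq2 fun k => norm_sgn (m k)
  choose θ hθ1 hθ2 using hI
  have hconj : ∀ m, θ m * (starRingEnd ℂ) (θ m) = 1 := fun m => by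
    rw [Complex.mul_conj', hθ1]; simp
  let y : ((Fin n → Bool) → Bool) → (Fin n → Bool) → ℂ :=
    fun m k => sgn (m k) * ((√(lam k) : ℝ) : ℂ)
  have hsq : ∀ k, ((√(lam k) : ℝ) : ℂ) * ((√(lam k) : ℝ) : ℂ) = lam k := fun k => by
    rw [← Complex.ofReal_mul, Real.mul_self_sqrt (hl k)]
  have hsg : ∀ c, (starRingEnd ℂ) (sgn c) = sgn c := by intro c; cases c <;> simp [sgn]
  have hsg1 : ∀ c, sgn c * sgn c = 1 := by intro c; cases c <;> simp [sgn]
  have hφ1 : ∀ m, ∑ a, ‖θ m * ∑ k, y m k * V a k‖ ^ 2 = 1 := by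
    intro m
    have h1 := sum_mul_mul_conj (fun _ => 1) (y m) fun k a => V a k
    simp only [one_mul, hV2, mul_ite, mul_one, mul_zero, Finset.sum_ite_eq, Finset.mem_univ,
      if_true, sum_mul_conj_ofReal] at h1
    have h2 : ∑ k, ‖y m k‖ ^ 2 = 1 := by
      rw [← hl1]
      refine Finset.sum_congr rfl fun k _ => ?_
      rw [norm_mul, norm_sgn, one_mul, Complex.norm_real, Real.norm_eq_abs, sq_abs,
        Real.sq_sqrt (hl k)]
    rw [h2] at h1
    simp only [norm_mul, hθ1, one_mul]
    exact_mod_cast h1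
  refine mem_iidErrorModel_of_uniform (fun m a => θ m * ∑ k, y m k * V a k) hφ1 (fun m => ?_) hβ
    fun a b => ?_
  -- Both vectors are normalised, so the squared distance is 2 - 2 Re of the overlap, at most 16a.
  · have h1 : ∀ z : ℂ, ∀ r : ℝ, ‖z - r‖ ^ 2 = ‖z‖ ^ 2 + r ^ 2 - 2 * (r * z.re) := by
      intro z r
      rw [Complex.sq_norm, Complex.sq_norm, Complex.normSq_apply, Complex.normSq_apply]
      simp only [Complex.sub_re, Complex.sub_im, Complex.ofReal_re, Complex.ofReal_im]
      ring
    simp only [h1, Finset.sum_sub_distrib, Finset.sum_add_distrib, hφ1, hx2, ← Finset.mul_sum]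
    have h2 : ∑ a, x a * (θ m * ∑ k, y m k * V a k).re =
        (θ m * ∑ k, sgn (m k) * ((√(lam k) : ℝ) : ℂ) * w k).re := by
      have e : θ m * ∑ k, sgn (m k) * ((√(lam k) : ℝ) : ℂ) * w k =
          ∑ a, (x a : ℂ) * (θ m * ∑ k, y m k * V a k) := by
        simp only [hw, y, Finset.mul_sum]
        rw [Finset.sum_comm]
        refine Finset.sum_congr rfl fun a _ => Finset.sum_congr rfl fun k _ => ?_
        ring
      rw [e, Complex.re_sum]
      exact Finset.sum_congr rfl fun a _ => (Complex.re_ofReal_mul _ _).symm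
    rw [h2]
    have := hθ2 m
    linarith
  -- The phases cancel in the projector, and averaging over the signs removes the terms with k ≠ l.
  -- What remains is the spectral decomposition of ρ.
  · have h1 : ∀ m, θ m * (∑ k, y m k * V a k) * (starRingEnd ℂ) (θ m * ∑ k, y m k * V b k) =
        ∑ k, ∑ l, sgn (m k) * sgn (m l) *
          (((√(lam k) : ℝ) : ℂ) * V a k * (((√(lam l) : ℝ) : ℂ) * (starRingEnd ℂ) (V b l))) := by
      intro m
      have e : θ m * (∑ k, y m k * V a k) * (starRingEnd ℂ) (θ m * ∑ k, y m k * V b k) =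
          (θ m * (starRingEnd ℂ) (θ m)) *
            ((∑ k, y m k * V a k) * (starRingEnd ℂ) (∑ k, y m k * V b k)) := by
        rw [map_mul]; ring
      rw [e, hconj, one_mul, map_sum, Finset.sum_mul_sum]
      refine Finset.sum_congr rfl fun k _ => Finset.sum_congr rfl fun l _ => ?_
      simp only [y, map_mul, hsg, Complex.conj_ofReal]
      ring
    simp only [h1]
    rw [Finset.sum_comm]
    simp only [Finset.sum_comm (s := (Finset.univ : Finset ((Fin n → Bool) → Bool))),
      ← Finset.sum_mul, sum_sgn_mul, ite_mul, zero_mul, Finset.sum_ite_eq, Finset.mem_univ, if_true]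
    rw [hs, Finset.mul_sum]
    refine Finset.sum_congr rfl fun k _ => ?_
    rw [← hsq]
    ring

end Iid

/-! ### Gradient descent -/

section Descent

variable {n p b : ℕ}

lemma exists_attempts {a : ℝ} (ha : 0 < a) (ha1 : a ≤ 1) :
    ∃ r : ℕ, (1 - a / 80) ^ r ≤ a ∧ (∀ j < r, a < (1 - a / 80) ^ j) ∧
      ∑ j ∈ Finset.range r, (((1 - a / 80) ^ j) ^ 2)⁻¹ ≤ 80 / a ^ 3 := by
  set l := 1 - a / 80 with hl
  have hl0 : 0 < l := by linarith
  have hl1 : l < 1 := by linarith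
  have hex : ∃ r : ℕ, l ^ r ≤ a := (exists_pow_lt_of_lt_one ha hl1).imp fun r hr => hr.le
  classical
  have hmin : ∀ j < Nat.find hex, a < l ^ j := fun j hj => not_le.1 (Nat.find_min hex hj)
  refine ⟨Nat.find hex, Nat.find_spec hex, hmin, ?_⟩
  -- The sum is dominated by its last term over 1 - l = a/80. The induction step only needs l² + (1
  -- - l) ≤ 1.
  have key : ∀ r : ℕ, (1 - l) * ∑ j ∈ Finset.range (r + 1), ((l ^ j) ^ 2)⁻¹ ≤
      ((l ^ r) ^ 2)⁻¹ := by
    intro r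
    induction r with
    | zero => simp; linarith
    | succ r ih =>
      rw [Finset.sum_range_succ, mul_add]
      have h0 : 0 < l ^ r := pow_pos hl0 r
      have e : ((l ^ r) ^ 2)⁻¹ = l ^ 2 * ((l ^ (r + 1)) ^ 2)⁻¹ := by
        field_simp
        ring
      rw [e] at ih
      have h1 : 0 ≤ ((l ^ (r + 1)) ^ 2)⁻¹ := by positivity
      have h2 : l ^ 2 + (1 - l) ≤ 1 := by nlinarith
      have := mul_le_mul_of_nonneg_right h2 h1
      linarith
  rcases hr : Nat.find hex with _ | r
  · simp
    positivity
  · have h1 := key r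
    have h2 : a < l ^ r := hmin r (by omega)
    have h3 : ((l ^ r) ^ 2)⁻¹ ≤ (a ^ 2)⁻¹ := by gcongr
    have h4 : a / 80 * ∑ j ∈ Finset.range (r + 1), ((l ^ j) ^ 2)⁻¹ ≤ (a ^ 2)⁻¹ := by
      have e : a / 80 = 1 - l := by rw [hl]; ring
      rw [e]
      exact h1.trans h3
    have h5 : 80 / a ^ 3 = (a / 80)⁻¹ * (a ^ 2)⁻¹ := by field_simp
    rw [h5, ← div_le_iff₀' (by positivity)]
    rw [div_inv_eq_mul, mul_comm]
    exact h4

lemma trace_zeroState (K : Type) [Fintype K] [DecidableEq K] : (zeroState K).trace = 1 := by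
  rw [Matrix.trace, Finset.sum_eq_single fun _ => false]
  · simp [zeroState]
  · intro x _ hx
    have : ¬ ∀ q, x q = false := fun h => hx (funext h)
    simp [zeroState, this]
  · simp

lemma traceNorm_zero {ι : Type} [Fintype ι] [DecidableEq ι] :
    traceNorm (0 : Matrix ι ι ℂ) = 0 := by
  refine le_antisymm ?_ (traceNorm_nonneg _)
  simpa using traceNorm_smul_le 0 (0 : Matrix ι ι ℂ)

/-- A replacing circuit with normalised output succeeds with probability 1, so the conditional state
is the output itself. -/
lemma Circuit.Replaces.prepares {Z : Circuit n p b (Fin n)} {O : Oracles n p b} {x₀ x : Vec n}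
    {ω : Op (Fin n)} {δ : ℝ} (h : Z.Replaces O (pureState x₀) ω) (hω : IsDensity ω)
    (hδ : traceNorm (ω - pureState x) ≤ 2 * δ) : Z.Prepares O x₀ x δ := by
  have h1 := h (zeroState (Fin n))
  rw [trace_zeroState, one_smul] at h1
  unfold Circuit.Prepares
  simp only [h1, hω.2, inv_one, one_smul, Complex.one_re, traceDist]
  constructor <;> linarith

/-- `T` steps of gradient descent, if `a t` is the accuracy of `x^(t)` and `r t` is the number of
attempts at step `t`. -/
theorem exists_descentCircuit {s T χ : ℕ} {c₀ δ L : ℝ} {η ΛD : ℕ → ℝ}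
    (hsch : Schedule n p s T c₀ δ η ΛD) (S : SimMethod n p b) (hL : 0 ≤ L) (a : ℕ → ℝ)
    (ha : ∀ t ≤ T, 0 < a t) (haL : ∀ t < T, 16 * (29 / 2 + 2 * L) * a t ≤ 1)
    (has : ∀ t < T, (8 * (29 / 2 + 2 * L) + 1) * a t ≤ a (t + 1)) (haT : a T ≤ δ)
    (r : ℕ → ℕ) (hr : ∀ t < T, (1 - a t / 80) ^ r t ≤ a t) {m g : ℝ} (hm0 : 0 ≤ m)
    (hm : ∀ t < T, 1 + ∑ j ∈ Finset.range (r t),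
      (1 + ((S t (stepTime (ΛD t) (a t)) (stepAcc (a t) j)).prog.copies : ℝ) +
        (S t (-stepTime (ΛD t) (a t)) (stepAcc (a t) j)).prog.copies) ≤ m)
    (hg : ∀ t < T, ∑ j ∈ Finset.range (r t),
      (4 + ((S t (stepTime (ΛD t) (a t)) (stepAcc (a t) j)).prog.gates : ℝ) +
        (S t (-stepTime (ΛD t) (a t)) (stepAcc (a t) j)).prog.gates) ≤ g) :
    ∃ Z : Circuit n p b (Fin n), (Z.prog.copies : ℝ) ≤ m ^ T ∧
      (Z.prog.gates : ℝ) ≤ g * ∑ i ∈ Finset.range T, m ^ i ∧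
      ∀ (A : Matrix (Idx n p) (Idx n p) ℝ) (x₀ : Vec n) (O : Oracles n p b),
        Problem s T χ η ΛD A x₀ O →
        (∀ t < T, ‖trajectory A x₀ η t‖ = 1 → SimulatesGradient (S t) O A (trajectory A x₀ η t) L
          (encodings (trajectory A x₀ η t) (a t))) →
        Z.Prepares O x₀ (trajectory A x₀ η T) δ := by
  -- The circuit is constructed before the problem instance is quantified, so it is independent of
  -- `A` and `x₀`. The induction carries the stronger `Replaces`, which is what allows substitution
  -- into the next step.
  suffices H : ∀ t ≤ T, ∃ Z : Circuit n p b (Fin n), (Z.prog.copies : ℝ) ≤ m ^ t ∧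
      (Z.prog.gates : ℝ) ≤ g * ∑ i ∈ Finset.range t, m ^ i ∧
      ∀ (A : Matrix (Idx n p) (Idx n p) ℝ) (x₀ : Vec n) (O : Oracles n p b),
        Problem s T χ η ΛD A x₀ O →
        (∀ t < T, ‖trajectory A x₀ η t‖ = 1 → SimulatesGradient (S t) O A (trajectory A x₀ η t) L
          (encodings (trajectory A x₀ η t) (a t))) →
        ‖trajectory A x₀ η t‖ = 1 ∧ ∃ ω, Z.Replaces O (pureState x₀) ω ∧ IsDensity ω ∧
          traceNorm (ω - pureState (trajectory A x₀ η t)) ≤ 2 * a t by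
    obtain ⟨Z, h1, h2, h3⟩ := H T le_rfl
    refine ⟨Z, h1, h2, fun A x₀ O hP hS => ?_⟩
    obtain ⟨-, ω, h4, h5, h6⟩ := h3 A x₀ O hP hS
    exact h4.prepares h5 (by linarith)
  intro t
  induction t with
  | zero =>
    refine fun h0 => ⟨copyCircuit, by simp [copies_copyCircuit], by simp [gates_copyCircuit],
      fun A x₀ O hP _ => ⟨hP.init, pureState x₀, copyCircuit_replaces O _,
        isDensity_pureState hP.init, ?_⟩⟩
    change traceNorm (pureState x₀ - pureState x₀) ≤ _
    rw [sub_self, traceNorm_zero]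
    have := ha 0 h0
    linarith
  | succ t ih =>
    intro ht
    obtain ⟨Z, h1, h2, h3⟩ := ih (by omega)
    have htT : t < T := ht
    have hat := ha t htT.le
    have hΛ := hsch.ΛD_ge t htT
    have hη := hsch.η_pos t htT
    have hηΛ : η t * ΛD t ≤ 1 / 2 := by
      have h4 := hsch.η_lt t htT
      rw [lt_div_iff₀ (by positivity)] at h4
      linarith
    have hph := norm_stepPhase (η := η t) (by linarith : 0 < ΛD t) hat
    obtain ⟨X, x1, x2, x3⟩ := Circuit.exists_subst Z (stepCircuit (S t) hph (r t))
    have hmt : ((stepCircuit (S t) hph (r t)).prog.copies : ℝ) ≤ m :=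
      le_trans (by exact_mod_cast copies_stepCircuit (S t) hph (r t)) (hm t htT)
    have hgt : ((stepCircuit (S t) hph (r t)).prog.gates : ℝ) ≤ g :=
      le_trans (by exact_mod_cast gates_stepCircuit (S t) hph (r t)) (hg t htT)
    refine ⟨X, ?_, ?_, fun A x₀ O hP hS => ?_⟩
    · calc (X.prog.copies : ℝ) ≤ (stepCircuit (S t) hph (r t)).prog.copies * Z.prog.copies := by
            exact_mod_cast x1
        _ ≤ m * m ^ t := by gcongr
        _ = m ^ (t + 1) := by ring
    · calc (X.prog.gates : ℝ) ≤ (stepCircuit (S t) hph (r t)).prog.gates +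
            (stepCircuit (S t) hph (r t)).prog.copies * Z.prog.gates := by exact_mod_cast x2
        _ ≤ g + m * (g * ∑ i ∈ Finset.range t, m ^ i) := by gcongr
        _ = g * ∑ i ∈ Finset.range (t + 1), m ^ i := by
            rw [Finset.sum_range_succ']
            simp only [pow_succ, ← Finset.sum_mul]
            ring
    · obtain ⟨hx, ω, w1, w2, w3⟩ := h3 A x₀ O hP hS
      have hnorm := hP.norm_le t htT
      have hw : traceDist ω (pureState (trajectory A x₀ η t)) ≤ a t := by
        rw [traceDist]; linarith
      obtain ⟨D, hD, hDx, hsim⟩ := hS t htT hx ω ⟨w2, hw⟩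
      have hu := (norm_descentVec A hP.symm hx hη.le hηΛ hnorm).1
      refine ⟨norm_descentStep (by linarith), ?_⟩
      obtain ⟨ω', v1, v2, v3⟩ := stepCircuit_spec hP.symm hx hΛ hη hηΛ hat hL (haL t htT) hnorm w2
        w3 hD (hDx.trans (by gcongr)) hsim hph (r t)
      refine ⟨ω', fun σ => ?_, v2, ?_⟩
      · rw [x3 O _ ω w1, v1]
      · have := has t htT
        have := hr t htT
        change traceNorm (ω' - pureState (descentStep A (η t) (trajectory A x₀ η t))) ≤ _
        linarith

end Descent

/-! ### Resource bounds -/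

section Resources

lemma polyVal_eq {m : ℕ} (P : MvPolynomial (Fin m) ℕ) (v : Fin m → ℝ) :
    polyVal P v = ∑ d ∈ P.support, ((P.coeff d : ℕ) : ℝ) * ∏ i, v i ^ d i := by
  rw [polyVal, MvPolynomial.aeval_def, MvPolynomial.eval₂_eq']
  rfl

lemma polyVal_nonneg {m : ℕ} (P : MvPolynomial (Fin m) ℕ) {v : Fin m → ℝ} (hv : ∀ i, 0 ≤ v i) :
    0 ≤ polyVal P v := by
  rw [polyVal_eq]
  exact Finset.sum_nonneg fun d _ =>
    mul_nonneg (Nat.cast_nonneg _) (Finset.prod_nonneg fun i _ => pow_nonneg (hv i) _)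

/-- Nonnegative coefficients make the polynomial monotone on nonnegative arguments, and scaling all
arguments by c ≥ 1 costs at most c to the total degree. Constants depending on T thus move out of
the polynomial. -/
lemma polyVal_le {m : ℕ} (P : MvPolynomial (Fin m) ℕ) {v w : Fin m → ℝ} {c : ℝ} (hc : 1 ≤ c)
    (hv : ∀ i, 0 ≤ v i) (hw : ∀ i, 0 ≤ w i) (hvw : ∀ i, v i ≤ c * w i) :
    polyVal P v ≤ c ^ P.totalDegree * polyVal P w := by
  rw [polyVal_eq, polyVal_eq, Finset.mul_sum]
  refine Finset.sum_le_sum fun d hd => ?_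
  have h0 : 0 ≤ ∏ i, w i ^ d i := Finset.prod_nonneg fun i _ => pow_nonneg (hw i) _
  have h1 : ∏ i, v i ^ d i ≤ ∏ i, (c * w i) ^ d i :=
    Finset.prod_le_prod (fun i _ => pow_nonneg (hv i) _)
      fun i _ => pow_le_pow_left₀ (hv i) (hvw i) _
  have h2 : ∑ i, d i ≤ P.totalDegree := by
    have := MvPolynomial.le_totalDegree hd
    rwa [Finsupp.sum_fintype _ _ fun _ => rfl] at this
  have h3 : ∏ i, (c * w i) ^ d i ≤ c ^ P.totalDegree * ∏ i, w i ^ d i := by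
    simp only [mul_pow, Finset.prod_mul_distrib, Finset.prod_pow_eq_pow_sum]
    exact mul_le_mul_of_nonneg_right (pow_le_pow_right₀ hc h2) h0
  calc ((P.coeff d : ℕ) : ℝ) * ∏ i, v i ^ d i
      ≤ ((P.coeff d : ℕ) : ℝ) * (c ^ P.totalDegree * ∏ i, w i ^ d i) := by
        gcongr
        exact h1.trans h3
    _ = _ := by ring

/-- The base of the exponential resource bound for polynomial simulation methods. -/
def basePoly (P : MvPolynomial (Fin 5) ℕ) (G : MvPolynomial (Fin 3) ℕ) :
    MvPolynomial (Fin 4) ℕ :=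
  (1 + MvPolynomial.bind₁ ![.X 0, .X 1, .X 2, 1, .X 3 ^ 2] P) *
    (1 + MvPolynomial.bind₁ ![.X 0, .X 1, .X 2] G) * .X 3 ^ 3

lemma polyVal_basePoly (P : MvPolynomial (Fin 5) ℕ) (G : MvPolynomial (Fin 3) ℕ) (w x y z : ℝ) :
    polyVal (basePoly P G) ![w, x, y, z] =
      (1 + polyVal P ![w, x, y, 1, z ^ 2]) * (1 + polyVal G ![w, x, y]) * z ^ 3 := by
  have h1 : (fun i => MvPolynomial.aeval ![w, x, y, z]
      ((![.X 0, .X 1, .X 2, 1, .X 3 ^ 2] : Fin 5 → MvPolynomial (Fin 4) ℕ) i)) =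
      ![w, x, y, 1, z ^ 2] := by
    funext i
    fin_cases i <;> simp
  have h2 : (fun i => MvPolynomial.aeval ![w, x, y, z]
      ((![.X 0, .X 1, .X 2] : Fin 3 → MvPolynomial (Fin 4) ℕ) i)) = ![w, x, y] := by
    funext i
    fin_cases i <;> simp
  simp only [polyVal, basePoly, map_mul, map_add, map_one, map_pow, MvPolynomial.aeval_bind₁, h1,
    h2, MvPolynomial.aeval_X]
  rfl

lemma one_le_log {Y : ℝ} (hY : 1 ≤ Y) : 1 ≤ Real.log (2 + Y) := by
  rw [Real.le_log_iff_exp_le (by linarith)]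
  have := Real.exp_one_lt_d9
  linarith

lemma log_add_mul_le {κ Y : ℝ} (hκ : 1 ≤ κ) (hY : 1 ≤ Y) :
    Real.log (2 + κ * Y) ≤ (1 + Real.log κ) * Real.log (2 + Y) := by
  have h1 : Real.log (2 + κ * Y) ≤ Real.log (κ * (2 + Y)) :=
    Real.log_le_log (by positivity) (by nlinarith)
  rw [Real.log_mul (by positivity) (by positivity)] at h1
  have h2 := one_le_log hY
  have h3 := Real.log_nonneg hκ
  nlinarith

lemma softO_le_abs {c : ℝ} {k : ℕ} {Y Y' : ℝ} (hY : 0 ≤ Y) (hYY : Y ≤ Y') :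
    softO c k Y ≤ |c| * Y * Real.log (2 + Y') ^ k := by
  have h0 : 0 ≤ Real.log (2 + Y) := Real.log_nonneg (by linarith)
  have h1 : Real.log (2 + Y) ≤ Real.log (2 + Y') := Real.log_le_log (by linarith) (by linarith)
  unfold softO
  have := le_abs_self c
  gcongr

lemma softO_mono {C C' : ℝ} {k : ℕ} {Y : ℝ} (hC : C ≤ C') (hY : 0 ≤ Y) :
    softO C k Y ≤ softO C' k Y := by
  unfold softO
  have : 0 ≤ Real.log (2 + Y) ^ k := pow_nonneg (Real.log_nonneg (by linarith)) _
  gcongr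

/-- For T ≥ 1 each power of m is at most (κB)^(T-1), and the factor B inside g supplies the missing
power. Since N occurs only in g, it enters the final bound once. -/
lemma mul_geom_sum_le_softO {κ B N m g : ℝ} {k T : ℕ} (hκ : 1 ≤ κ) (hB : 1 ≤ B) (hN : 1 ≤ N)
    (hm0 : 0 ≤ m) (hm : m ≤ κ * B)
    (hg : g ≤ κ * (B * N) * Real.log (2 + κ * (B * N)) ^ k) :
    g * ∑ i ∈ Finset.range T, m ^ i ≤
      softO (T * κ ^ T * (1 + Real.log κ) ^ k) k (B ^ T * N) := by
  rcases T with _ | T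
  · simp [softO]
  have h1 : ∑ i ∈ Finset.range (T + 1), m ^ i ≤ (T + 1 : ℕ) * (κ * B) ^ T := by
    rw [← nsmul_eq_mul]
    refine (Finset.sum_le_card_nsmul _ _ ((κ * B) ^ T) fun i hi => ?_).trans (by simp)
    have hκB : 1 ≤ κ * B := by nlinarith
    exact (pow_le_pow_left₀ hm0 hm i).trans
      (pow_le_pow_right₀ hκB (Nat.lt_succ_iff.1 (Finset.mem_range.1 hi)))
  have hBN : 1 ≤ B * N := by nlinarith
  have hBT : B * N ≤ B ^ (T + 1) * N := by
    have : B ^ 1 ≤ B ^ (T + 1) := pow_le_pow_right₀ hB (by omega)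
    rw [pow_one] at this
    gcongr
  have h2 : Real.log (2 + κ * (B * N)) ≤ (1 + Real.log κ) * Real.log (2 + B ^ (T + 1) * N) := by
    refine (Real.log_le_log (by positivity) ?_).trans (log_add_mul_le hκ (hBN.trans hBT))
    gcongr
  have h3 : 0 ≤ Real.log (2 + κ * (B * N)) := Real.log_nonneg (by nlinarith)
  have h4 : 0 ≤ (1 + Real.log κ) * Real.log (2 + B ^ (T + 1) * N) := h3.trans h2
  calc g * ∑ i ∈ Finset.range (T + 1), m ^ i
      ≤ (κ * (B * N) * Real.log (2 + κ * (B * N)) ^ k) * ∑ i ∈ Finset.range (T + 1), m ^ i := by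
        gcongr
    _ ≤ (κ * (B * N) * ((1 + Real.log κ) * Real.log (2 + B ^ (T + 1) * N)) ^ k) *
          ((T + 1 : ℕ) * (κ * B) ^ T) := by
        gcongr
    _ = _ := by
        rw [softO, mul_pow, mul_pow, pow_succ κ, pow_succ B]
        ring

/-- Accuracies `a t` for the intermediate states. -/
lemma exists_accuracies {L M : ℝ} (hL : 0 ≤ L) (hM : 16 * (29 / 2 + 2 * L) ≤ M) (T : ℕ) :
    ∃ κ : ℝ, 1 ≤ κ ∧ ∀ δ : ℝ, 0 < δ → δ ≤ 1 → ∃ a : ℕ → ℝ, (∀ t, 0 < a t) ∧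
      (∀ t, (8 * (29 / 2 + 2 * L) + 1) * a t ≤ a (t + 1)) ∧
      ∀ t ≤ T, δ ≤ κ * a t ∧ M * a t ≤ δ := by
  set C := 8 * (29 / 2 + 2 * L) + 1 with hC
  have hC1 : 1 ≤ C := by linarith
  have hM1 : 1 ≤ M := by linarith
  have hCT : ∀ t, 1 ≤ C ^ t := fun t => one_le_pow₀ hC1
  -- The last accuracy is δ/M, and each earlier one is smaller by the factor C by which a step
  -- amplifies the error.
  refine ⟨M * C ^ T, by nlinarith [hCT T], fun δ hδ _ => ⟨fun t => δ * C ^ t / (M * C ^ T),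
    fun t => by positivity, fun t => le_of_eq ?_, fun t ht => ⟨?_, ?_⟩⟩⟩
  · change C * (δ * C ^ t / (M * C ^ T)) = δ * C ^ (t + 1) / (M * C ^ T)
    rw [pow_succ]
    ring
  · rw [mul_div_cancel₀ _ (by positivity)]
    exact le_mul_of_one_le_right hδ.le (hCT t)
  · have h1 : C ^ t ≤ C ^ T := pow_le_pow_right₀ hC1 ht
    have e : M * (δ * C ^ t / (M * C ^ T)) = δ * (C ^ t / C ^ T) := by field_simp
    change M * (δ * C ^ t / (M * C ^ T)) ≤ δ
    rw [e]
    exact mul_le_of_le_one_right hδ.le (div_le_one_of_le₀ h1 (by positivity))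

lemma le_maxNorm {T t : ℕ} (ΛD : ℕ → ℝ) (ht : t < T) : ΛD t ≤ maxNorm T ΛD :=
  le_ciSup (f := fun t : Fin T => ΛD t) (Set.finite_range _).bddAbove ⟨t, ht⟩

lemma stepAcc_pos {a : ℝ} (ha : 0 < a) (ha1 : a ≤ 1) (j : ℕ) : 0 < stepAcc a j := by
  have : 0 < 1 - a / 80 := by linarith
  unfold stepAcc
  positivity

lemma stepAcc_lt_one {a : ℝ} (ha : 0 < a) (ha1 : a ≤ 1) (j : ℕ) : stepAcc a j < 1 := by
  have : (1 - a / 80) ^ j ≤ 1 := pow_le_one₀ (by linarith) (by linarith)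
  unfold stepAcc
  nlinarith

lemma stepTime_le_one {Λ a : ℝ} (hΛ : 1 ≤ Λ) (ha1 : a ≤ 1) : stepTime Λ a ≤ 1 := by
  rw [stepTime, div_le_one (by positivity)]
  have := Real.sqrt_le_one.2 ha1
  linarith

lemma one_div_stepAcc_le {a : ℝ} (ha : 0 < a) {j : ℕ} (hj : a < (1 - a / 80) ^ j) :
    1 / stepAcc a j ≤ 640 * (1 / a) ^ 2 := by
  have h1 : a * a / 640 ≤ stepAcc a j := by
    unfold stepAcc
    gcongr
  refine (one_div_le_one_div_of_le (by positivity) h1).trans (le_of_eq ?_)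
  field_simp

lemma card_attempts_le {a : ℝ} (ha : 0 < a) (ha1 : a ≤ 1) {r : ℕ}
    (h : ∑ j ∈ Finset.range r, (((1 - a / 80) ^ j) ^ 2)⁻¹ ≤ 80 / a ^ 3) :
    (r : ℝ) ≤ 80 * (1 / a) ^ 3 := by
  have h1 : (r : ℝ) ≤ ∑ j ∈ Finset.range r, (((1 - a / 80) ^ j) ^ 2)⁻¹ := by
    have h0 : 0 < 1 - a / 80 := by linarith
    have := Finset.card_nsmul_le_sum (Finset.range r)
      (fun j => (((1 - a / 80) ^ j) ^ 2)⁻¹) 1 fun j _ => by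
        refine one_le_inv₀ (by positivity) |>.2 ?_
        exact pow_le_one₀ (by positivity) (pow_le_one₀ h0.le (by linarith))
    simpa using this
  refine (h1.trans h).trans (le_of_eq ?_)
  field_simp

variable {n p b : ℕ}

/-- The resources of a step with a simulation method of polynomial cost. -/
lemma step_cost_polynomial (P : MvPolynomial (Fin 5) ℕ) (G : MvPolynomial (Fin 3) ℕ) (c : ℝ) (k : ℕ)
    {κ : ℝ} (hκ : 1 ≤ κ) : ∃ κ' : ℝ, 1 ≤ κ' ∧ ∀ (n p s b : ℕ) (δ Λt Λ a : ℝ), 1 ≤ n → 0 < δ → δ ≤ 1 →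
      1 ≤ Λt → Λt ≤ Λ → 0 < a → a ≤ 1 → δ ≤ κ * a → ∀ S : ℝ → ℝ → Circuit n p b (Option (Fin n)),
      (∀ τ ε : ℝ, 0 < ε → ε < 1 →
        ((S τ ε).prog.copies : ℝ) ≤ polyVal P ![p, s, Λt, |τ|, 1 / ε] ∧
        ((S τ ε).prog.gates : ℝ) ≤ polyVal P ![p, s, Λt, |τ|, 1 / ε] *
          softO c k (polyVal G ![p, s, Λt] * n)) → ∀ r : ℕ,
      (∀ j < r, a < (1 - a / 80) ^ j) →
      ∑ j ∈ Finset.range r, (((1 - a / 80) ^ j) ^ 2)⁻¹ ≤ 80 / a ^ 3 →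
      1 + ∑ j ∈ Finset.range r, (1 + ((S (stepTime Λt a) (stepAcc a j)).prog.copies : ℝ) +
        (S (-stepTime Λt a) (stepAcc a j)).prog.copies) ≤
          κ' * polyVal (basePoly P G) ![p, s, Λ, 1 / δ] ∧
      ∑ j ∈ Finset.range r, (4 + ((S (stepTime Λt a) (stepAcc a j)).prog.gates : ℝ) +
        (S (-stepTime Λt a) (stepAcc a j)).prog.gates) ≤
          κ' * (polyVal (basePoly P G) ![p, s, Λ, 1 / δ] * n) *
            Real.log (2 + κ' * (polyVal (basePoly P G) ![p, s, Λ, 1 / δ] * n)) ^ k := by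
  set q : ℝ := (640 * κ ^ 2) ^ P.totalDegree with hq
  have hκ2 : 1 ≤ 640 * κ ^ 2 := by nlinarith
  have hq1 : 1 ≤ q := one_le_pow₀ hκ2
  -- The factor 80κ³ comes from the number of trials, and the bracket from the cost of one trial
  -- with its two simulations. The absolute value is needed because the sign of `c` is arbitrary.
  refine ⟨1 + 80 * κ ^ 3 * (4 + 2 * q * (1 + |c|)), ?_, ?_⟩
  · have : 0 ≤ 80 * κ ^ 3 * (4 + 2 * q * (1 + |c|)) := by positivity
    linarith
  intro n p s b δ Λt Λ a hn hδ hδ1 hΛt hΛ ha ha1 hδa S hS r hr1 hr2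
  have hn1 : (1 : ℝ) ≤ n := by exact_mod_cast hn
  have ha' : 1 / a ≤ κ * (1 / δ) := by
    rw [mul_one_div, div_le_div_iff₀ ha hδ]
    linarith
  have hz : 1 ≤ 1 / δ := by rwa [le_div_iff₀ hδ, one_mul]
  set z := 1 / δ with hzdef
  have hv : ∀ i, 0 ≤ (![(p : ℝ), s, Λ, 1, z ^ 2] : Fin 5 → ℝ) i := by
    have := sq_nonneg z
    intro i; fin_cases i <;> simp <;> linarith
  have hG : polyVal G ![p, s, Λt] ≤ polyVal G ![p, s, Λ] := by
    have := polyVal_le G (v := ![p, s, Λt]) (w := ![p, s, Λ]) (c := 1) le_rfl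
      (by intro i; fin_cases i <;> simp <;> linarith) (by intro i; fin_cases i <;> simp <;> linarith)
      (by intro i; fin_cases i <;> simp <;> linarith)
    simpa using this
  have hG0 : 0 ≤ polyVal G ![p, s, Λt] :=
    polyVal_nonneg G (by intro i; fin_cases i <;> simp <;> linarith)
  have hP0 : 0 ≤ polyVal P ![p, s, Λ, 1, z ^ 2] := polyVal_nonneg P (hv)
  -- Times are at most 1 and inverse accuracies at most a constant times δ⁻², so the last two
  -- arguments of `P` become 1 and z², as in `basePoly`.
  have hP : ∀ τ : ℝ, |τ| ≤ 1 → ∀ j < r, polyVal P ![p, s, Λt, |τ|, 1 / stepAcc a j] ≤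
      q * polyVal P ![p, s, Λ, 1, z ^ 2] := by
    intro τ hτ j hj
    have hacc := stepAcc_pos ha ha1 j
    have h1 := one_div_stepAcc_le ha (hr1 j hj)
    have h2 : 640 * (1 / a) ^ 2 ≤ 640 * κ ^ 2 * z ^ 2 := by
      calc 640 * (1 / a) ^ 2 ≤ 640 * (κ * z) ^ 2 := by gcongr
        _ = _ := by ring
    have hle : ∀ y y' : ℝ, 0 ≤ y' → y ≤ y' → y ≤ 640 * κ ^ 2 * y' := fun y y' h0 h => by nlinarith
    refine polyVal_le P hκ2 ?_ (hv) ?_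
    · intro i; fin_cases i <;> simp <;> linarith
    · intro i
      fin_cases i
      · exact hle _ _ (Nat.cast_nonneg _) le_rfl
      · exact hle _ _ (Nat.cast_nonneg _) le_rfl
      · exact hle _ _ (by simp; linarith) hΛ
      · exact hle _ _ zero_le_one hτ
      · exact h1.trans h2
  have hτ : |stepTime Λt a| ≤ 1 := by
    rw [abs_of_pos (stepTime_pos (by linarith) ha)]
    exact stepTime_le_one hΛt ha1
  have hτ' : |-stepTime Λt a| ≤ 1 := by rwa [abs_neg]
  have hr3 : (r : ℝ) ≤ 80 * κ ^ 3 * z ^ 3 := by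
    calc (r : ℝ) ≤ 80 * (1 / a) ^ 3 := card_attempts_le ha ha1 hr2
      _ ≤ 80 * (κ * z) ^ 3 := by gcongr
      _ = _ := by ring
  rw [polyVal_basePoly]
  set Pv := polyVal P ![p, s, Λ, 1, z ^ 2]
  set Gv := polyVal G ![p, s, Λ]
  have hGv : 0 ≤ Gv := hG0.trans hG
  have hB1 : 1 ≤ (1 + Pv) * (1 + Gv) * z ^ 3 := by
    have : 1 ≤ z ^ 3 := one_le_pow₀ hz
    exact one_le_mul_of_one_le_of_one_le
      (one_le_mul_of_one_le_of_one_le (by linarith) (by linarith)) this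
  constructor
  · have h1 : ∀ j ∈ Finset.range r, 1 + ((S (stepTime Λt a) (stepAcc a j)).prog.copies : ℝ) +
        (S (-stepTime Λt a) (stepAcc a j)).prog.copies ≤ (4 + 2 * q * (1 + |c|)) * ((1 + Pv) * (1 + Gv)) := by
      intro j hj
      have hj' := Finset.mem_range.1 hj
      have e1 := ((hS (stepTime Λt a) _ (stepAcc_pos ha ha1 j) (stepAcc_lt_one ha ha1 j)).1).trans
        (hP _ hτ j hj')
      have e2 := ((hS (-stepTime Λt a) _ (stepAcc_pos ha ha1 j) (stepAcc_lt_one ha ha1 j)).1).trans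
        (hP _ hτ' j hj')
      have e3 : 1 + 2 * q * Pv ≤ (4 + 2 * q * (1 + |c|)) * ((1 + Pv) * (1 + Gv)) := by
        have e4 : Pv ≤ (1 + Pv) * (1 + Gv) := by nlinarith
        have e5 : 1 ≤ (1 + Pv) * (1 + Gv) := by nlinarith
        have e6 : q * Pv ≤ q * ((1 + Pv) * (1 + Gv)) := by gcongr
        have e7 : 0 ≤ 2 * q * |c| * ((1 + Pv) * (1 + Gv)) := by positivity
        nlinarith
      linarith
    have h2 := Finset.sum_le_card_nsmul _ _ _ h1
    rw [Finset.card_range, nsmul_eq_mul] at h2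
    have h3 : (r : ℝ) * ((4 + 2 * q * (1 + |c|)) * ((1 + Pv) * (1 + Gv))) ≤
        80 * κ ^ 3 * z ^ 3 * ((4 + 2 * q * (1 + |c|)) * ((1 + Pv) * (1 + Gv))) := by
      gcongr
    linarith
  · set B := (1 + Pv) * (1 + Gv) * z ^ 3 with hB
    set κ' := 1 + 80 * κ ^ 3 * (4 + 2 * q * (1 + |c|)) with hκ'
    have hκ'1 : 1 ≤ κ' := by
      have : 0 ≤ 80 * κ ^ 3 * (4 + 2 * q * (1 + |c|)) := by positivity
      linarith
    have hY : polyVal G ![p, s, Λt] * n ≤ κ' * (B * n) := by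
      have e1 : Gv ≤ B := by
        have : 1 ≤ z ^ 3 := one_le_pow₀ hz
        have e4 : Gv ≤ (1 + Pv) * (1 + Gv) := by nlinarith
        have e5 : 0 ≤ (1 + Pv) * (1 + Gv) := by positivity
        rw [hB]
        nlinarith
      have e2 : B * n ≤ κ' * (B * n) := le_mul_of_one_le_left (by positivity) hκ'1
      have e3 : polyVal G ![p, s, Λt] * n ≤ B * n := by
        gcongr
        exact hG.trans e1
      exact e3.trans e2
    have hlog : 1 ≤ Real.log (2 + κ' * (B * n)) := by
      refine one_le_log ?_
      exact one_le_mul_of_one_le_of_one_le hκ'1 (one_le_mul_of_one_le_of_one_le hB1 hn1)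
    have hl1 : 1 ≤ Real.log (2 + κ' * (B * n)) ^ k := one_le_pow₀ hlog
    set l := Real.log (2 + κ' * (B * n)) ^ k
    have hso : softO c k (polyVal G ![p, s, Λt] * n) ≤ |c| * ((1 + Gv) * n) * l := by
      refine (softO_le_abs (by positivity) hY).trans ?_
      gcongr
      linarith
    have h1 : ∀ j ∈ Finset.range r, 4 + ((S (stepTime Λt a) (stepAcc a j)).prog.gates : ℝ) +
        (S (-stepTime Λt a) (stepAcc a j)).prog.gates ≤
          (4 + 2 * q * (1 + |c|)) * (((1 + Pv) * (1 + Gv)) * n * l) := by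
      intro j hj
      have hj' := Finset.mem_range.1 hj
      have e : ∀ τ : ℝ, |τ| ≤ 1 → ((S τ (stepAcc a j)).prog.gates : ℝ) ≤
          q * Pv * (|c| * ((1 + Gv) * n) * l) := fun τ hτ =>
        ((hS τ _ (stepAcc_pos ha ha1 j) (stepAcc_lt_one ha ha1 j)).2).trans
          ((mul_le_mul_of_nonneg_left hso (polyVal_nonneg P (by
            have := (stepAcc_pos ha ha1 j).le
            intro i; fin_cases i <;> simp <;> linarith))).trans
            (mul_le_mul_of_nonneg_right (hP _ hτ j hj') (by positivity)))
      have e1 := e _ hτ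
      have e2 := e _ hτ'
      have e3 : q * Pv * (|c| * ((1 + Gv) * n) * l) ≤ q * |c| * (((1 + Pv) * (1 + Gv)) * n * l) := by
        calc q * Pv * (|c| * ((1 + Gv) * n) * l) ≤ q * (1 + Pv) * (|c| * ((1 + Gv) * n) * l) := by
              gcongr
              linarith
          _ = _ := by ring
      have e4 : 1 ≤ ((1 + Pv) * (1 + Gv)) * n * l :=
        one_le_mul_of_one_le_of_one_le (one_le_mul_of_one_le_of_one_le
          (one_le_mul_of_one_le_of_one_le (by linarith) (by linarith)) hn1) hl1
      have e5 : 0 ≤ 2 * q * (((1 + Pv) * (1 + Gv)) * n * l) := by positivity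
      have e6 : (4 + 2 * q * (1 + |c|)) * (((1 + Pv) * (1 + Gv)) * n * l) =
          4 * (((1 + Pv) * (1 + Gv)) * n * l) + 2 * q * (((1 + Pv) * (1 + Gv)) * n * l) +
            2 * (q * |c| * (((1 + Pv) * (1 + Gv)) * n * l)) := by ring
      linarith
    have h2 := Finset.sum_le_card_nsmul _ _ _ h1
    rw [Finset.card_range, nsmul_eq_mul] at h2
    have h3 : (r : ℝ) * ((4 + 2 * q * (1 + |c|)) * (((1 + Pv) * (1 + Gv)) * n * l)) ≤
        80 * κ ^ 3 * z ^ 3 * ((4 + 2 * q * (1 + |c|)) * (((1 + Pv) * (1 + Gv)) * n * l)) := by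
      gcongr
    refine (h2.trans h3).trans ?_
    have e : 80 * κ ^ 3 * z ^ 3 * ((4 + 2 * q * (1 + |c|)) * (((1 + Pv) * (1 + Gv)) * n * l)) =
        (κ' - 1) * (B * n) * l := by
      rw [hκ', hB]
      ring
    rw [e]
    gcongr
    linarith

end Resources

/-! ### Cost of a step with the sample-based simulation -/

section SampleBased

/-- Here 25600 = 640²/16. The factor Λ⁻² offsets two powers of Λ in the simulation cost, and
summation over j contributes a further a⁻³, for a total of a⁻⁴. -/
lemma stepTime_sq_div_stepAcc_sq {Λ a : ℝ} (hΛ : 0 < Λ) (ha : 0 < a) (ha1 : a ≤ 1) (j : ℕ) :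
    stepTime Λ a ^ 2 / stepAcc a j ^ 2 =
      25600 * (1 / a) * (((1 - a / 80) ^ j) ^ 2)⁻¹ / Λ ^ 2 := by
  have h : (1 - a / 80) ^ j ≠ 0 := pow_ne_zero _ (by linarith)
  rw [stepTime_sq ha.le, stepAcc]
  field_simp
  norm_num

/-- The resources of a step with the sample-based simulation method. -/
lemma step_cost_sampleBased (c : ℝ) (k : ℕ) {κ : ℝ} (hκ : 1 ≤ κ) :
    ∃ κ' : ℝ, 1 ≤ κ' ∧ ∀ (n p s b : ℕ) (δ Λt Λ a : ℝ), 1 ≤ n → 1 ≤ p → 1 ≤ s → 0 < δ →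
      1 ≤ Λt → Λt ≤ Λ → 0 < a → a ≤ 1 → δ ≤ 1 → δ ≤ κ * a →
      ∀ S : ℝ → ℝ → Circuit n p b (Option (Fin n)),
      (∀ τ ε : ℝ, 0 < ε → ε < 1 →
        ((S τ ε).prog.copies : ℝ) ≤ c * max 1 ((p : ℝ) ^ 5 * Λt ^ 2 * τ ^ 2 / ε ^ 2) ∧
        ((S τ ε).prog.gates : ℝ) ≤
          softO c k (max 1 ((p : ℝ) ^ 5 * Λt ^ 3 * τ ^ 2 * s * n / ε ^ 2))) → ∀ r : ℕ,
      (∀ j < r, a < (1 - a / 80) ^ j) →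
      ∑ j ∈ Finset.range r, (((1 - a / 80) ^ j) ^ 2)⁻¹ ≤ 80 / a ^ 3 →
      1 + ∑ j ∈ Finset.range r, (1 + ((S (stepTime Λt a) (stepAcc a j)).prog.copies : ℝ) +
        (S (-stepTime Λt a) (stepAcc a j)).prog.copies) ≤ κ' * ((p : ℝ) ^ 5 * Λ ^ 2 / δ ^ 4) ∧
      ∑ j ∈ Finset.range r, (4 + ((S (stepTime Λt a) (stepAcc a j)).prog.gates : ℝ) +
        (S (-stepTime Λt a) (stepAcc a j)).prog.gates) ≤
          κ' * ((p : ℝ) ^ 5 * Λ ^ 3 * s / δ ^ 4 * n) *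
            Real.log (2 + κ' * ((p : ℝ) ^ 5 * Λ ^ 3 * s / δ ^ 4 * n)) ^ k := by
  have hκ'1 : 1 ≤ 1 + 80 * 25600 * κ ^ 4 * (4 + 2 * |c|) := by
    have : 0 ≤ 80 * 25600 * κ ^ 4 * (4 + 2 * |c|) := by positivity
    linarith
  -- The 80 is from the geometric sum over the trials, 25600 from τ²/ε², and κ⁴ from replacing a⁻⁴
  -- by δ⁻⁴.
  refine ⟨1 + 80 * 25600 * κ ^ 4 * (4 + 2 * |c|), hκ'1, ?_⟩
  intro n p s b δ Λt Λ a hn hp hs hδ hΛt hΛ ha ha1 hδ1 hδa S hS r hr1 hr2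
  have hn1 : (1 : ℝ) ≤ n := by exact_mod_cast hn
  have hp1 : (1 : ℝ) ≤ (p : ℝ) ^ 5 := one_le_pow₀ (by exact_mod_cast hp)
  have hs1 : (1 : ℝ) ≤ s := by exact_mod_cast hs
  have ha' : 1 / a ≤ κ * (1 / δ) := by
    rw [mul_one_div, div_le_div_iff₀ ha hδ]
    linarith
  have hu : 1 ≤ 1 / a := by rwa [le_div_iff₀ ha, one_mul]
  have hz : 1 ≤ 1 / δ := by rwa [le_div_iff₀ hδ, one_mul]
  have hdiv : ∀ y : ℝ, y / δ ^ 4 = y * (1 / δ) ^ 4 := fun y => by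
    rw [one_div, inv_pow, div_eq_mul_inv]
  have e80 : 80 / a ^ 3 = 80 * (1 / a) ^ 3 := by
    rw [one_div, inv_pow, div_eq_mul_inv]
  rw [hdiv, hdiv]
  rw [e80] at hr2
  have hεeq := stepTime_sq_div_stepAcc_sq (by linarith : 0 < Λt) ha ha1
  have hl0 : 0 < 1 - a / 80 := by linarith
  have hν : ∀ j, 1 ≤ (((1 - a / 80) ^ j) ^ 2)⁻¹ := fun j =>
    (one_le_inv₀ (by positivity)).2
      (pow_le_one₀ (by positivity) (pow_le_one₀ hl0.le (by linarith)))
  have hν2 : ∀ j < r, (((1 - a / 80) ^ j) ^ 2)⁻¹ ≤ (1 / a) ^ 2 := fun j hj => by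
    have := (hr1 j hj).le
    rw [one_div, inv_pow]
    gcongr
  have hacc := fun j => stepAcc_pos ha ha1 j
  have hacc1 := fun j => stepAcc_lt_one ha ha1 j
  generalize hνdef : (fun j => (((1 - a / 80) ^ j) ^ 2)⁻¹) = ν at *
  have hνj : ∀ j, (((1 - a / 80) ^ j) ^ 2)⁻¹ = ν j := fun j => congrFun hνdef j
  simp only [hνj] at *
  generalize 1 / a = u at *
  generalize 1 / δ = z at *
  have hu4 : u ^ 4 ≤ κ ^ 4 * z ^ 4 := by
    rw [← mul_pow]
    gcongr
  have hz4 : 1 ≤ z ^ 4 := one_le_pow₀ hz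
  have hΛ2 : 1 ≤ Λ ^ 2 := one_le_pow₀ (by linarith)
  have hΛt0 : 0 < Λt := by linarith
  have hc0 := abs_nonneg c
  constructor
  · have hX : ∀ j (τ : ℝ), τ ^ 2 = stepTime Λt a ^ 2 →
        ((S τ (stepAcc a j)).prog.copies : ℝ) ≤ |c| * (25600 * ((p : ℝ) ^ 5 * u) * ν j) := by
      intro j τ hτ
      refine ((hS τ _ (hacc j) (hacc1 j)).1).trans ?_
      have e : (p : ℝ) ^ 5 * Λt ^ 2 * τ ^ 2 / stepAcc a j ^ 2 =
          25600 * ((p : ℝ) ^ 5 * u) * ν j := by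
        rw [hτ, mul_div_assoc, hεeq]
        field_simp
      have h1 : 1 ≤ 25600 * ((p : ℝ) ^ 5 * u) * ν j :=
        one_le_mul_of_one_le_of_one_le (by nlinarith) (hν j)
      rw [e, max_eq_right h1]
      exact mul_le_mul_of_nonneg_right (le_abs_self c) (by linarith)
    have h1 : ∀ j ∈ Finset.range r, 1 + ((S (stepTime Λt a) (stepAcc a j)).prog.copies : ℝ) +
        (S (-stepTime Λt a) (stepAcc a j)).prog.copies ≤
          (4 + 2 * |c|) * (25600 * ((p : ℝ) ^ 5 * u)) * ν j := by
      intro j _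
      have e1 := hX j _ rfl
      have e2 := hX j (-stepTime Λt a) (neg_sq _)
      have e3 : 1 ≤ 25600 * ((p : ℝ) ^ 5 * u) * ν j :=
        one_le_mul_of_one_le_of_one_le (by nlinarith) (hν j)
      linarith
    have h2 := Finset.sum_le_sum h1
    rw [← Finset.mul_sum] at h2
    have h3 : (4 + 2 * |c|) * (25600 * ((p : ℝ) ^ 5 * u)) * ∑ j ∈ Finset.range r, ν j ≤
        (4 + 2 * |c|) * (25600 * ((p : ℝ) ^ 5 * u)) * (80 * u ^ 3) := by
      gcongr
    -- The powers of Λt have cancelled, so the factor Λ² of the bound is inserted by 1 ≤ Λ².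
    have h4 : (4 + 2 * |c|) * (25600 * ((p : ℝ) ^ 5 * u)) * (80 * u ^ 3) ≤
        80 * 25600 * κ ^ 4 * (4 + 2 * |c|) * ((p : ℝ) ^ 5 * Λ ^ 2 * z ^ 4) := by
      calc (4 + 2 * |c|) * (25600 * ((p : ℝ) ^ 5 * u)) * (80 * u ^ 3)
          = 80 * 25600 * (4 + 2 * |c|) * ((p : ℝ) ^ 5 * 1 * u ^ 4) := by ring
        _ ≤ 80 * 25600 * (4 + 2 * |c|) * ((p : ℝ) ^ 5 * Λ ^ 2 * (κ ^ 4 * z ^ 4)) := by gcongr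
        _ = _ := by ring
    have h5 : 1 ≤ (p : ℝ) ^ 5 * Λ ^ 2 * z ^ 4 :=
      one_le_mul_of_one_le_of_one_le (one_le_mul_of_one_le_of_one_le hp1 hΛ2) hz4
    linarith
  · have hΛ3 : 1 ≤ Λ ^ 3 := one_le_pow₀ (by linarith)
    have hΛ3' : Λt ≤ Λ ^ 3 := hΛ.trans (le_self_pow₀ (by linarith) (by norm_num))
    have hB1 : 1 ≤ (p : ℝ) ^ 5 * Λ ^ 3 * s * z ^ 4 * n :=
      one_le_mul_of_one_le_of_one_le (one_le_mul_of_one_le_of_one_le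
        (one_le_mul_of_one_le_of_one_le (one_le_mul_of_one_le_of_one_le hp1 hΛ3) hs1) hz4) hn1
    set κ' := 1 + 80 * 25600 * κ ^ 4 * (4 + 2 * |c|) with hκ'
    set W := (p : ℝ) ^ 5 * Λ ^ 3 * s * z ^ 4 * n with hW
    have hlog : 1 ≤ Real.log (2 + κ' * W) ^ k :=
      one_le_pow₀ (one_le_log (one_le_mul_of_one_le_of_one_le hκ'1 hB1))
    set Y := (p : ℝ) ^ 5 * Λt * s * n * u with hY
    have hY1 : 1 ≤ Y :=
      one_le_mul_of_one_le_of_one_le (one_le_mul_of_one_le_of_one_le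
        (one_le_mul_of_one_le_of_one_le (one_le_mul_of_one_le_of_one_le hp1 hΛt) hs1) hn1) hu
    have hYu : Y * u ^ 3 ≤ κ ^ 4 * W := by
      calc Y * u ^ 3 = (p : ℝ) ^ 5 * Λt * s * n * u ^ 4 := by rw [hY]; ring
        _ ≤ (p : ℝ) ^ 5 * Λ ^ 3 * s * n * (κ ^ 4 * z ^ 4) := by gcongr
        _ = _ := by rw [hW]; ring
    have hYν1 : ∀ j, 1 ≤ 25600 * Y * ν j := fun j =>
      one_le_mul_of_one_le_of_one_le (by linarith) (hν j)
    -- A bound uniform in the trials is needed only inside the logarithm; outside it the individual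
    -- ν j are kept so that their sum stays geometric.
    have hYν : ∀ j < r, 25600 * Y * ν j ≤ κ' * W := by
      intro j hj
      have e1 : Y * ν j ≤ Y * u ^ 3 := by
        have := hν2 j hj
        have e2 : u ^ 2 ≤ u ^ 3 := pow_le_pow_right₀ hu (by norm_num)
        gcongr
        linarith
      have e3 : 0 ≤ κ ^ 4 * W := by positivity
      have e4 : 0 ≤ |c| * (κ ^ 4 * W) := by positivity
      have e5 : κ' * W = W + 80 * 25600 * 4 * (κ ^ 4 * W) + 80 * 25600 * 2 * (|c| * (κ ^ 4 * W)) := by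
        rw [hκ']; ring
      linarith
    set l := Real.log (2 + κ' * W) ^ k with hl
    have hX : ∀ j < r, ∀ τ : ℝ, τ ^ 2 = stepTime Λt a ^ 2 →
        ((S τ (stepAcc a j)).prog.gates : ℝ) ≤ |c| * (25600 * Y * ν j) * l := by
      intro j hj τ hτ
      refine ((hS τ _ (hacc j) (hacc1 j)).2).trans ?_
      have e : (p : ℝ) ^ 5 * Λt ^ 3 * τ ^ 2 * s * n / stepAcc a j ^ 2 = 25600 * Y * ν j := by
        have e1 : (p : ℝ) ^ 5 * Λt ^ 3 * τ ^ 2 * s * n / stepAcc a j ^ 2 =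
            (p : ℝ) ^ 5 * Λt ^ 3 * s * n * (stepTime Λt a ^ 2 / stepAcc a j ^ 2) := by
          rw [hτ]; ring
        rw [e1, hεeq, hY]
        field_simp
      rw [e, max_eq_right (hYν1 j)]
      exact softO_le_abs (by have := hYν1 j; linarith) (hYν j hj)
    have h1 : ∀ j ∈ Finset.range r, 4 + ((S (stepTime Λt a) (stepAcc a j)).prog.gates : ℝ) +
        (S (-stepTime Λt a) (stepAcc a j)).prog.gates ≤
          (4 + 2 * |c|) * (25600 * Y) * l * ν j := by
      intro j hj
      have e1 := hX j (Finset.mem_range.1 hj) _ rfl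
      have e2 := hX j (Finset.mem_range.1 hj) (-stepTime Λt a) (neg_sq _)
      have e3 : 1 ≤ 25600 * Y * ν j * l := one_le_mul_of_one_le_of_one_le (hYν1 j) hlog
      have e4 : (4 + 2 * |c|) * (25600 * Y) * l * ν j =
        4 * (25600 * Y * ν j * l) + 2 * (|c| * (25600 * Y * ν j) * l) := by ring
      linarith
    have h2 := Finset.sum_le_sum h1
    rw [← Finset.mul_sum] at h2
    have h3 : (4 + 2 * |c|) * (25600 * Y) * l * ∑ j ∈ Finset.range r, ν j ≤
        (4 + 2 * |c|) * (25600 * Y) * l * (80 * u ^ 3) := by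
      gcongr
    have h4 : (4 + 2 * |c|) * (25600 * Y) * l * (80 * u ^ 3) ≤ κ' * W * l := by
      calc (4 + 2 * |c|) * (25600 * Y) * l * (80 * u ^ 3)
          = 80 * 25600 * (4 + 2 * |c|) * (Y * u ^ 3) * l := by ring
        _ ≤ 80 * 25600 * (4 + 2 * |c|) * (κ ^ 4 * W) * l := by gcongr
        _ ≤ W * l + 80 * 25600 * (4 + 2 * |c|) * (κ ^ 4 * W) * l :=
            le_add_of_nonneg_left (by positivity)
        _ = κ' * W * l := by rw [hκ']; ring
    linarith

end SampleBased

/-! ### Assembling the two resource bounds -/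

section Main

variable {n p b : ℕ}

/-- For T = 0 the supremum over the empty type is 0 and not a bound ≥ 1. Since only T-th powers of
the base occur, any other value serves in that case. -/
lemma exists_normBound {T : ℕ} {ΛD : ℕ → ℝ} (h : ∀ t < T, 1 ≤ ΛD t) :
    ∃ Λ : ℝ, 1 ≤ Λ ∧ (∀ t < T, ΛD t ≤ Λ) ∧ (Λ = maxNorm T ΛD ∨ T = 0) := by
  rcases T with _ | T
  · exact ⟨1, le_rfl, by simp, .inr rfl⟩
  · exact ⟨_, (h 0 T.succ_pos).trans (le_maxNorm ΛD T.succ_pos), fun t ht => le_maxNorm ΛD ht,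
      .inl rfl⟩

lemma SimulatesGradient.of_le {S : ℝ → ℝ → Circuit n p b (Option (Fin n))} {O : Oracles n p b}
    {A : Matrix (Idx n p) (Idx n p) ℝ} {x : Vec n} {L L' : ℝ} {𝒮 𝒮' : Set (Op (Fin n))}
    (h : SimulatesGradient S O A x L 𝒮) (hL : L ≤ L') (h' : 𝒮' ⊆ 𝒮) :
    SimulatesGradient S O A x L' 𝒮' := fun ρ hρ => by
  obtain ⟨D, h1, h2, h3⟩ := h ρ (h' hρ)
  have : 0 ≤ traceDist ρ (pureState x) := div_nonneg (traceNorm_nonneg _) zero_le_two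
  exact ⟨D, h1, h2.trans (by gcongr), h3⟩

lemma encodings_mono {x : Vec n} {δ δ' : ℝ} (h : δ ≤ δ') : encodings x δ ⊆ encodings x δ' :=
  fun _ hρ => ⟨hρ.1, hρ.2.trans h⟩

lemma logb_two_pow (n : ℕ) : Real.logb 2 (2 ^ n) = n := by
  rw [Real.logb_pow, Real.logb_self_eq_one (by norm_num), mul_one]

lemma one_le_polyVal_basePoly (P : MvPolynomial (Fin 5) ℕ) (G : MvPolynomial (Fin 3) ℕ)
    {w x y z : ℝ} (hw : 0 ≤ w) (hx : 0 ≤ x) (hy : 0 ≤ y) (hz : 1 ≤ z) :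
    1 ≤ polyVal (basePoly P G) ![w, x, y, z] := by
  have h0 := sq_nonneg z
  have h1 : 0 ≤ polyVal P ![w, x, y, 1, z ^ 2] :=
    polyVal_nonneg P (by intro i; fin_cases i <;> simp <;> linarith)
  have h2 : 0 ≤ polyVal G ![w, x, y] :=
    polyVal_nonneg G (by intro i; fin_cases i <;> simp <;> linarith)
  rw [polyVal_basePoly]
  exact one_le_mul_of_one_le_of_one_le
    (one_le_mul_of_one_le_of_one_le (by linarith) (by linarith)) (one_le_pow₀ hz)

lemma exists_attempts_forall {T : ℕ} {a : ℕ → ℝ} (ha : ∀ t, 0 < a t) (ha1 : ∀ t < T, a t ≤ 1) :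
    ∃ r : ℕ → ℕ, ∀ t < T, (1 - a t / 80) ^ r t ≤ a t ∧
      (∀ j < r t, a t < (1 - a t / 80) ^ j) ∧
      ∑ j ∈ Finset.range (r t), (((1 - a t / 80) ^ j) ^ 2)⁻¹ ≤ 80 / a t ^ 3 := by
  have h : ∀ t, ∃ r : ℕ, t < T → (1 - a t / 80) ^ r ≤ a t ∧
      (∀ j < r, a t < (1 - a t / 80) ^ j) ∧
      ∑ j ∈ Finset.range r, (((1 - a t / 80) ^ j) ^ 2)⁻¹ ≤ 80 / a t ^ 3 := fun t => by
    by_cases ht : t < T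
    · obtain ⟨r, h⟩ := exists_attempts (ha t) (ha1 t ht)
      exact ⟨r, fun _ => h⟩
    · exact ⟨0, fun h => absurd h ht⟩
  choose r hr using h
  exact ⟨r, hr⟩

lemma exists_descentCircuit_polynomial (P : MvPolynomial (Fin 5) ℕ) (G : MvPolynomial (Fin 3) ℕ)
    (c : ℝ) (k T : ℕ) (c₀ L : ℝ) : ∃ (C : ℝ) (K : ℕ),
      ∀ (n p s b χ : ℕ) (δ : ℝ) (η ΛD : ℕ → ℝ), Schedule n p s T c₀ δ η ΛD →
      ∀ S : SimMethod n p b,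
        (∀ t < T, ∀ τ ε : ℝ, 0 < ε → ε < 1 →
          ((S t τ ε).prog.copies : ℝ) ≤ polyVal P ![p, s, ΛD t, |τ|, 1 / ε] ∧
          ((S t τ ε).prog.gates : ℝ) ≤ polyVal P ![p, s, ΛD t, |τ|, 1 / ε] *
            softO c k (polyVal G ![p, s, ΛD t] * n)) →
        ∃ Z : Circuit n p b (Fin n),
          (Z.prog.copies : ℝ) ≤ C * polyVal (basePoly P G) ![p, s, maxNorm T ΛD, 1 / δ] ^ T ∧
          (Z.prog.gates : ℝ) ≤
            softO C K (polyVal (basePoly P G) ![p, s, maxNorm T ΛD, 1 / δ] ^ T * n) ∧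
          ∀ (A : Matrix (Idx n p) (Idx n p) ℝ) (x₀ : Vec n) (O : Oracles n p b),
            Problem s T χ η ΛD A x₀ O →
            (∀ t < T, SimulatesGradient (S t) O A (trajectory A x₀ η t) L
              (encodings (trajectory A x₀ η t) δ)) →
            Z.Prepares O x₀ (trajectory A x₀ η T) δ := by
  -- The sign of `L` is not prescribed; enlarging it weakens the Lipschitz condition.
  have hL : 0 ≤ max L 0 := le_max_right _ _
  obtain ⟨κ, hκ, hacc⟩ := exists_accuracies hL le_rfl T
  obtain ⟨κ', hκ', hcost⟩ := step_cost_polynomial P G c k hκ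
  refine ⟨max (κ' ^ T) (T * κ' ^ T * (1 + Real.log κ') ^ k), k,
    fun n p s b χ δ η ΛD hsch S hS => ?_⟩
  obtain ⟨a, ha, has, haδ⟩ := hacc δ hsch.δ_pos hsch.δ_le
  have hδ1 := hsch.δ_le
  have haM : ∀ t ≤ T, a t ≤ δ := fun t ht => by
    have h1 := (haδ t ht).2
    have h2 : 0 ≤ max L 0 * a t := mul_nonneg hL (ha t).le
    have h3 := ha t
    linarith
  obtain ⟨r, hr⟩ := exists_attempts_forall ha fun t ht => (haM t ht.le).trans hδ1
  obtain ⟨Λ, hΛ1, hΛ, hΛT⟩ := exists_normBound hsch.ΛD_ge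
  have hsteps := fun t (ht : t < T) => hcost n p s b δ (ΛD t) Λ (a t) hsch.n_pos hsch.δ_pos hδ1
    (hsch.ΛD_ge t ht) (hΛ t ht) (ha t) ((haM t ht.le).trans hδ1) (haδ t ht.le).1 (S t) (hS t ht)
    (r t) (hr t ht).2.1 (hr t ht).2.2
  have hz : 1 ≤ 1 / δ := by rwa [le_div_iff₀ hsch.δ_pos, one_mul]
  have hB1 := one_le_polyVal_basePoly P G (Nat.cast_nonneg (α := ℝ) p) (Nat.cast_nonneg (α := ℝ) s)
    (by linarith : 0 ≤ Λ) hz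
  have hBT : polyVal (basePoly P G) ![p, s, Λ, 1 / δ] ^ T =
      polyVal (basePoly P G) ![p, s, maxNorm T ΛD, 1 / δ] ^ T := by
    rcases hΛT with h | h
    · rw [h]
    · simp [h]
  rw [← hBT]
  set B := polyVal (basePoly P G) ![p, s, Λ, 1 / δ]
  obtain ⟨Z, h1, h2, h3⟩ := exists_descentCircuit (χ := χ) hsch S hL a (fun t _ => ha t)
    (fun t ht => (haδ t ht.le).2.trans hδ1) (fun t _ => has t) (haM T le_rfl) r
    (fun t ht => (hr t ht).1) (by positivity) (fun t ht => (hsteps t ht).1)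
    fun t ht => (hsteps t ht).2
  refine ⟨Z, h1.trans ?_, h2.trans ?_, fun A x₀ O hP hsim => h3 A x₀ O hP fun t ht _ =>
    (hsim t ht).of_le (le_max_left _ _) (encodings_mono (haM t ht.le))⟩
  · rw [mul_pow]
    gcongr
    exact le_max_left _ _
  · exact (mul_geom_sum_le_softO hκ' hB1 (by exact_mod_cast hsch.n_pos) (by positivity) le_rfl
      le_rfl).trans (softO_mono (le_max_right _ _) (by positivity))

/-- Compared with the generic method, the intermediate accuracies must also be small relative to β².
Then `mem_iidErrorModel` places every intermediate state in the class on which the simulation is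
guaranteed to work. -/
lemma exists_descentCircuit_sampleBased (c : ℝ) (k T : ℕ) (c₀ L : ℝ) {β : ℝ} (hβ : 0 < β) :
    ∃ (C : ℝ) (K : ℕ),
      ∀ (n p s b χ : ℕ) (δ : ℝ) (η ΛD : ℕ → ℝ), Schedule n p s T c₀ δ η ΛD →
      ∀ S : SimMethod n p b,
        (∀ t < T, ∀ τ ε : ℝ, 0 < ε → ε < 1 →
          ((S t τ ε).prog.copies : ℝ) ≤ c * max 1 ((p : ℝ) ^ 5 * ΛD t ^ 2 * τ ^ 2 / ε ^ 2) ∧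
          ((S t τ ε).prog.gates : ℝ) ≤
            softO c k (max 1 ((p : ℝ) ^ 5 * ΛD t ^ 3 * τ ^ 2 * s * n / ε ^ 2))) →
        ∃ Z : Circuit n p b (Fin n),
          (Z.prog.copies : ℝ) ≤ C * ((p : ℝ) ^ 5 * maxNorm T ΛD ^ 2 / δ ^ 4) ^ T ∧
          (Z.prog.gates : ℝ) ≤
            softO C K (((p : ℝ) ^ 5 * maxNorm T ΛD ^ 3 * s / δ ^ 4) ^ T * n) ∧
          ∀ (A : Matrix (Idx n p) (Idx n p) ℝ) (x₀ : Vec n) (O : Oracles n p b),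
            Problem s T χ η ΛD A x₀ O →
            (∀ t < T, SimulatesGradient (S t) O A (trajectory A x₀ η t) L
              (encodings (trajectory A x₀ η t) δ ∩ iidErrorModel (trajectory A x₀ η t) β)) →
            Z.Prepares O x₀ (trajectory A x₀ η T) δ := by
  have hL : 0 ≤ max L 0 := le_max_right _ _
  -- The second entry of the maximum yields 16·a_t ≤ β²δ ≤ β², the condition for membership in the
  -- i.i.d. error model.
  obtain ⟨κ, hκ, hacc⟩ := exists_accuracies hL
    (le_max_left (16 * (29 / 2 + 2 * max L 0)) (16 / β ^ 2)) T
  obtain ⟨κ', hκ', hcost⟩ := step_cost_sampleBased c k hκ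
  refine ⟨max (κ' ^ T) (T * κ' ^ T * (1 + Real.log κ') ^ k), k,
    fun n p s b χ δ η ΛD hsch S hS => ?_⟩
  obtain ⟨a, ha, has, haδ⟩ := hacc δ hsch.δ_pos hsch.δ_le
  have hδ0 := hsch.δ_pos
  have hδ1 := hsch.δ_le
  have haL : ∀ t ≤ T, 16 * (29 / 2 + 2 * max L 0) * a t ≤ δ := fun t ht =>
    (mul_le_mul_of_nonneg_right (le_max_left _ _) (ha t).le).trans (haδ t ht).2
  have haβ : ∀ t ≤ T, 16 * a t ≤ β ^ 2 := fun t ht => by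
    have h1 := (mul_le_mul_of_nonneg_right (le_max_right _ _) (ha t).le).trans (haδ t ht).2
    rw [div_mul_eq_mul_div, div_le_iff₀ (by positivity)] at h1
    exact h1.trans (mul_le_of_le_one_left (by positivity) hδ1)
  have haM : ∀ t ≤ T, a t ≤ δ := fun t ht => by
    have h1 := haL t ht
    have h2 : 0 ≤ max L 0 * a t := mul_nonneg hL (ha t).le
    have h3 := ha t
    linarith
  obtain ⟨r, hr⟩ := exists_attempts_forall ha fun t ht => (haM t ht.le).trans hδ1
  obtain ⟨Λ, hΛ1, hΛ, hΛT⟩ := exists_normBound hsch.ΛD_ge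
  have hsteps := fun t (ht : t < T) => hcost n p s b δ (ΛD t) Λ (a t) hsch.n_pos hsch.p_pos
    hsch.s_pos hsch.δ_pos (hsch.ΛD_ge t ht) (hΛ t ht) (ha t) ((haM t ht.le).trans hδ1) hδ1
    (haδ t ht.le).1 (S t) (hS t ht) (r t) (hr t ht).2.1 (hr t ht).2.2
  have hp1 : (1 : ℝ) ≤ (p : ℝ) ^ 5 := one_le_pow₀ (by exact_mod_cast hsch.p_pos)
  have hs1 : (1 : ℝ) ≤ s := by exact_mod_cast hsch.s_pos
  have hδ4 : δ ^ 4 ≤ 1 := pow_le_one₀ hδ0.le hδ1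
  have hB1 : 1 ≤ (p : ℝ) ^ 5 * Λ ^ 3 * s / δ ^ 4 := by
    rw [le_div_iff₀ (by positivity), one_mul]
    exact hδ4.trans (one_le_mul_of_one_le_of_one_le
      (one_le_mul_of_one_le_of_one_le hp1 (one_le_pow₀ hΛ1)) hs1)
  have hBB : (p : ℝ) ^ 5 * Λ ^ 2 / δ ^ 4 ≤ (p : ℝ) ^ 5 * Λ ^ 3 * s / δ ^ 4 := by
    have h1 : Λ ^ 2 ≤ Λ ^ 3 := pow_le_pow_right₀ hΛ1 (by norm_num)
    have h2 : (p : ℝ) ^ 5 * Λ ^ 2 ≤ (p : ℝ) ^ 5 * Λ ^ 3 := by gcongr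
    exact div_le_div_of_nonneg_right (h2.trans (le_mul_of_one_le_right (by positivity) hs1))
      (by positivity)
  have hBT : ((p : ℝ) ^ 5 * Λ ^ 2 / δ ^ 4) ^ T = ((p : ℝ) ^ 5 * maxNorm T ΛD ^ 2 / δ ^ 4) ^ T ∧
      ((p : ℝ) ^ 5 * Λ ^ 3 * s / δ ^ 4) ^ T =
        ((p : ℝ) ^ 5 * maxNorm T ΛD ^ 3 * s / δ ^ 4) ^ T := by
    rcases hΛT with h | h
    · rw [h]
      exact ⟨rfl, rfl⟩
    · simp [h]
  rw [← hBT.1, ← hBT.2]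
  obtain ⟨Z, h1, h2, h3⟩ := exists_descentCircuit (χ := χ) hsch S hL a (fun t _ => ha t)
    (fun t ht => (haL t ht.le).trans hδ1) (fun t _ => has t) (haM T le_rfl) r
    (fun t ht => (hr t ht).1) (by positivity) (fun t ht => (hsteps t ht).1)
    fun t ht => (hsteps t ht).2
  refine ⟨Z, h1.trans ?_, h2.trans ?_, fun A x₀ O hP hsim => h3 A x₀ O hP fun t ht hx =>
    (hsim t ht).of_le (le_max_left _ _) fun ρ hρ => ⟨encodings_mono (haM t ht.le) hρ, ?_⟩⟩
  · rw [mul_pow]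
    gcongr
    exact le_max_left _ _
  · exact (mul_geom_sum_le_softO hκ' hB1 (by exact_mod_cast hsch.n_pos) (by positivity)
      (by gcongr) le_rfl).trans (softO_mono (le_max_right _ _) (by positivity))
  -- This is where the unit norm of the iterate is needed, which is why `exists_descentCircuit`
  -- supplies it to the simulation hypothesis.
  · refine mem_iidErrorModel hx hρ.1 ?_ hβ.le (haβ t ht.le)
    have := hρ.2
    rw [traceDist] at this
    linarith

end Main

end

end QGD

theorem mainTheorem3 :
    -- generic simulation method, with polynomial resources
    (∀ (P : MvPolynomial (Fin 5) ℕ) (G : MvPolynomial (Fin 3) ℕ),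
      ∃ R : MvPolynomial (Fin 4) ℕ,
        ∀ (c : ℝ) (k : ℕ) (T : ℕ) (c₀ L : ℝ), ∃ (C : ℝ) (K : ℕ),
          ∀ (n p s b χ : ℕ) (δ : ℝ) (η ΛD : ℕ → ℝ), QGD.Schedule n p s T c₀ δ η ΛD →
          ∀ S : QGD.SimMethod n p b,
            (∀ t < T, ∀ τ ε : ℝ, 0 < ε → ε < 1 →
              ((S t τ ε).prog.copies : ℝ) ≤ QGD.polyVal P ![p, s, ΛD t, |τ|, 1 / ε] ∧
              ((S t τ ε).prog.queries : ℝ) ≤ QGD.polyVal P ![p, s, ΛD t, |τ|, 1 / ε] ∧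
              ((S t τ ε).prog.gates : ℝ) ≤ QGD.polyVal P ![p, s, ΛD t, |τ|, 1 / ε] *
                QGD.softO c k (QGD.polyVal G ![p, s, ΛD t] * Real.logb 2 (2 ^ n))) →
            ∃ Z : QGD.Circuit n p b (Fin n),
              (Z.prog.copies : ℝ) ≤
                C * QGD.polyVal R ![p, s, QGD.maxNorm T ΛD, 1 / δ] ^ T ∧
              (Z.prog.gates : ℝ) ≤
                QGD.softO C K (QGD.polyVal R ![p, s, QGD.maxNorm T ΛD, 1 / δ] ^ T *
                  Real.logb 2 (2 ^ n)) ∧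
              ∀ (A : Matrix (QGD.Idx n p) (QGD.Idx n p) ℝ) (x₀ : QGD.Vec n)
                (O : QGD.Oracles n p b), QGD.Problem s T χ η ΛD A x₀ O →
                (∀ t < T, QGD.SimulatesGradient (S t) O A (QGD.trajectory A x₀ η t) L
                  (QGD.encodings (QGD.trajectory A x₀ η t) δ)) →
                Z.Prepares O x₀ (QGD.trajectory A x₀ η T) δ) ∧
    -- i.i.d. error model, with the resources of the sample-based simulation method
    (∀ (c : ℝ) (k : ℕ) (T : ℕ) (c₀ L β : ℝ), 0 < β → ∃ (C : ℝ) (K : ℕ),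
      ∀ (n p s b χ : ℕ) (δ : ℝ) (η ΛD : ℕ → ℝ), QGD.Schedule n p s T c₀ δ η ΛD →
      ∀ S : QGD.SimMethod n p b,
        (∀ t < T, ∀ τ ε : ℝ, 0 < ε → ε < 1 →
          ((S t τ ε).prog.copies : ℝ) ≤
            c * max 1 ((p : ℝ) ^ 5 * ΛD t ^ 2 * τ ^ 2 / ε ^ 2) ∧
          ((S t τ ε).prog.queries : ℝ) ≤
            c * max 1 ((p : ℝ) ^ 4 * ΛD t ^ 3 * τ ^ 2 * s / ε ^ 2) ∧
          ((S t τ ε).prog.gates : ℝ) ≤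
            QGD.softO c k (max 1 ((p : ℝ) ^ 5 * ΛD t ^ 3 * τ ^ 2 * s *
              Real.logb 2 (2 ^ n) / ε ^ 2))) →
        ∃ Z : QGD.Circuit n p b (Fin n),
          (Z.prog.copies : ℝ) ≤
            C * ((p : ℝ) ^ (5 * T) * QGD.maxNorm T ΛD ^ (2 * T) / δ ^ (4 * T)) ∧
          (Z.prog.gates : ℝ) ≤
            QGD.softO C K ((p : ℝ) ^ (5 * T) * QGD.maxNorm T ΛD ^ (3 * T) * (s : ℝ) ^ T /
              δ ^ (4 * T) * Real.logb 2 (2 ^ n)) ∧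
          ∀ (A : Matrix (QGD.Idx n p) (QGD.Idx n p) ℝ) (x₀ : QGD.Vec n)
            (O : QGD.Oracles n p b), QGD.Problem s T χ η ΛD A x₀ O →
            (∀ t < T, QGD.SimulatesGradient (S t) O A (QGD.trajectory A x₀ η t) L
              (QGD.encodings (QGD.trajectory A x₀ η t) δ ∩
                QGD.iidErrorModel (QGD.trajectory A x₀ η t) β)) →
            Z.Prepares O x₀ (QGD.trajectory A x₀ η T) δ) := by
  refine ⟨fun P G => ⟨QGD.basePoly P G, fun c k T c₀ L => ?_⟩, fun c k T c₀ L β hβ => ?_⟩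
  · obtain ⟨C, K, h⟩ := QGD.exists_descentCircuit_polynomial P G c k T c₀ L
    simp only [QGD.logb_two_pow]
    exact ⟨C, K, fun n p s b χ δ η ΛD hsch S hS => h n p s b χ δ η ΛD hsch S
      fun t ht τ ε hε hε1 => ⟨(hS t ht τ ε hε hε1).1, (hS t ht τ ε hε hε1).2.2⟩⟩
  · obtain ⟨C, K, h⟩ := QGD.exists_descentCircuit_sampleBased c k T c₀ L hβ
    simp only [QGD.logb_two_pow]
    refine ⟨C, K, fun n p s b χ δ η ΛD hsch S hS => ?_⟩
    obtain ⟨Z, h1, h2, h3⟩ := h n p s b χ δ η ΛD hsch S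
      fun t ht τ ε hε hε1 => ⟨(hS t ht τ ε hε hε1).1, (hS t ht τ ε hε hε1).2.2⟩
    rw [div_pow, mul_pow, ← pow_mul, ← pow_mul, ← pow_mul] at h1
    rw [div_pow, mul_pow, mul_pow, ← pow_mul, ← pow_mul, ← pow_mul] at h2
    exact ⟨Z, h1, h2, h3⟩
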